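/- Let $H$ be an infinite-dimensional real Hilbert space, let $A:D(A)\to H$ be a positive self-adjoint operator with compact inverse, let $\lambda_1\le\lambda_2\le\cdots$ be its eigenvalues (with multiplicity) and $\{e_n\}_{n\ge1}$ a corresponding complete orthonormal system of eigenvectors, and put $\|u\|_{H^s}^2=\sum_n\lambda_n^s(u,e_n)^2$ and $P_NH=\operatorname{span}\{e_1,\dots,e_N\}$. Let $F:H\to H$ satisfy $\|F(u_1)-F(u_2)\|_H\le L\|u_1-u_2\|_H$ for all $u_1,u_2\in H$, and $F(0)=0$. Let $\varepsilon>0$ and $N\ge1$ satisfy $$\lambda_{N+1}-\lambda_N>2L,\qquad 3\lambda_{N+1}+\lambda_N\le\frac1\varepsilon .$$ Consider $$\varepsilon\,\partial_t^2u+\partial_tu+Au=F(u)\qquad(\ast)$$ in the energy space $\mathcal E_\varepsilon=H^1\times H$, $\|(u,v)\|_{\mathcal E_\varepsilon}^2=\varepsilon\|v\|_H^2+\|v\|_{H^{-1}}^2+\|u\|_{H^1}^2$. A solution on an interval $I$ is a curve $\xi_u=(u,\partial_tu)\in C(I,\mathcal E_\varepsilon)$ that satisfies $(\ast)$ weakly,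 i.e. tested with every $\varphi\in D(A)$. For every $\xi_0\in\mathcal E_\varepsilon$ there is a unique solution on $[0,\infty)$ with $\xi_u(0)=\xi_0$; let $S_\varepsilon(t)\xi_0=\xi_u(t)$, $t\ge0$, be the solution semigroup. Let $\theta$ be the smallest root of $2\theta(\varepsilon\theta-1)+\lambda_{N+1}+\lambda_N=0$ (it is real and positive). Then $(\ast)$ possesses an $N$-dimensional Lipschitz inertial manifold $\mathcal M\subset\mathcal E_\varepsilon$, namely $$\mathcal M=\{\xi_u(0):\ \xi_u \text{ is a solution of }(\ast)\text{ on }\mathbb R_-=(-\infty,0],\ u\in L^2_{e^{\theta t}}(\mathbb R_-,H)\},\qquad \|u\|^2_{L^2_{e^{\theta t}}(\mathbb R_-,H)}=\int_{-\infty}^0e^{2\theta t}\|u(t)\|_H^2\,dt .$$ That is: 1. $\mathcal M=M(P_NH)$ for an injective Lipschitz map $M:P_NH\to\mathcal E_\varepsilon$ with Lipschitz inverse $\mathcal M\to P_NH$. Moreover $\widetilde{\mathcal P}_N M(p)=p$ for all $p\in P_NH$, where, with $d_n=\sqrt{1-4\varepsilon\lambda_n}$, $$\widetilde{\mathcal P}_N(u,v)=\sum_{n=1}^N\Big(\frac{\varepsilon}{d_n}(v,e_n)+\frac{1+d_n}{2d_n}(u,e_n)\Big)e_n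 ,$$ so that $\mathcal M$ is a Lipschitz graph over an $N$-dimensional subspace of $\mathcal E_\varepsilon$ along $\ker\widetilde{\mathcal P}_N$. 2. $\mathcal M$ is strictly invariant: $S_\varepsilon(t)\mathcal M=\mathcal M$ for all $t\ge0$. 3. $\mathcal M$ has the exponential tracking property: there is $C>0$ such that for every $\xi_0\in\mathcal E_\varepsilon$ there is $\bar\xi_0\in\mathcal M$ with $$\|S_\varepsilon(t)\xi_0-S_\varepsilon(t)\bar\xi_0\|_{\mathcal E_\varepsilon}\le C\|\xi_0\|_{\mathcal E_\varepsilon}e^{-\theta t}\qquad\text{for all }t\ge0 .$$ -/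

import Mathlib

open scoped InnerProductSpace Topology

noncomputable section

variable {H : Type*} [NormedAddCommGroup H] [InnerProductSpace ℝ H]

/-- `A : D(A) → H` is a positive self-adjoint (in general unbounded) operator whose inverse is
an everywhere defined compact operator. -/
structure IsPositiveSelfAdjointCompactInverse [CompleteSpace H] (A : H →ₗ.[ℝ] H) : Prop where
  selfAdjoint : IsSelfAdjoint A
  positive : ∀ x : A.domain, (x : H) ≠ 0 → 0 < ⟪A x, (x : H)⟫_ℝ
  compactInverse : ∃ K : H →L[ℝ] H, IsCompactOperator K ∧
    (∀ y : H, ∃ hy : K y ∈ A.domain, A ⟨K y, hy⟩ = y) ∧ (∀ x : A.domain, K (A x) = x)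

/-- `lam 1 ≤ lam 2 ≤ …` are the eigenvalues of `A` (with multiplicity) in non-decreasing order and
the complete orthonormal system `e` consists of corresponding eigenvectors. -/
structure IsEigensystem (A : H →ₗ.[ℝ] H) (e : HilbertBasis ℕ+ ℝ H) (lam : ℕ+ → ℝ) : Prop where
  mem_domain : ∀ n, e n ∈ A.domain
  apply_eq : ∀ n, A ⟨e n, mem_domain n⟩ = lam n • e n
  monotone : Monotone lam

/-- `‖u‖²_{H^s} = ∑ λ_n^s (u, e_n)²` (meaningful when the series converges). -/
def hsNormSq (e : HilbertBasis ℕ+ ℝ H) (lam : ℕ+ → ℝ) (s : ℝ) (u : H) : ℝ :=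
  ∑' n, lam n ^ s * ⟪u, e n⟫_ℝ ^ 2

/-- `u ∈ H` belongs to `H^s = D(A^{s/2})`, `s ≥ 0`. -/
def MemHs (e : HilbertBasis ℕ+ ℝ H) (lam : ℕ+ → ℝ) (s : ℝ) (u : H) : Prop :=
  Summable fun n => lam n ^ s * ⟪u, e n⟫_ℝ ^ 2

/-- The energy space `H¹ × H` (the phase space for `ε > 0`), as a subset of `H × H`. Its topology
is always expressed through `energyNorm` below, never through the topology of `H × H`. -/
def energySpace (e : HilbertBasis ℕ+ ℝ H) (lam : ℕ+ → ℝ) : Set (H × H) :=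
  {ξ | MemHs e lam 1 ξ.1}

/-- `‖(u, v)‖_{𝓔_ε} = (ε ‖v‖²_H + ‖v‖²_{H⁻¹} + ‖u‖²_{H¹})^{1/2}`. -/
def energyNorm (e : HilbertBasis ℕ+ ℝ H) (lam : ℕ+ → ℝ) (ε : ℝ) (ξ : H × H) : ℝ :=
  Real.sqrt (ε * ‖ξ.2‖ ^ 2 + hsNormSq e lam (-1) ξ.2 + hsNormSq e lam 1 ξ.1)

/-- `ξ = (u, ∂ₜu) ∈ C(I, 𝓔_ε)` is a (weak) solution of `ε ∂ₜ²u + ∂ₜu + A u = F(u)` on the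
interval `I`: the derivative of `u` in `H` is the second component, and for every test vector
`φ ∈ D(A)`, `d/dt (ε (∂ₜu, φ)) + (∂ₜu, φ) + (u, A φ) = (F(u), φ)`. -/
structure IsSolutionOn (A : H →ₗ.[ℝ] H) (e : HilbertBasis ℕ+ ℝ H) (lam : ℕ+ → ℝ)
    (F : H → H) (ε : ℝ) (I : Set ℝ) (ξ : ℝ → energySpace e lam) : Prop where
  continuous : ∀ t ∈ I, Filter.Tendsto
    (fun s => energyNorm e lam ε ((ξ s : H × H) - (ξ t : H × H))) (𝓝[I] t) (𝓝 0)
  hasDeriv : ∀ t ∈ I, HasDerivWithinAt (fun s => (ξ s : H × H).1) (ξ t : H × H).2 I t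
  equation : ∀ φ : A.domain, ∀ t ∈ I,
    HasDerivWithinAt (fun s => ε * ⟪(ξ s : H × H).2, (φ : H)⟫_ℝ)
      (⟪F (ξ t : H × H).1, (φ : H)⟫_ℝ - ⟪(ξ t : H × H).2, (φ : H)⟫_ℝ
        - ⟪(ξ t : H × H).1, A φ⟫_ℝ) I t

/-- `S t`, `t ≥ 0`, is the solution semigroup: `t ↦ S t ξ₀` is the one and only solution on
`[0, ∞)` that starts at `ξ₀`. (The values of `S t` for `t < 0` are irrelevant.) -/
structure IsSolutionSemigroup (A : H →ₗ.[ℝ] H) (e : HilbertBasis ℕ+ ℝ H) (lam : ℕ+ → ℝ)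
    (F : H → H) (ε : ℝ) (S : ℝ → energySpace e lam → energySpace e lam) : Prop where
  initial : ∀ ξ₀, S 0 ξ₀ = ξ₀
  solution : ∀ ξ₀, IsSolutionOn A e lam F ε (Set.Ici 0) fun t => S t ξ₀
  unique : ∀ ξ : ℝ → energySpace e lam, IsSolutionOn A e lam F ε (Set.Ici 0) ξ →
    ∀ t, 0 ≤ t → ξ t = S t (ξ 0)

/-- The space `P_N H`, spanned by the first `N` eigenvectors. -/
def spectralSpace (e : HilbertBasis ℕ+ ℝ H) (N : ℕ+) : Submodule ℝ H :=
  Submodule.span ℝ (e '' Set.Icc 1 N)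

/-- The map `(u, v) ↦ ∑_{n ≤ N} (ε / d_n (v, e_n) + (1 + d_n) / (2 d_n) (u, e_n)) e_n`,
`d_n = √(1 - 4 ε λ_n)`, from the energy space to `P_N H`. Its `n`-th coefficient is that of the
slow exponential `e^{μ_n⁺ t}`, `μ_n⁺ = (-1 + d_n) / (2 ε)`, in the solution of
`ε y'' + y' + λ_n y = 0` with data `((u, e_n), (v, e_n))`. -/
def slowProjection (e : HilbertBasis ℕ+ ℝ H) (lam : ℕ+ → ℝ) (ε : ℝ) (N : ℕ+) (ξ : H × H) : H :=
  ∑ n ∈ Finset.Icc 1 N,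
    (ε / Real.sqrt (1 - 4 * ε * lam n) * ⟪ξ.2, e n⟫_ℝ
      + (1 + Real.sqrt (1 - 4 * ε * lam n)) / (2 * Real.sqrt (1 - 4 * ε * lam n))
        * ⟪ξ.1, e n⟫_ℝ) • e n

/-- `u ∈ L²_{e^{θ t}}(V, H)`: `u` is measurable on `V` and `∫_V e^{2 θ t} ‖u(t)‖² dt < ∞`. -/
def MemWeightedL2 (θ : ℝ) (V : Set ℝ) (u : ℝ → H) : Prop :=
  MeasureTheory.AEStronglyMeasurable u (MeasureTheory.volume.restrict V) ∧
    MeasureTheory.IntegrableOn (fun t => Real.exp (2 * θ * t) * ‖u t‖ ^ 2) V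

/-- The map `M : P_N H → 𝓔_ε` is a bi-Lipschitz parametrization of `𝓜`; so `𝓜` is an
`N`-dimensional Lipschitz submanifold of `𝓔_ε` with base `P_N H`. -/
structure IsLipschitzParametrization (e : HilbertBasis ℕ+ ℝ H) (lam : ℕ+ → ℝ) (ε : ℝ) (N : ℕ+)
    (M : spectralSpace e N → energySpace e lam) (𝓜 : Set (energySpace e lam)) : Prop where
  range_eq : Set.range M = 𝓜
  lipschitz : ∃ K : ℝ, ∀ p q,
    energyNorm e lam ε ((M p : H × H) - (M q : H × H)) ≤ K * ‖p - q‖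
  lipschitz_inverse : ∃ K : ℝ, ∀ p q,
    ‖p - q‖ ≤ K * energyNorm e lam ε ((M p : H × H) - (M q : H × H))

/-- `𝓜` is an inertial manifold with base `P_N H` for the semigroup `S`, with exponential tracking
at the rate `θ`. -/
structure IsInertialManifold (e : HilbertBasis ℕ+ ℝ H) (lam : ℕ+ → ℝ) (ε : ℝ) (N : ℕ+)
    (S : ℝ → energySpace e lam → energySpace e lam) (θ : ℝ)
    (𝓜 : Set (energySpace e lam)) : Prop where
  submanifold : ∃ M, IsLipschitzParametrization e lam ε N M 𝓜
  invariant : ∀ t, 0 ≤ t → S t '' 𝓜 = 𝓜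
  rate_pos : 0 < θ
  tracking : ∃ C : ℝ, 0 < C ∧ ∀ ξ₀ : energySpace e lam, ∃ η₀ ∈ 𝓜, ∀ t, 0 ≤ t →
    energyNorm e lam ε ((S t ξ₀ : H × H) - (S t η₀ : H × H))
      ≤ C * energyNorm e lam ε ξ₀ * Real.exp (-θ * t)

end

/-! ### Calculus of primitives of locally integrable functions. -/

noncomputable section
open MeasureTheory Set Filter

/-! The proof is the Lyapunov-Perron method in weighted L² spaces. Let m be the midpoint of the
spectral gap and δ > L half its width. Since θ - εθ² = m, the substitution w = e^{θt} u turns the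
equation into ε w'' + γ w' + (A - m) w = e^{θt} F(e^{-θt} w) with γ = 1 - 2εθ > 0. The right-hand
side is still Lipschitz in w with constant L, and every eigenvalue a of A - m satisfies |a| ≥ δ.

The decisive fact is that the solution operator h ↦ w of the linear equation has norm at most 1/δ on
L²(ℝ, H). For one mode this says |-εω² + iγω + a| ≥ δ for all real ω, which holds when |a| ≥ δ and
2εδ ≤ γ²; the last inequality is the hypothesis 3λ_{N+1} + λ_N ≤ 1/ε. `mode_sq_integral_le` proves
the bound without Fourier transform, by writing h² - δ²w² as a square plus a total derivative. Hence
an equation h = G(t, w), with G Lipschitz of constant L in w, is a contraction with factor L/δ < 1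
(`exists_fixedPoint`), and `norm_le_of_ae` is the matching a priori estimate.

This is used twice. For the manifold, the nonlinearity is switched off for t > 0 and replaced by a
pulse on (0,1). For the modes n ≤ N the component along the growing exponential at time 0 depends
only on the right-hand side at positive times, so the strength of the pulse prescribes the slow
projection (`inner_slow_unshift_evol`). This produces one backward solution for each p in P_N H,
with Lipschitz dependence on p, and `eq_backSolution` shows that there are no others with finite
weighted norm. For tracking, the curve φu + e^{-θt} w is made a solution on all of ℝ, where u is the
given trajectory and φ is a cutoff from 0 to 1. For t ≤ 0 it is e^{-θt} w, which puts its value at 0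
on the manifold; for t ≥ 1 it differs from u by e^{-θt} w, and the pointwise bound of w gives the
decay (`exists_tracking`).

Well-posedness is handled in the coordinates √λ_n (u, e_n) + i√ε (v, e_n). There ε u'' + A u = 0
generates a unitary group, the damping and the nonlinearity form a globally Lipschitz field, and the
interaction picture is an ordinary differential equation (`isModalSolution_iff`). The resulting flow
is a group, so weighted integrability at -∞ is preserved in both time directions; this is strict
invariance. -/

/-- `f` is a primitive of the locally integrable function `g`. -/
structure IsPrimitive {𝕜 : Type*} [RCLike 𝕜] (f g : ℝ → 𝕜) : Prop where
  intervalIntegrable : ∀ a b, IntervalIntegrable g volume a b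
  sub_eq : ∀ s t, f t - f s = ∫ x in s..t, g x

namespace IsPrimitive

variable {𝕜 : Type*} [RCLike 𝕜] {f g f₁ g₁ f₂ g₂ : ℝ → 𝕜}

theorem eq_add (h : IsPrimitive f g) (s t : ℝ) : f t = f s + ∫ x in s..t, g x := by
  rw [← h.sub_eq s t]; ring

theorem absolutelyContinuous (h : IsPrimitive f g) (a b : ℝ) :
    AbsolutelyContinuousOnInterval f a b := by
  have hg := h.intervalIntegrable
  have hre : IntervalIntegrable (fun x => RCLike.re (g x)) volume a b :=
    ⟨(hg a b).1.re, (hg a b).2.re⟩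
  have him : IntervalIntegrable (fun x => RCLike.im (g x)) volume a b :=
    ⟨(hg a b).1.im, (hg a b).2.im⟩
  have h1 := hre.absolutelyContinuousOnInterval_intervalIntegral left_mem_uIcc
  have h2 := him.absolutelyContinuousOnInterval_intervalIntegral left_mem_uIcc
  have hc : ∀ c : 𝕜, AbsolutelyContinuousOnInterval (fun _ : ℝ => c) a b := fun c =>
    (LipschitzOnWith.of_dist_le_mul (K := 0) (by simp)).absolutelyContinuousOnInterval
  -- A constant plus the integrals of the real and imaginary parts of g, each absolutely continuous,
  -- recovers f.
  have h3 := (hc (f a)).fun_add ((h1.fun_smul (hc 1)).fun_add (h2.fun_smul (hc RCLike.I)))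
  suffices hfx : ∀ x, f x = _ from (funext hfx : f = _) ▸ h3
  intro x
  rw [h.eq_add a x]
  have e1 := (RCLike.reCLM (K := 𝕜)).intervalIntegral_comp_comm (hg a x)
  have e2 := (RCLike.imCLM (K := 𝕜)).intervalIntegral_comp_comm (hg a x)
  simp only [RCLike.reCLM_apply, RCLike.imCLM_apply] at e1 e2
  rw [e1, e2]
  simp only [Algebra.smul_def, mul_one, add_right_inj]
  exact (RCLike.re_add_im _).symm

theorem continuous (h : IsPrimitive f g) : Continuous f := by
  rw [continuous_iff_continuousAt]
  intro x
  exact (h.absolutelyContinuous (x - 1) (x + 1)).continuousOn.continuousAt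
    (by rw [uIcc_of_le (by linarith)]; exact Icc_mem_nhds (by linarith) (by linarith))

theorem ae_hasDerivAt (h : IsPrimitive f g) : ∀ᵐ x, HasDerivAt f (g x) x := by
  have hl : LocallyIntegrable g volume := by
    rw [locallyIntegrable_iff]
    intro K hK
    obtain ⟨a, b, hab⟩ : ∃ a b, K ⊆ Ioc a b := by
      obtain ⟨r, hr⟩ := hK.isBounded.subset_closedBall 0
      refine ⟨-r - 1, r, hr.trans ?_⟩
      rw [Real.closedBall_eq_Icc]
      intro x hx
      exact ⟨by linarith [hx.1], by linarith [hx.2]⟩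
    exact (h.intervalIntegrable a b).1.mono_set hab
  filter_upwards [_root_.LocallyIntegrable.ae_hasDerivAt_integral hl] with x hx
  have hf : f = fun y => f 0 + ∫ t in (0 : ℝ)..y, g t := funext fun y => h.eq_add 0 y
  exact hf ▸ (hx 0).const_add (f 0)

/-- Subtracting the integral of g leaves an absolutely continuous function with derivative zero
almost everywhere, hence a constant. This yields the product rule `mul` when derivatives exist only
almost everywhere, as for w' with a right-hand side in L². -/
theorem of_ae_hasDerivAt (hf : ∀ a b, AbsolutelyContinuousOnInterval f a b)
    (hg : ∀ a b, IntervalIntegrable g volume a b) (hd : ∀ᵐ x, HasDerivAt f (g x) x) :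
    IsPrimitive f g := by
  refine ⟨hg, fun s t => ?_⟩
  have hp : IsPrimitive (fun x => ∫ y in s..x, g y) g :=
    ⟨hg, fun a b => by
      rw [sub_eq_iff_eq_add, add_comm]
      exact (intervalIntegral.integral_add_adjacent_intervals (hg _ _) (hg _ _)).symm⟩
  obtain ⟨C, hC⟩ := ((hf s t).fun_sub (hp.absolutelyContinuous s t)).const_of_ae_hasDerivAt_zero (by
    filter_upwards [hd, hp.ae_hasDerivAt] with x h1 h2 _
    simpa using h1.fun_sub h2)
  have h1 := hC s left_mem_uIcc
  have h2 := hC t right_mem_uIcc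
  simp only [intervalIntegral.integral_same, sub_zero] at h1 h2
  rw [h1, ← h2]; ring

theorem of_hasDerivAt (hg : Continuous g) (hd : ∀ x, HasDerivAt f (g x) x) : IsPrimitive f g :=
  ⟨fun a b => hg.intervalIntegrable a b, fun s t =>
    (intervalIntegral.integral_eq_sub_of_hasDerivAt (fun x _ => hd x)
      (hg.intervalIntegrable s t)).symm⟩

theorem congr (h : IsPrimitive f g) (hg : ∀ x, g x = g₁ x) : IsPrimitive f g₁ := by
  rwa [← funext hg]

theorem add (h₁ : IsPrimitive f₁ g₁) (h₂ : IsPrimitive f₂ g₂) :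
    IsPrimitive (fun x => f₁ x + f₂ x) (fun x => g₁ x + g₂ x) :=
  ⟨fun a b => (h₁.intervalIntegrable a b).add (h₂.intervalIntegrable a b), fun s t => by
    rw [intervalIntegral.integral_add (h₁.intervalIntegrable _ _) (h₂.intervalIntegrable _ _),
      ← h₁.sub_eq, ← h₂.sub_eq]; ring⟩

theorem const_mul (h : IsPrimitive f g) (c : 𝕜) :
    IsPrimitive (fun x => c * f x) (fun x => c * g x) :=
  ⟨fun a b => (h.intervalIntegrable a b).const_mul c, fun s t => by
    rw [intervalIntegral.integral_const_mul, ← h.sub_eq]; ring⟩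

theorem mul (h₁ : IsPrimitive f₁ g₁) (h₂ : IsPrimitive f₂ g₂) :
    IsPrimitive (fun x => f₁ x * f₂ x) (fun x => g₁ x * f₂ x + f₁ x * g₂ x) :=
  of_ae_hasDerivAt (fun a b => (h₁.absolutelyContinuous a b).fun_smul (h₂.absolutelyContinuous a b))
    (fun a b => ((h₁.intervalIntegrable a b).mul_continuousOn h₂.continuous.continuousOn).add
      ((h₂.intervalIntegrable a b).continuousOn_mul h₁.continuous.continuousOn))
    (by filter_upwards [h₁.ae_hasDerivAt, h₂.ae_hasDerivAt] with x d1 d2 using d1.mul d2)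

theorem re {f g : ℝ → ℂ} (h : IsPrimitive f g) :
    IsPrimitive (fun x => (f x).re) (fun x => (g x).re) :=
  ⟨fun a b => ⟨(h.intervalIntegrable a b).1.re, (h.intervalIntegrable a b).2.re⟩, fun s t => by
    rw [← Complex.sub_re, h.sub_eq]
    exact (Complex.reCLM.intervalIntegral_comp_comm (h.intervalIntegrable s t)).symm⟩

theorem im {f g : ℝ → ℂ} (h : IsPrimitive f g) :
    IsPrimitive (fun x => (f x).im) (fun x => (g x).im) :=
  ⟨fun a b => ⟨(h.intervalIntegrable a b).1.im, (h.intervalIntegrable a b).2.im⟩, fun s t => by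
    rw [← Complex.sub_im, h.sub_eq]
    exact (Complex.imCLM.intervalIntegral_comp_comm (h.intervalIntegrable s t)).symm⟩

/-- Integrability of g forces a limit to exist, and an integrable f cannot have a nonzero limit
along a filter of sets of infinite measure. -/
theorem tendsto_atBot (h : IsPrimitive f g) (hf : Integrable f) (hg : Integrable g) :
    Tendsto f atBot (𝓝 0) := by
  have h1 : Tendsto f atBot (𝓝 (f 0 - ∫ x in Iic 0, g x)) := by
    have := (intervalIntegral_tendsto_integral_Iic 0 hg.integrableOn tendsto_id).const_sub (f 0)
    refine this.congr fun x => ?_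
    simp only [id, ← h.sub_eq]; ring
  have : f 0 - ∫ x in Iic 0, g x = 0 := by
    refine IntegrableAtFilter.eq_zero_of_tendsto (hf.integrableAtFilter _) (fun s hs => ?_) h1
    obtain ⟨b, hb⟩ := mem_atBot_sets.1 hs
    rw [← top_le_iff, ← Real.volume_Iic (a := b)]
    exact measure_mono hb
  rwa [this] at h1

theorem tendsto_atTop (h : IsPrimitive f g) (hf : Integrable f) (hg : Integrable g) :
    Tendsto f atTop (𝓝 0) := by
  have h1 : Tendsto f atTop (𝓝 (f 0 + ∫ x in Ioi 0, g x)) := by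
    have := (intervalIntegral_tendsto_integral_Ioi 0 hg.integrableOn tendsto_id).const_add (f 0)
    exact this.congr fun x => (h.eq_add 0 x).symm
  have : f 0 + ∫ x in Ioi 0, g x = 0 := by
    refine IntegrableAtFilter.eq_zero_of_tendsto (hf.integrableAtFilter _) (fun s hs => ?_) h1
    obtain ⟨b, hb⟩ := mem_atTop_sets.1 hs
    rw [← top_le_iff, ← Real.volume_Ici (a := b)]
    exact measure_mono hb
  rwa [this] at h1

theorem eq_integral_Iic (h : IsPrimitive f g) (hf : Integrable f) (hg : Integrable g) (t : ℝ) :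
    f t = ∫ x in Iic t, g x := by
  have h1 := intervalIntegral_tendsto_integral_Iic t hg.integrableOn tendsto_id
  have h2 := (h.tendsto_atBot hf hg).const_sub (f t)
  rw [sub_zero] at h2
  exact tendsto_nhds_unique (h2.congr fun x => h.sub_eq x t) h1

theorem integral_eq_zero (h : IsPrimitive f g) (hf : Integrable f) (hg : Integrable g) :
    ∫ x, g x = 0 := by
  have h1 := intervalIntegral_tendsto_integral hg tendsto_neg_atTop_atBot tendsto_id
  have h2 := (h.tendsto_atTop hf hg).sub ((h.tendsto_atBot hf hg).comp tendsto_neg_atTop_atBot)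
  rw [sub_zero] at h2
  exact tendsto_nhds_unique h1 (h2.congr fun x => h.sub_eq (-x) x)

end IsPrimitive

end

/-! ### The first-order equation y' = r y + g in L²(ℝ). -/

noncomputable section
open MeasureTheory Set Filter

theorem MeasureTheory.MemLp.integrable_norm_sq_real {E : Type*} [NormedAddCommGroup E] {g : ℝ → E}
    (hg : MemLp g 2) : Integrable (fun x => ‖g x‖ ^ 2) := by
  simpa using hg.integrable_norm_pow (by norm_num)

/-- The half-line on which `s ↦ exp (-r s)` is square integrable. -/
def decaySet (r : ℂ) (t : ℝ) : Set ℝ := if r.re < 0 then Iic t else Ioi t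

theorem measurableSet_decaySet (r : ℂ) (t : ℝ) : MeasurableSet (decaySet r t) := by
  unfold decaySet; split_ifs <;> measurability

theorem integrableOn_exp_decaySet {r : ℂ} (hr : r.re ≠ 0) (t : ℝ) :
    IntegrableOn (fun s => Real.exp (-2 * r.re * s)) (decaySet r t) := by
  unfold decaySet
  split_ifs with h
  · exact integrableOn_exp_mul_Iic (by linarith) t
  · exact integrableOn_exp_mul_Ioi (by linarith [lt_of_le_of_ne (not_lt.1 h) (Ne.symm hr)]) t

theorem norm_exp_neg_mul_sq (r : ℂ) (s : ℝ) :
    ‖Complex.exp (-(r * s))‖ ^ 2 = Real.exp (-2 * r.re * s) := by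
  rw [Complex.norm_exp, ← Real.exp_nat_mul]
  congr 1; simp; ring

theorem memLp_exp_decaySet {r : ℂ} (hr : r.re ≠ 0) (t : ℝ) :
    MemLp (fun s : ℝ => Complex.exp (-(r * s))) 2 (volume.restrict (decaySet r t)) := by
  have hc : Continuous fun s : ℝ => Complex.exp (-(r * s)) := by fun_prop
  rw [← memLp_norm_iff hc.aestronglyMeasurable, memLp_two_iff_integrable_sq
    hc.norm.aestronglyMeasurable]
  simp_rw [norm_exp_neg_mul_sq]
  exact integrableOn_exp_decaySet hr t

theorem integrableOn_exp_mul_decaySet {r : ℂ} (hr : r.re ≠ 0) {g : ℝ → ℂ} (hg : MemLp g 2)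
    (t : ℝ) : IntegrableOn (fun s : ℝ => Complex.exp (-(r * s)) * g s) (decaySet r t) :=
  (memLp_exp_decaySet hr t).integrable_mul (hg.restrict _)

/-- The solution operator of `y' = r y + g` in `L²(ℝ)`, for `Re r ≠ 0`. -/
def expResolvent (r : ℂ) (g : ℝ → ℂ) (t : ℝ) : ℂ :=
  Complex.exp (r * t) * ((if r.re < 0 then 1 else -1) *
    ∫ s in decaySet r t, Complex.exp (-(r * s)) * g s)

theorem isPrimitive_halfLine {r : ℂ} (hr : r.re ≠ 0) {g : ℝ → ℂ} (hg : MemLp g 2) :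
    IsPrimitive (fun t => (if r.re < 0 then 1 else -1) *
      ∫ s in decaySet r t, Complex.exp (-(r * s)) * g s)
      (fun s => Complex.exp (-(r * s)) * g s) := by
  have hi := fun t => integrableOn_exp_mul_decaySet hr hg t
  by_cases h : r.re < 0
  · simp only [decaySet, h, if_true] at hi ⊢
    refine ⟨fun a b => ?_, fun s t => ?_⟩
    · exact ⟨(hi b).mono_set Ioc_subset_Iic_self, (hi a).mono_set Ioc_subset_Iic_self⟩
    · rw [one_mul, one_mul, intervalIntegral.integral_Iic_sub_Iic (hi s) (hi t)]
  · simp only [decaySet, h, if_false] at hi ⊢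
    refine ⟨fun a b => ?_, fun s t => ?_⟩
    · exact ⟨(hi a).mono_set Ioc_subset_Ioi_self, (hi b).mono_set Ioc_subset_Ioi_self⟩
    · rcases le_total s t with hst | hst
      · rw [← intervalIntegral.integral_Ioi_sub_Ioi (hi s) hst]; ring
      · rw [intervalIntegral.integral_symm, ← intervalIntegral.integral_Ioi_sub_Ioi (hi t) hst]
        ring

theorem isPrimitive_expResolvent {r : ℂ} (hr : r.re ≠ 0) {g : ℝ → ℂ} (hg : MemLp g 2) :
    IsPrimitive (expResolvent r g) (fun t => r * expResolvent r g t + g t) := by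
  have he : IsPrimitive (fun t : ℝ => Complex.exp (r * t)) (fun t => r * Complex.exp (r * t)) := by
    refine .of_hasDerivAt (by fun_prop) fun x => ?_
    have h1 : HasDerivAt (fun t : ℝ => r * (t : ℂ)) r x := by
      simpa using (Complex.ofRealCLM.hasDerivAt (x := x)).const_mul r
    simpa [mul_comm] using h1.cexp
  refine (he.mul (isPrimitive_halfLine hr hg)).congr fun t => ?_
  have : Complex.exp (r * t) * (Complex.exp (-(r * t)) * g t) = g t := by
    rw [← mul_assoc, ← Complex.exp_add]; simp
  rw [this, expResolvent]; ring

/-- Young's inequality splits the integrand into an exponential and |g|²/2; by translation the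
integral of the exponential over the half-line does not depend on t. The bound serves to control
boundary terms in `memLp_expResolvent`. -/
theorem exists_bound_expResolvent {r : ℂ} (hr : r.re ≠ 0) {g : ℝ → ℂ} (hg : MemLp g 2) :
    ∃ B, ∀ t, ‖expResolvent r g t‖ ≤ B := by
  have hg2 := hg.integrable_norm_sq_real
  have hbase : ∀ t, ∫ s in decaySet r t, Real.exp (2 * r.re * (t - s)) =
      ∫ s in decaySet r 0, Real.exp (-2 * r.re * s) := by
    intro t
    have e : ∀ s, Real.exp (2 * r.re * (t - s)) = Real.exp (-2 * r.re * (s - t)) := fun s => by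
      congr 1; ring
    simp_rw [e]
    rw [← integral_indicator (measurableSet_decaySet r t),
      ← integral_indicator (measurableSet_decaySet r 0),
      ← integral_sub_right_eq_self (fun s => (decaySet r 0).indicator _ s) t]
    congr 1
    funext s
    have : s ∈ decaySet r t ↔ s - t ∈ decaySet r 0 := by
      unfold decaySet; split_ifs <;> simp
    by_cases hs : s ∈ decaySet r t
    · rw [indicator_of_mem hs, indicator_of_mem (this.1 hs)]
    · rw [indicator_of_notMem hs, indicator_of_notMem (fun h => hs (this.2 h))]
  refine ⟨(∫ s in decaySet r 0, Real.exp (-2 * r.re * s)) / 2 + (∫ s, ‖g s‖ ^ 2) / 2, fun t => ?_⟩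
  have hexp : IntegrableOn (fun s => Real.exp (2 * r.re * (t - s))) (decaySet r t) := by
    have := (integrableOn_exp_decaySet hr t).const_mul (Real.exp (2 * r.re * t))
    refine this.congr (Eventually.of_forall fun s => ?_)
    simp only
    rw [← Real.exp_add]; congr 1; ring
  calc ‖expResolvent r g t‖
      = ‖∫ s in decaySet r t, Complex.exp (r * t) * (Complex.exp (-(r * s)) * g s)‖ := by
        rw [integral_const_mul, expResolvent, norm_mul, norm_mul, norm_mul]
        split_ifs <;> simp
    _ ≤ ∫ s in decaySet r t, (Real.exp (2 * r.re * (t - s)) / 2 + ‖g s‖ ^ 2 / 2) := by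
        refine norm_integral_le_of_norm_le ((hexp.div_const 2).add (hg2.integrableOn.div_const 2))
          (Eventually.of_forall fun s => ?_)
        have h1 : ‖Complex.exp (r * t) * (Complex.exp (-(r * s)) * g s)‖
            = Real.exp (r.re * (t - s)) * ‖g s‖ := by
          rw [← mul_assoc, ← Complex.exp_add, norm_mul, Complex.norm_exp]
          congr 2; simp; ring
        have h2 : Real.exp (2 * r.re * (t - s)) = Real.exp (r.re * (t - s)) ^ 2 := by
          rw [← Real.exp_nat_mul]; congr 1; push_cast; ring
        rw [h1, h2]
        nlinarith [sq_nonneg (Real.exp (r.re * (t - s)) - ‖g s‖)]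
    _ = (∫ s in decaySet r t, Real.exp (2 * r.re * (t - s))) / 2
          + (∫ s in decaySet r t, ‖g s‖ ^ 2) / 2 := by
        rw [integral_add (hexp.div_const 2) (hg2.integrableOn.div_const 2), integral_div,
          integral_div]
    _ ≤ _ := by
        rw [hbase]
        gcongr
        · exact Eventually.of_forall fun s => by positivity
        · exact Measure.restrict_le_self

/-- An energy estimate: in the derivative of |Y|² the term 2ρ|Y|² dominates after the cross term is
absorbed by Young's inequality. Integration over [-T, T] then bounds ∫|Y|² uniformly in T, because
the boundary values are bounded. -/
theorem memLp_expResolvent {r : ℂ} (hr : r.re ≠ 0) {g : ℝ → ℂ} (hg : MemLp g 2) :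
    MemLp (expResolvent r g) 2 := by
  have hP := isPrimitive_expResolvent hr hg
  have hg2 := hg.integrable_norm_sq_real
  obtain ⟨B, hB⟩ := exists_bound_expResolvent hr hg
  set Y := expResolvent r g with hY
  have hYc : Continuous Y := hP.continuous
  set ρ := r.re with hρ
  have hN : IsPrimitive (fun t => ‖Y t‖ ^ 2)
      (fun t => 2 * ρ * ‖Y t‖ ^ 2 + 2 * ((Y t).re * (g t).re + (Y t).im * (g t).im)) := by
    have h := (hP.re.mul hP.re).add (hP.im.mul hP.im)
    have e : ∀ z : ℂ, ‖z‖ ^ 2 = z.re * z.re + z.im * z.im := fun z => by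
      rw [← Complex.normSq_eq_norm_sq, Complex.normSq_apply]
    simp only [e]
    refine h.congr fun t => ?_
    simp only [Complex.add_re, Complex.mul_re, Complex.add_im, Complex.mul_im]
    ring
  -- The sign σ of ρ lets growing and decaying exponentials be treated together.
  obtain ⟨σ, hσ, hσρ⟩ : ∃ σ : ℝ, (σ = 1 ∨ σ = -1) ∧ σ * ρ = |ρ| := by
    rcases lt_or_gt_of_ne hr with h | h
    · exact ⟨-1, Or.inr rfl, by rw [abs_of_neg h]; ring⟩
    · exact ⟨1, Or.inl rfl, by rw [abs_of_pos h]; ring⟩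
  have hpt : ∀ t, |ρ| * ‖Y t‖ ^ 2 ≤ ‖g t‖ ^ 2 / |ρ| + σ *
      (2 * ρ * ‖Y t‖ ^ 2 + 2 * ((Y t).re * (g t).re + (Y t).im * (g t).im)) := by
    intro t
    have e : ∀ z : ℂ, ‖z‖ ^ 2 = z.re * z.re + z.im * z.im := fun z => by
      rw [← Complex.normSq_eq_norm_sq, Complex.normSq_apply]
    have hρ0 : 0 < |ρ| := abs_pos.2 hr
    have h2 : σ ^ 2 = 1 := by rcases hσ with h | h <;> simp [h]
    rw [e, e]
    generalize (Y t).re = a; generalize (Y t).im = b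
    generalize (g t).re = c; generalize (g t).im = d
    have h3 : (c * c + d * d) / |ρ| + σ * (2 * ρ * (a * a + b * b) + 2 * (a * c + b * d))
        - |ρ| * (a * a + b * b) = ((c + σ * |ρ| * a) ^ 2 + (d + σ * |ρ| * b) ^ 2) / |ρ| := by
      field_simp
      linear_combination (-(a ^ 2 + b ^ 2) * |ρ| ^ 2) * h2 + 2 * |ρ| * (a ^ 2 + b ^ 2) * hσρ
    have : 0 ≤ ((c + σ * |ρ| * a) ^ 2 + (d + σ * |ρ| * b) ^ 2) / |ρ| := by positivity
    linarith
  have hB0 : 0 ≤ B := (norm_nonneg _).trans (hB 0)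
  have hρ0 : 0 < |ρ| := abs_pos.2 hr
  rw [← memLp_norm_iff hYc.aestronglyMeasurable, memLp_two_iff_integrable_sq
    hYc.norm.aestronglyMeasurable]
  refine integrable_of_intervalIntegral_norm_bounded
    (((∫ s, ‖g s‖ ^ 2) / |ρ| + 2 * B ^ 2) / |ρ|) (l := atTop) (a := fun x : ℝ => -x)
    (b := fun x => x) (fun i => ?_) tendsto_neg_atTop_atBot tendsto_id ?_
  · exact ((hYc.norm.pow 2).integrableOn_Ioc)
  · filter_upwards [eventually_ge_atTop 0] with T hT
    have hTT : -T ≤ T := by linarith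
    rw [le_div_iff₀ hρ0]
    have hYi : IntervalIntegrable (fun t => ‖Y t‖ ^ 2) volume (-T) T :=
      (hYc.norm.pow 2).intervalIntegrable _ _
    have hgi : IntervalIntegrable (fun t => ‖g t‖ ^ 2 / |ρ|) volume (-T) T :=
      (hg2.div_const _).intervalIntegrable
    calc (∫ x in (-T)..T, ‖‖Y x‖ ^ 2‖) * |ρ| = ∫ x in (-T)..T, |ρ| * ‖Y x‖ ^ 2 := by
          rw [intervalIntegral.integral_const_mul, mul_comm]; simp
      _ ≤ ∫ t in (-T)..T, (‖g t‖ ^ 2 / |ρ| + σ *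
            (2 * ρ * ‖Y t‖ ^ 2 + 2 * ((Y t).re * (g t).re + (Y t).im * (g t).im))) :=
          intervalIntegral.integral_mono_on hTT (hYi.const_mul _)
            (hgi.add ((hN.intervalIntegrable _ _).const_mul _)) fun t _ => hpt t
      _ = (∫ t in (-T)..T, ‖g t‖ ^ 2) / |ρ| + σ * (‖Y T‖ ^ 2 - ‖Y (-T)‖ ^ 2) := by
          rw [intervalIntegral.integral_add hgi ((hN.intervalIntegrable _ _).const_mul _),
            intervalIntegral.integral_const_mul, ← hN.sub_eq, intervalIntegral.integral_div]
      _ ≤ _ := by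
          refine add_le_add ?_ ?_
          · gcongr
            rw [intervalIntegral.integral_of_le hTT]
            exact setIntegral_le_integral hg2 (Eventually.of_forall fun s => by positivity)
          · have h1 : ‖Y T‖ ^ 2 ≤ B ^ 2 := by gcongr; exact hB T
            have h2 : ‖Y (-T)‖ ^ 2 ≤ B ^ 2 := by gcongr; exact hB (-T)
            have h3 : 0 ≤ ‖Y T‖ ^ 2 := by positivity
            have h4 : 0 ≤ ‖Y (-T)‖ ^ 2 := by positivity
            rcases hσ with h | h <;> rw [h] <;> linarith

theorem expResolvent_congr {r : ℂ} {g₁ g₂ : ℝ → ℂ} (h : g₁ =ᵐ[volume] g₂) :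
    expResolvent r g₁ = expResolvent r g₂ := by
  funext t
  unfold expResolvent
  congr 2
  refine integral_congr_ae (ae_restrict_of_ae ?_)
  filter_upwards [h] with s hs
  rw [hs]

theorem expResolvent_add {r : ℂ} (hr : r.re ≠ 0) {g₁ g₂ : ℝ → ℂ} (h₁ : MemLp g₁ 2)
    (h₂ : MemLp g₂ 2) (t : ℝ) :
    expResolvent r (fun s => g₁ s + g₂ s) t = expResolvent r g₁ t + expResolvent r g₂ t := by
  unfold expResolvent
  simp_rw [mul_add]
  rw [integral_add (integrableOn_exp_mul_decaySet hr h₁ t) (integrableOn_exp_mul_decaySet hr h₂ t)]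
  ring

theorem expResolvent_const_mul (r c : ℂ) (g : ℝ → ℂ) (t : ℝ) :
    expResolvent r (fun s => c * g s) t = c * expResolvent r g t := by
  unfold expResolvent
  simp_rw [mul_left_comm _ c, integral_const_mul]
  ring

end

/-! ### A single mode: ε w'' + γ w' + a w = h on the line. -/

noncomputable section
open MeasureTheory Set Filter

/-- A square root of the real number `x` with nonnegative real part. -/
def complexSqrt (x : ℝ) : ℂ := ⟨√x, √(-x)⟩

theorem complexSqrt_sq (x : ℝ) : complexSqrt x ^ 2 = x := by
  rw [sq]
  rcases le_total 0 x with h | h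
  · have h' : √(-x) = 0 := Real.sqrt_eq_zero_of_nonpos (by linarith)
    apply Complex.ext <;> simp [complexSqrt, h', Real.mul_self_sqrt h]
  · have h' : √x = 0 := Real.sqrt_eq_zero_of_nonpos h
    apply Complex.ext <;> simp [complexSqrt, h', Real.mul_self_sqrt (neg_nonneg.2 h)]

/-- The root of `ε x² + γ x + a` with the larger real part. -/
def slowRoot (ε γ a : ℝ) : ℂ := (-γ + complexSqrt (γ ^ 2 - 4 * ε * a)) / (2 * ε : ℝ)

/-- The root of `ε x² + γ x + a` with the smaller real part. -/
def fastRoot (ε γ a : ℝ) : ℂ := (-γ - complexSqrt (γ ^ 2 - 4 * ε * a)) / (2 * ε : ℝ)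

theorem slowRoot_re (ε γ a : ℝ) :
    (slowRoot ε γ a).re = (-γ + √(γ ^ 2 - 4 * ε * a)) / (2 * ε) := by
  rw [slowRoot, Complex.div_ofReal_re]; simp [complexSqrt]

theorem fastRoot_re (ε γ a : ℝ) :
    (fastRoot ε γ a).re = (-γ - √(γ ^ 2 - 4 * ε * a)) / (2 * ε) := by
  rw [fastRoot, Complex.div_ofReal_re]; simp [complexSqrt]

theorem fastRoot_add_slowRoot {ε : ℝ} (hε : 0 < ε) (γ a : ℝ) :
    fastRoot ε γ a + slowRoot ε γ a = -γ / ε := by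
  have : (ε : ℂ) ≠ 0 := by exact_mod_cast hε.ne'
  unfold fastRoot slowRoot
  push_cast
  field_simp
  ring

theorem fastRoot_mul_slowRoot {ε : ℝ} (hε : 0 < ε) (γ a : ℝ) :
    fastRoot ε γ a * slowRoot ε γ a = a / ε := by
  have h0 : (ε : ℂ) ≠ 0 := by exact_mod_cast hε.ne'
  have h := complexSqrt_sq (γ ^ 2 - 4 * ε * a)
  unfold fastRoot slowRoot
  push_cast at h ⊢
  field_simp
  linear_combination -h

theorem fastRoot_re_neg {ε γ : ℝ} (hε : 0 < ε) (hγ : 0 < γ) (a : ℝ) :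
    (fastRoot ε γ a).re < 0 := by
  rw [fastRoot_re]
  exact div_neg_of_neg_of_pos (by linarith [Real.sqrt_nonneg (γ ^ 2 - 4 * ε * a)]) (by linarith)

theorem slowRoot_re_neg {ε γ a : ℝ} (hε : 0 < ε) (hγ : 0 < γ) (ha : 0 < a) :
    (slowRoot ε γ a).re < 0 := by
  rw [slowRoot_re]
  refine div_neg_of_neg_of_pos ?_ (by linarith)
  have : √(γ ^ 2 - 4 * ε * a) < γ := by
    rw [Real.sqrt_lt' hγ]; nlinarith [mul_pos hε ha]
  linarith

theorem slowRoot_re_pos {ε γ a : ℝ} (hε : 0 < ε) (hγ : 0 < γ) (ha : a < 0) :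
    0 < (slowRoot ε γ a).re := by
  rw [slowRoot_re]
  refine div_pos ?_ (by linarith)
  have : γ < √(γ ^ 2 - 4 * ε * a) := by
    rw [Real.lt_sqrt hγ.le]; nlinarith [mul_pos hε (neg_pos.2 ha)]
  linarith

/-- The real part has the sign of -a. As the fast root always lies in the left half-plane, a ≠ 0
gives an exponential dichotomy. -/
theorem slowRoot_re_ne_zero {ε γ a : ℝ} (hε : 0 < ε) (hγ : 0 < γ) (ha : a ≠ 0) :
    (slowRoot ε γ a).re ≠ 0 := by
  rcases lt_or_gt_of_ne ha with h | h
  · exact (slowRoot_re_pos hε hγ h).ne'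
  · exact (slowRoot_re_neg hε hγ h).ne

/-- The first factor `(d/dt - slowRoot)⁻¹ (h / ε)` of the solution of `ε w'' + γ w' + a w = h`. -/
def modeAux (ε γ a : ℝ) (h : ℝ → ℝ) : ℝ → ℂ :=
  expResolvent (slowRoot ε γ a) (fun t => ((ε⁻¹ : ℝ) : ℂ) * (h t : ℂ))

/-- The solution in `L²(ℝ)` of `ε w'' + γ w' + a w = h`. -/
def modePos (ε γ a : ℝ) (h : ℝ → ℝ) (t : ℝ) : ℝ :=
  (expResolvent (fastRoot ε γ a) (modeAux ε γ a h) t).re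

/-- The derivative of `modePos`. -/
def modeVel (ε γ a : ℝ) (h : ℝ → ℝ) (t : ℝ) : ℝ :=
  (fastRoot ε γ a * expResolvent (fastRoot ε γ a) (modeAux ε γ a h) t + modeAux ε γ a h t).re

section
variable {ε γ a : ℝ} (hε : 0 < ε) (hγ : 0 < γ) (ha : a ≠ 0) {h : ℝ → ℝ} (hh : MemLp h 2)
include hε hγ ha hh

omit hε hγ ha in
theorem memLp_modeRhs : MemLp (fun t => ((ε⁻¹ : ℝ) : ℂ) * (h t : ℂ)) 2 :=
  hh.ofReal.const_mul _

theorem memLp_modeAux : MemLp (modeAux ε γ a h) 2 :=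
  memLp_expResolvent (slowRoot_re_ne_zero hε hγ ha) (memLp_modeRhs hh)

theorem memLp_modePos : MemLp (modePos ε γ a h) 2 :=
  (memLp_expResolvent (fastRoot_re_neg hε hγ a).ne (memLp_modeAux hε hγ ha hh)).re

theorem memLp_modeVel : MemLp (modeVel ε γ a h) 2 :=
  (((memLp_expResolvent (fastRoot_re_neg hε hγ a).ne (memLp_modeAux hε hγ ha hh)).const_mul
    _).add (memLp_modeAux hε hγ ha hh)).re

theorem isPrimitive_modePos : IsPrimitive (modePos ε γ a h) (modeVel ε γ a h) :=
  (isPrimitive_expResolvent (fastRoot_re_neg hε hγ a).ne (memLp_modeAux hε hγ ha hh)).re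

/-- The two first-order equations combine to the second-order one through Vieta's relations for the
roots. -/
theorem isPrimitive_modeVel : IsPrimitive (modeVel ε γ a h)
    (fun t => (h t - γ * modeVel ε γ a h t - a * modePos ε γ a h t) / ε) := by
  have hW := isPrimitive_expResolvent (fastRoot_re_neg hε hγ a).ne (memLp_modeAux hε hγ ha hh)
  have hY := isPrimitive_expResolvent (slowRoot_re_ne_zero hε hγ ha)
    (memLp_modeRhs (ε := ε) hh)
  refine ((hW.const_mul (fastRoot ε γ a)).add hY).re.congr fun t => ?_
  have h0 : (ε : ℂ) ≠ 0 := by exact_mod_cast hε.ne'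
  have e1 := fastRoot_add_slowRoot hε γ a
  have e2 := fastRoot_mul_slowRoot hε γ a
  change (fastRoot ε γ a * _ + (slowRoot ε γ a * modeAux ε γ a h t + _)).re = _
  set W := expResolvent (fastRoot ε γ a) (modeAux ε γ a h) t with hWd
  set Y := modeAux ε γ a h t with hYd
  have : fastRoot ε γ a * (fastRoot ε γ a * W + Y) + (slowRoot ε γ a * Y
      + ((ε⁻¹ : ℝ) : ℂ) * (h t : ℂ)) =
      ((h t : ℂ) - γ * (fastRoot ε γ a * W + Y) - a * W) / ε := by
    push_cast
    have e3 : (γ : ℂ) = -(fastRoot ε γ a + slowRoot ε γ a) * ε := by rw [e1]; field_simp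
    have e4 : (a : ℂ) = (fastRoot ε γ a * slowRoot ε γ a) * ε := by rw [e2]; field_simp
    generalize fastRoot ε γ a = q at *
    generalize slowRoot ε γ a = r at *
    rw [e3, e4]
    field_simp
    ring
  rw [this, Complex.div_ofReal_re]
  simp only [Complex.sub_re, Complex.ofReal_re, Complex.re_ofReal_mul]
  rfl

end

section
variable {ε γ a : ℝ} (hε : 0 < ε) (hγ : 0 < γ) {w v h : ℝ → ℝ} (hh : MemLp h 2)
  (hw : MemLp w 2) (hv : MemLp v 2) (hwv : IsPrimitive w v)
  (hvh : IsPrimitive v (fun t => (h t - γ * v t - a * w t) / ε))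
include hε hγ hh hw hv hwv hvh

omit hε hγ in
-- The integrand is the derivative along the solution of the quadratic form x v² + y w v + z w²,
-- which is integrable since w and v are in L². Suitable choices of x, y, z give the bounds for w,
-- for v and for the energy.
theorem mode_energy_identity (x y z : ℝ) (t : ℝ) :
    Integrable (fun t => 2 * x / ε * v t * (h t - γ * v t - a * w t)
      + y * (v t ^ 2 + w t * ((h t - γ * v t - a * w t) / ε)) + 2 * z * w t * v t) ∧
    x * v t ^ 2 + y * (w t * v t) + z * w t ^ 2 = ∫ t in Iic t, (2 * x / ε * v t *
      (h t - γ * v t - a * w t) + y * (v t ^ 2 + w t * ((h t - γ * v t - a * w t) / ε))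
        + 2 * z * w t * v t) ∧
    ∫ t, (2 * x / ε * v t * (h t - γ * v t - a * w t)
      + y * (v t ^ 2 + w t * ((h t - γ * v t - a * w t) / ε)) + 2 * z * w t * v t) = 0 := by
  have hP : IsPrimitive (fun t => x * v t ^ 2 + y * (w t * v t) + z * w t ^ 2)
      (fun t => 2 * x / ε * v t * (h t - γ * v t - a * w t)
      + y * (v t ^ 2 + w t * ((h t - γ * v t - a * w t) / ε)) + 2 * z * w t * v t) := by
    have := (((hvh.mul hvh).const_mul x).add ((hwv.mul hvh).const_mul y)).add
      ((hwv.mul hwv).const_mul z)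
    simp only [sq]
    exact this.congr fun t => by ring
  have ivv := hv.integrable_mul hv
  have iwv := hw.integrable_mul hv
  have iww := hw.integrable_mul hw
  have ihv := hh.integrable_mul hv
  have ihw := hh.integrable_mul hw
  have i1 : Integrable (fun t => x * v t ^ 2 + y * (w t * v t) + z * w t ^ 2) := by
    refine (((ivv.const_mul x).add (iwv.const_mul y)).add (iww.const_mul z)).congr
      (Eventually.of_forall fun t => ?_)
    simp only [Pi.add_apply, Pi.mul_apply]; ring
  have i2 : Integrable (fun t => 2 * x / ε * v t * (h t - γ * v t - a * w t)
      + y * (v t ^ 2 + w t * ((h t - γ * v t - a * w t) / ε)) + 2 * z * w t * v t) := by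
    refine (((((ihv.const_mul (2 * x / ε)).add (ivv.const_mul (y - 2 * x / ε * γ))).add
      (iwv.const_mul (2 * z - 2 * x / ε * a - y * γ / ε))).add (ihw.const_mul (y / ε))).add
      (iww.const_mul (- y * a / ε))).congr (Eventually.of_forall fun t => ?_)
    simp only [Pi.add_apply, Pi.mul_apply]; ring
  exact ⟨i2, hP.eq_integral_Iic i1 i2 t, hP.integral_eq_zero i1 i2⟩

omit hγ in
-- In terms of symbols, |-εω² + iγω + a|² - δ² equals |-εω² + iαω + β|² once β² = a² - δ² and α² =
-- γ² - 2ε(a - β). So h² - δ²w² is (εw'' + αw' + βw)² plus a total derivative, which integrates to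
-- zero.
theorem mode_sq_integral_le {δ : ℝ} (hδ : 0 ≤ δ) (had : δ ≤ |a|)
    (hgap : 2 * ε * δ ≤ γ ^ 2) : δ ^ 2 * ∫ t, w t ^ 2 ≤ ∫ t, h t ^ 2 := by
  -- The nonnegative root satisfies a - β ≤ δ for either sign of a, so 2εδ ≤ γ² is what makes α
  -- real.
  obtain ⟨β, hβ, hβa⟩ : ∃ β : ℝ, β ^ 2 = a ^ 2 - δ ^ 2 ∧ 2 * ε * (a - β) ≤ γ ^ 2 := by
    have h0 : 0 ≤ a ^ 2 - δ ^ 2 := by nlinarith [abs_nonneg a, sq_abs a]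
    refine ⟨√(a ^ 2 - δ ^ 2), Real.sq_sqrt h0, le_trans ?_ hgap⟩
    have : a - √(a ^ 2 - δ ^ 2) ≤ δ := by
      by_cases hc : a ≤ δ
      · linarith [Real.sqrt_nonneg (a ^ 2 - δ ^ 2)]
      · have : a - δ ≤ √(a ^ 2 - δ ^ 2) := Real.le_sqrt_of_sq_le (by nlinarith)
        linarith
    nlinarith
  set α := √(γ ^ 2 - 2 * ε * (a - β)) with hα
  have hα2 : α ^ 2 = γ ^ 2 - 2 * ε * (a - β) := Real.sq_sqrt (by linarith)
  obtain ⟨hi, -, h0⟩ := mode_energy_identity hh hw hv hwv hvh (ε * (γ - α)) (2 * ε * (a - β))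
    (γ * a - α * β) 0
  have iw := hw.integrable_sq
  have ih := hh.integrable_sq
  have : ∫ t, (δ ^ 2 * w t ^ 2 - h t ^ 2) ≤ ∫ t, -(2 * (ε * (γ - α)) / ε * v t *
      (h t - γ * v t - a * w t) + 2 * ε * (a - β) * (v t ^ 2 + w t * ((h t - γ * v t - a * w t) / ε))
      + 2 * (γ * a - α * β) * w t * v t) := by
    refine integral_mono ((iw.const_mul _).sub ih) hi.neg fun t => ?_
    simp only
    have key : -(2 * (ε * (γ - α)) / ε * v t *
      (h t - γ * v t - a * w t) + 2 * ε * (a - β) * (v t ^ 2 + w t * ((h t - γ * v t - a * w t) / ε))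
      + 2 * (γ * a - α * β) * w t * v t) = (h t - γ * v t - a * w t + α * v t + β * w t) ^ 2
        + δ ^ 2 * w t ^ 2 - h t ^ 2 := by
      field_simp
      linear_combination (-v t ^ 2) * hα2 - w t ^ 2 * hβ
    rw [key]
    nlinarith [sq_nonneg (h t - γ * v t - a * w t + α * v t + β * w t)]
  rw [integral_neg, h0, integral_sub (iw.const_mul _) ih, integral_const_mul] at this
  linarith

omit hγ in
-- Testing the equation with v removes the conservative terms and leaves ∫ h v = γ ∫ v²; expanding
-- (h - γv)² finishes.
theorem mode_vel_sq_integral_le : γ ^ 2 * ∫ t, v t ^ 2 ≤ ∫ t, h t ^ 2 := by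
  obtain ⟨hi, -, h0⟩ := mode_energy_identity hh hw hv hwv hvh ε 0 a 0
  have iv := hv.integrable_sq
  have ih := hh.integrable_sq
  have : ∫ t, (γ ^ 2 * v t ^ 2 - h t ^ 2) ≤ ∫ t, -(γ * (2 * ε / ε * v t * (h t - γ * v t - a * w t)
      + 0 * (v t ^ 2 + w t * ((h t - γ * v t - a * w t) / ε)) + 2 * a * w t * v t)) := by
    refine integral_mono ((iv.const_mul _).sub ih) (hi.const_mul γ).neg fun t => ?_
    have e : 2 * ε / ε = 2 := by field_simp
    simp only [e]
    nlinarith [sq_nonneg (h t - γ * v t)]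
  rw [integral_neg, integral_const_mul, h0, integral_sub (iv.const_mul _) ih,
    integral_const_mul] at this
  linarith

/-- The derivative of ε v² + a w² is 2v(h - γv), which is at most h²/(2γ). The sign of a plays no
role. -/
theorem mode_energy_le (t : ℝ) :
    ε * v t ^ 2 + a * w t ^ 2 ≤ (∫ t, h t ^ 2) / (2 * γ) := by
  obtain ⟨hi, h0, -⟩ := mode_energy_identity hh hw hv hwv hvh ε 0 a t
  have ih := hh.integrable_sq.div_const (2 * γ)
  have e : 2 * ε / ε = 2 := by field_simp
  simp only [e, zero_mul, add_zero] at h0 hi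
  rw [h0, ← integral_div]
  refine (integral_mono hi.integrableOn ih.integrableOn fun t => ?_).trans
    (setIntegral_le_integral ih (Eventually.of_forall fun s => by positivity))
  simp only
  rw [le_div_iff₀ (by positivity)]
  nlinarith [sq_nonneg (h t - 2 * γ * v t)]

omit hε hγ hh hvh in
theorem mode_pos_sq_le (t : ℝ) :
    w t ^ 2 ≤ (∫ t, w t ^ 2) + ∫ t, v t ^ 2 := by
  have iwv := hw.integrable_mul hv
  have iww := hw.integrable_sq
  have ivv := hv.integrable_sq
  have hi : Integrable (fun t => v t * w t + w t * v t) := by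
    refine (iwv.const_mul 2).congr (Eventually.of_forall fun t => ?_)
    simp only [Pi.mul_apply]; ring
  have := (hwv.mul hwv).eq_integral_Iic (by simpa [sq] using iww) hi t
  rw [sq, this, ← integral_add iww ivv]
  refine (integral_mono hi.integrableOn (iww.add ivv).integrableOn fun t => ?_).trans
    (setIntegral_le_integral (iww.add ivv) (Eventually.of_forall fun s => ?_))
  · simp only [Pi.add_apply]; nlinarith [sq_nonneg (w t - v t)]
  · simp only [Pi.add_apply, Pi.zero_apply]; positivity

/-- For a < 0 the form in `mode_energy_le` is indefinite. Adding m w² restores the eigenvalue as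
coefficient, and the pointwise bound of w² pays for it. The constant does not depend on a, so the
estimates can be summed over all modes. -/
theorem mode_sup_le {δ lam m : ℝ} (hδ : 0 < δ) (had : δ ≤ |a|) (hgap : 2 * ε * δ ≤ γ ^ 2)
    (hm : 0 ≤ m) (hlam : lam = a + m) (t : ℝ) :
    ε * v t ^ 2 + lam * w t ^ 2 ≤ (1 / (2 * γ) + m * (1 / δ ^ 2 + 1 / γ ^ 2)) * ∫ t, h t ^ 2 := by
  have h1 := mode_sq_integral_le hε hh hw hv hwv hvh hδ.le had hgap
  have h2 := mode_vel_sq_integral_le hε hh hw hv hwv hvh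
  have h3 := mode_energy_le hε hγ hh hw hv hwv hvh t
  have h4 := mode_pos_sq_le hw hv hwv t
  rw [mul_comm, ← le_div_iff₀ (by positivity)] at h1 h2
  have h5 : m * w t ^ 2 ≤ m * ((∫ t, h t ^ 2) / δ ^ 2 + (∫ t, h t ^ 2) / γ ^ 2) := by
    gcongr; linarith
  rw [hlam]
  calc ε * v t ^ 2 + (a + m) * w t ^ 2 = (ε * v t ^ 2 + a * w t ^ 2) + m * w t ^ 2 := by ring
    _ ≤ _ := add_le_add h3 h5
    _ = _ := by ring

end

end

/-! ### Linearity of the mode solution and its unstable component. -/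

noncomputable section
open MeasureTheory Set Filter

section
variable {ε γ a : ℝ}

theorem modeAux_congr {h₁ h₂ : ℝ → ℝ} (h : h₁ =ᵐ[volume] h₂) :
    modeAux ε γ a h₁ = modeAux ε γ a h₂ := by
  refine expResolvent_congr ?_
  filter_upwards [h] with t ht
  rw [ht]

theorem modePos_congr {h₁ h₂ : ℝ → ℝ} (h : h₁ =ᵐ[volume] h₂) :
    modePos ε γ a h₁ = modePos ε γ a h₂ := by
  funext t; rw [modePos, modePos, modeAux_congr h]

theorem modeVel_congr {h₁ h₂ : ℝ → ℝ} (h : h₁ =ᵐ[volume] h₂) :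
    modeVel ε γ a h₁ = modeVel ε γ a h₂ := by
  funext t; rw [modeVel, modeVel, modeAux_congr h]

theorem modeAux_const_mul (c : ℝ) (h : ℝ → ℝ) :
    modeAux ε γ a (fun t => c * h t) = fun t => c * modeAux ε γ a h t := by
  funext t
  rw [modeAux, modeAux, ← expResolvent_const_mul]
  congr 1
  funext s
  push_cast
  ring

theorem modePos_const_mul (c : ℝ) (h : ℝ → ℝ) (t : ℝ) :
    modePos ε γ a (fun t => c * h t) t = c * modePos ε γ a h t := by
  rw [modePos, modePos, modeAux_const_mul, expResolvent_const_mul, Complex.re_ofReal_mul]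

theorem modeVel_const_mul (c : ℝ) (h : ℝ → ℝ) (t : ℝ) :
    modeVel ε γ a (fun t => c * h t) t = c * modeVel ε γ a h t := by
  rw [modeVel, modeVel, modeAux_const_mul, expResolvent_const_mul, ← Complex.re_ofReal_mul]
  congr 1; ring

section
variable (hε : 0 < ε) (hγ : 0 < γ) (ha : a ≠ 0) {h₁ h₂ : ℝ → ℝ} (hh₁ : MemLp h₁ 2)
  (hh₂ : MemLp h₂ 2)
include hε hγ ha hh₁ hh₂

theorem modeAux_add :
    modeAux ε γ a (fun t => h₁ t + h₂ t) = fun t => modeAux ε γ a h₁ t + modeAux ε γ a h₂ t := by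
  funext t
  rw [modeAux, modeAux, modeAux, ← expResolvent_add (slowRoot_re_ne_zero hε hγ ha)
    (memLp_modeRhs hh₁) (memLp_modeRhs hh₂)]
  congr 1
  funext s
  push_cast
  ring

theorem modePos_add (t : ℝ) :
    modePos ε γ a (fun t => h₁ t + h₂ t) t = modePos ε γ a h₁ t + modePos ε γ a h₂ t := by
  rw [modePos, modePos, modePos, modeAux_add hε hγ ha hh₁ hh₂,
    expResolvent_add (fastRoot_re_neg hε hγ a).ne (memLp_modeAux hε hγ ha hh₁)
    (memLp_modeAux hε hγ ha hh₂), Complex.add_re]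

theorem modeVel_add (t : ℝ) :
    modeVel ε γ a (fun t => h₁ t + h₂ t) t = modeVel ε γ a h₁ t + modeVel ε γ a h₂ t := by
  rw [modeVel, modeVel, modeVel, modeAux_add hε hγ ha hh₁ hh₂,
    expResolvent_add (fastRoot_re_neg hε hγ a).ne (memLp_modeAux hε hγ ha hh₁)
    (memLp_modeAux hε hγ ha hh₂), ← Complex.add_re]
  congr 1; ring

end

theorem complexSqrt_of_nonneg {x : ℝ} (hx : 0 ≤ x) : complexSqrt x = (√x : ℝ) := by
  apply Complex.ext
  · simp [complexSqrt]
  · simpa [complexSqrt] using Real.sqrt_eq_zero_of_nonpos (by linarith : -x ≤ 0)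

theorem fastRoot_eq_ofReal (hd : 0 ≤ γ ^ 2 - 4 * ε * a) :
    fastRoot ε γ a = ((fastRoot ε γ a).re : ℂ) := by
  rw [fastRoot_re, fastRoot, complexSqrt_of_nonneg hd]; push_cast; rfl

theorem slowRoot_eq_ofReal (hd : 0 ≤ γ ^ 2 - 4 * ε * a) :
    slowRoot ε γ a = ((slowRoot ε γ a).re : ℂ) := by
  rw [slowRoot_re, slowRoot, complexSqrt_of_nonneg hd]; push_cast; rfl

/-- With q the fast root, w' - q w obeys the first-order equation of the slow root; for a < 0 it is
the coordinate along the growing exponential. -/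
theorem modeVel_sub_fastRoot_mul (hd : 0 ≤ γ ^ 2 - 4 * ε * a) (h : ℝ → ℝ) (t : ℝ) :
    modeVel ε γ a h t - (fastRoot ε γ a).re * modePos ε γ a h t = (modeAux ε γ a h t).re := by
  rw [modeVel, modePos, Complex.add_re]
  nth_rw 1 [fastRoot_eq_ofReal hd]
  rw [Complex.re_ofReal_mul]
  ring

/-- For a < 0 the slow root has positive real part, so the resolvent integrates over the future
only. -/
theorem modeAux_zero_of_ae (hε : 0 < ε) (hγ : 0 < γ) (ha : a < 0) {h : ℝ → ℝ}
    (hh : ∀ᵐ t, 0 < t → h t = 0) : modeAux ε γ a h 0 = 0 := by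
  have hr := (slowRoot_re_pos hε hγ ha).le.not_gt
  rw [modeAux, expResolvent, decaySet, if_neg hr, if_neg hr]
  rw [setIntegral_eq_zero_of_ae_eq_zero]
  · simp
  · filter_upwards [hh] with t ht ht0
    simp [ht ht0]

/-- The value at `0` of the unstable component of the solution with right-hand side `1_{(0,1)}`. -/
def pulseCoeff (ε γ a : ℝ) : ℝ := (modeAux ε γ a ((Ioo 0 1).indicator 1) 0).re

/-- The roots are real for a < 0, and the value is -1/ε times the integral over (0,1) of a positive
exponential. Hence a pulse can produce any unstable component. -/
theorem pulseCoeff_ne_zero (hε : 0 < ε) (hγ : 0 < γ) (ha : a < 0) : pulseCoeff ε γ a ≠ 0 := by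
  have hr := (slowRoot_re_pos hε hγ ha).le.not_gt
  have hd : 0 ≤ γ ^ 2 - 4 * ε * a := by nlinarith [sq_nonneg γ, mul_pos hε (neg_pos.2 ha)]
  have key : modeAux ε γ a ((Ioo 0 1).indicator 1) 0 =
      ((-(ε⁻¹ * ∫ s in Ioo (0 : ℝ) 1, Real.exp (-((slowRoot ε γ a).re * s))) : ℝ) : ℂ) := by
    rw [modeAux, expResolvent, decaySet, if_neg hr, if_neg hr]
    have : ∀ s : ℝ, Complex.exp (-(slowRoot ε γ a * s)) *
        (((ε⁻¹ : ℝ) : ℂ) * (((Ioo (0 : ℝ) 1).indicator (1 : ℝ → ℝ) s : ℝ) : ℂ)) =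
        ((Ioo (0 : ℝ) 1).indicator
          (fun s => ε⁻¹ * Real.exp (-((slowRoot ε γ a).re * s))) s : ℝ) := by
      intro s
      by_cases hs : s ∈ Ioo (0 : ℝ) 1
      · rw [indicator_of_mem hs, indicator_of_mem hs, slowRoot_eq_ofReal hd]
        push_cast
        simp [mul_comm]
      · rw [indicator_of_notMem hs, indicator_of_notMem hs]; simp
    simp_rw [this]
    rw [integral_complex_ofReal, setIntegral_indicator measurableSet_Ioo,
      inter_eq_self_of_subset_right Ioo_subset_Ioi_self, integral_const_mul]
    push_cast
    simp
  rw [pulseCoeff, key, Complex.ofReal_re]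
  have : 0 < ∫ s in Ioo (0 : ℝ) 1, Real.exp (-((slowRoot ε γ a).re * s)) := by
    rw [← integral_Ioc_eq_integral_Ioo, ← intervalIntegral.integral_of_le zero_le_one]
    exact intervalIntegral.intervalIntegral_pos_of_pos
      ((by fun_prop : Continuous _).intervalIntegrable _ _) (fun s => Real.exp_pos _) zero_lt_one
  have : 0 < ε⁻¹ * ∫ s in Ioo (0 : ℝ) 1, Real.exp (-((slowRoot ε γ a).re * s)) := by positivity
  exact (neg_neg_of_pos this).ne

end

/-! ### Backward solutions of the homogeneous mode equation. -/

theorem eq_of_hasDerivWithinAt_zero {E : Type*} [NormedAddCommGroup E] [NormedSpace ℝ E]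
    {f : ℝ → E} {I : Set ℝ} (hI : Convex ℝ I) (hf : ∀ t ∈ I, HasDerivWithinAt f 0 I t) {s t : ℝ}
    (hs : s ∈ I) (ht : t ∈ I) : f s = f t := by
  have := hI.norm_image_sub_le_of_norm_hasDerivWithin_le (C := 0) hf (by simp) ht hs
  rw [zero_mul] at this
  exact sub_eq_zero.1 (norm_eq_zero.1 (le_antisymm this (norm_nonneg _)))

theorem hasDerivAt_cexp_neg_mul (r : ℂ) (t : ℝ) :
    HasDerivAt (fun s : ℝ => Complex.exp (-(r * s))) (-r * Complex.exp (-(r * t))) t := by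
  have h1 : HasDerivAt (fun s : ℝ => -(r * (s : ℂ))) (-r) t := by
    simpa using ((Complex.ofRealCLM.hasDerivAt (x := t)).const_mul r).fun_neg
  simpa [mul_comm] using h1.cexp

section
variable {z z₁ : ℝ → ℝ} {q r : ℂ}

/-- If `(d/dt - r) (d/dt - q) z = 0` on `(-∞, 0]`, `Re r < 0` and `z` is square integrable, then
`z' = q z`. -/
theorem deriv_eq_mul_of_sq_integrable (hr : r.re < 0)
    (hz : ∀ t ∈ Iic (0 : ℝ), HasDerivWithinAt z (z₁ t) (Iic 0) t)
    (hz₁ : ∀ t ∈ Iic (0 : ℝ), HasDerivWithinAt (fun s => (z₁ s : ℂ))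
      ((q + r) * z₁ t - q * r * z t) (Iic 0) t)
    (hi : IntegrableOn (fun t => z t ^ 2) (Iic 0)) {t : ℝ} (ht : t ≤ 0) :
    (z₁ t : ℂ) = q * z t := by
  have hzc : ∀ t ∈ Iic (0 : ℝ), HasDerivWithinAt (fun s => (z s : ℂ)) (z₁ t : ℂ) (Iic 0) t :=
    fun t ht => (hz t ht).ofReal_comp
  have hcont : ContinuousOn z (Iic 0) := fun t ht => (hz t ht).continuousWithinAt
  -- This quantity is constant in time; the claim is that the constant is zero.
  set c := Complex.exp (-(r * t)) * (z₁ t - q * z t) with hc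
  have hconst : ∀ s : ℝ, s ≤ 0 → Complex.exp (-(r * s)) * (z₁ s - q * z s) = c := by
    intro s hs
    refine eq_of_hasDerivWithinAt_zero (convex_Iic (0 : ℝ)) (f := fun s : ℝ =>
      Complex.exp (-(r * s)) * (z₁ s - q * z s)) (fun x hx => ?_) hs ht
    refine ((hasDerivAt_cexp_neg_mul r x).hasDerivWithinAt.mul
      ((hz₁ x hx).fun_sub ((hzc x hx).const_mul q))).congr_deriv ?_
    ring
  suffices hc0 : c = 0 by
    rw [hc0] at hc
    have := (mul_eq_zero.1 hc.symm).resolve_left (Complex.exp_ne_zero _)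
    linear_combination this
  -- The constant is averaged over [T - 1, T] with a weight ψ of mass 1/6 that vanishes at both
  -- ends. Integration by parts moves the derivative from z to ψ, so only the square integral of z
  -- enters, and the factor e^{-Re(r) T} tends to 0 as T → -∞.
  have hK : ∀ T ≤ (0 : ℝ), ‖c‖ / 6 ≤ (1 + ‖q - r‖) * Real.exp (-r.re * T) *
      (1 + ∫ t in Iic 0, z t ^ 2) := by
    intro T hT
    set ψ : ℝ → ℂ := fun s => (s - T + 1) * (T - s) with hψ
    set ψ' : ℝ → ℂ := fun s => (T - s) - (s - T + 1) with hψ'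
    have hsub : uIcc (T - 1) T ⊆ Iic 0 := by
      rw [uIcc_of_le (by linarith)]; exact fun x hx => hx.2.trans hT
    have hψd : ∀ s : ℝ, HasDerivAt ψ (ψ' s) s := by
      intro s
      have h1 : HasDerivAt (fun s : ℝ => (s : ℂ)) 1 s := Complex.ofRealCLM.hasDerivAt
      refine (((h1.sub_const (T : ℂ)).add_const 1).mul (h1.const_sub (T : ℂ))).congr_deriv ?_
      simp only [hψ']; ring
    have hψc : Continuous ψ := by fun_prop
    have hψ'c : Continuous ψ' := by fun_prop
    have hd : ∀ s ∈ Ioo (T - 1) T, HasDerivAt (fun s : ℝ => ψ s * (Complex.exp (-(r * s)) * z s))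
        (ψ s * c + (ψ' s + (q - r) * ψ s) * (Complex.exp (-(r * s)) * z s)) s := by
      intro s hs
      have hs0 : s < 0 := hs.2.trans_le hT
      have hn : Iic (0 : ℝ) ∈ 𝓝 s := Iic_mem_nhds hs0
      refine ((hψd s).mul ((hasDerivAt_cexp_neg_mul r s).fun_mul
        ((hzc s hs0.le).hasDerivAt hn))).congr_deriv ?_
      rw [← hconst s hs0.le]
      ring
    have hzcont : ContinuousOn (fun s => (z s : ℂ)) (uIcc (T - 1) T) :=
      Complex.continuous_ofReal.comp_continuousOn (hcont.mono hsub)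
    have hF : ContinuousOn (fun s : ℝ => Complex.exp (-(r * s)) * z s) (uIcc (T - 1) T) :=
      (by fun_prop : Continuous fun s : ℝ => Complex.exp (-(r * s))).continuousOn.mul hzcont
    have hG : ContinuousOn (fun s : ℝ => (ψ' s + (q - r) * ψ s) *
        (Complex.exp (-(r * s)) * z s)) (uIcc (T - 1) T) :=
      (by fun_prop : Continuous fun s : ℝ => ψ' s + (q - r) * ψ s).continuousOn.mul hF
    have hle : T - 1 ≤ T := by linarith
    have hψi : IntervalIntegrable (fun s => ψ s * c) volume (T - 1) T :=
      (hψc.mul continuous_const).intervalIntegrable _ _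
    have hint := intervalIntegral.integral_eq_sub_of_hasDerivAt_of_le hle
      (f := fun s : ℝ => ψ s * (Complex.exp (-(r * s)) * z s))
      (by rw [← uIcc_of_le hle]; exact hψc.continuousOn.mul hF) hd
      (hψi.add hG.intervalIntegrable)
    rw [intervalIntegral.integral_add hψi
      hG.intervalIntegrable, intervalIntegral.integral_mul_const] at hint
    have h6 : ∫ s in (T - 1)..T, ψ s = 1 / 6 := by
      have hd3 : ∀ s ∈ uIcc (T - 1) T, HasDerivAt (fun s : ℝ =>
          ((s - T + 1 : ℂ)) ^ 2 / 2 - (s - T + 1 : ℂ) ^ 3 / 3) (ψ s) s := by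
        intro s _
        have h1 : HasDerivAt (fun s : ℝ => (s - T + 1 : ℂ)) 1 s :=
          ((Complex.ofRealCLM.hasDerivAt (x := s)).sub_const (T : ℂ)).add_const 1
        refine (((h1.pow 2).div_const 2).sub ((h1.pow 3).div_const 3)).congr_deriv ?_
        simp only [hψ]; push_cast; ring
      rw [intervalIntegral.integral_eq_sub_of_hasDerivAt hd3 (hψc.intervalIntegrable _ _)]
      push_cast; ring
    have h0 : ψ T * (Complex.exp (-(r * T)) * z T) -
        ψ (T - 1 : ℝ) * (Complex.exp (-(r * (T - 1 : ℝ))) * z (T - 1)) = 0 := by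
      simp only [hψ]; push_cast; ring
    rw [h6, h0] at hint
    have hc6 : ‖c‖ / 6 = ‖∫ s in (T - 1)..T, (ψ' s + (q - r) * ψ s) *
        (Complex.exp (-(r * s)) * z s)‖ := by
      rw [← eq_neg_iff_add_eq_zero] at hint
      rw [← norm_neg (∫ s in (T - 1)..T, _), ← hint]
      simp; ring
    rw [hc6]
    have hzi : IntervalIntegrable (fun s => 1 + z s ^ 2) volume (T - 1) T :=
      (continuousOn_const.add ((hcont.mono hsub).pow 2)).intervalIntegrable
    calc _ ≤ ∫ s in (T - 1)..T, (1 + ‖q - r‖) * Real.exp (-r.re * T) * (1 + z s ^ 2) := by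
          refine intervalIntegral.norm_integral_le_of_norm_le hle ?_ (hzi.const_mul _)
          refine Eventually.of_forall fun s hs => ?_
          have hs1 : T - 1 ≤ s := hs.1.le
          have e1 : ‖ψ' s + (q - r) * ψ s‖ ≤ 1 + ‖q - r‖ := by
            have ha : ‖ψ' s‖ ≤ 1 := by
              have : ψ' s = ((T - s - (s - T + 1) : ℝ) : ℂ) := by simp only [hψ']; push_cast; ring
              rw [this, Complex.norm_real, Real.norm_eq_abs, abs_le]
              constructor <;> linarith [hs.2]
            have hb : ‖ψ s‖ ≤ 1 := by
              have : ψ s = (((s - T + 1) * (T - s) : ℝ) : ℂ) := by simp only [hψ]; push_cast; ring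
              rw [this, Complex.norm_real, Real.norm_eq_abs, abs_le]
              constructor <;> nlinarith [hs.2]
            calc _ ≤ ‖ψ' s‖ + ‖q - r‖ * ‖ψ s‖ := by rw [← norm_mul]; exact norm_add_le _ _
              _ ≤ 1 + ‖q - r‖ * 1 := by gcongr
              _ = _ := by ring
          have e2 : ‖Complex.exp (-(r * s))‖ ≤ Real.exp (-r.re * T) := by
            rw [Complex.norm_exp]
            refine Real.exp_le_exp.2 ?_
            simp only [Complex.neg_re, Complex.re_mul_ofReal]
            nlinarith [hs.2]
          have e3 : ‖(z s : ℂ)‖ ≤ 1 + z s ^ 2 := by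
            rw [Complex.norm_real, Real.norm_eq_abs]
            nlinarith [sq_abs (z s), sq_nonneg (|z s| - 1)]
          rw [norm_mul, norm_mul, mul_assoc]
          gcongr
      _ = (1 + ‖q - r‖) * Real.exp (-r.re * T) * (1 + ∫ s in (T - 1)..T, z s ^ 2) := by
          rw [intervalIntegral.integral_const_mul, intervalIntegral.integral_add (by simp)
            (show IntervalIntegrable (fun s => z s ^ 2) volume (T - 1) T from
              ((hcont.mono hsub).pow 2).intervalIntegrable)]
          simp
      _ ≤ _ := by
          gcongr
          rw [intervalIntegral.integral_of_le hle]
          exact setIntegral_mono_set hi (Eventually.of_forall fun s => by positivity)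
            (Eventually.of_forall fun s hs => (show s ≤ 0 from hs.2.trans hT))
  have hlim : Tendsto (fun T : ℝ => (1 + ‖q - r‖) * Real.exp (-r.re * T) *
      (1 + ∫ t in Iic 0, z t ^ 2)) atBot (𝓝 0) := by
    have h1 : Tendsto (fun T : ℝ => Real.exp (-r.re * T)) atBot (𝓝 0) :=
      Real.tendsto_exp_atBot.comp ((tendsto_const_mul_atBot_of_pos (by linarith)).2 tendsto_id)
    simpa using (h1.const_mul (1 + ‖q - r‖)).mul_const (1 + ∫ t in Iic 0, z t ^ 2)
  have := ge_of_tendsto hlim (eventually_atBot.2 ⟨0, hK⟩)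
  exact norm_eq_zero.1 (le_antisymm (by linarith) (norm_nonneg _))

theorem eq_exp_of_deriv_eq_mul
    (hz : ∀ t ∈ Iic (0 : ℝ), HasDerivWithinAt z (z₁ t) (Iic 0) t)
    (hq : ∀ t ≤ 0, (z₁ t : ℂ) = q * z t) {t : ℝ} (ht : t ≤ 0) :
    Complex.exp (-(q * t)) * z t = z 0 := by
  have := eq_of_hasDerivWithinAt_zero (convex_Iic (0 : ℝ)) (f := fun s : ℝ =>
      Complex.exp (-(q * s)) * z s) (fun x hx => ?_) (mem_Iic.2 ht) (mem_Iic.2 le_rfl)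
  · simpa using this
  · refine ((hasDerivAt_cexp_neg_mul q x).hasDerivWithinAt.mul
      (hz x hx).ofReal_comp).congr_deriv ?_
    rw [hq x hx]; ring

end

/-- A solution of `ε z'' + γ z' + a z = 0` that is square integrable at `-∞` and has no component
along the growing exponential vanishes. -/
theorem homogeneous_mode_eq_zero {ε γ a : ℝ} (hε : 0 < ε) (hγ : 0 < γ) (ha : a ≠ 0)
    {z z₁ : ℝ → ℝ} (hz : ∀ t ∈ Iic (0 : ℝ), HasDerivWithinAt z (z₁ t) (Iic 0) t)
    (hz₁ : ∀ t ∈ Iic (0 : ℝ), HasDerivWithinAt z₁ ((-γ * z₁ t - a * z t) / ε) (Iic 0) t)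
    (hi : IntegrableOn (fun t => z t ^ 2) (Iic 0))
    (h0 : a < 0 → z₁ 0 = (fastRoot ε γ a).re * z 0) {t : ℝ} (ht : t ≤ 0) : z t = 0 ∧ z₁ t = 0 := by
  have h1 := fastRoot_add_slowRoot hε γ a
  have h2 := fastRoot_mul_slowRoot hε γ a
  have hq : ∀ t ≤ 0, (z₁ t : ℂ) = slowRoot ε γ a * z t := fun t ht =>
    deriv_eq_mul_of_sq_integrable (fastRoot_re_neg hε hγ a) hz (fun t ht => by
      refine (hz₁ t ht).ofReal_comp.congr_deriv ?_
      rw [add_comm, h1, mul_comm (slowRoot ε γ a), h2]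
      push_cast
      ring) hi ht
  have he := fun t ht => eq_exp_of_deriv_eq_mul hz hq (t := t) ht
  have hz0 : z 0 = 0 := by
    rcases lt_or_gt_of_ne ha with hneg | hpos
    -- At time 0 the derivative of z is both the slow and the fast root times z, and their real
    -- parts have opposite signs.
    · have e1 := h0 hneg
      have e2 := hq 0 le_rfl
      have hs := slowRoot_re_pos hε hγ hneg
      have hf := fastRoot_re_neg hε hγ a
      have e3 := congrArg Complex.re e2
      rw [Complex.ofReal_re, Complex.re_mul_ofReal, e1] at e3
      have : ((fastRoot ε γ a).re - (slowRoot ε γ a).re) * z 0 = 0 := by linarith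
      exact (mul_eq_zero.1 this).resolve_left (by linarith)
    -- For a > 0 the slow exponential does not decay backwards in time, so a nonzero z(0)
    -- contradicts square integrability.
    · by_contra hne
      have hs := slowRoot_re_neg hε hγ hpos
      have hlow : ∀ t ≤ 0, z 0 ^ 2 ≤ z t ^ 2 := by
        intro t ht
        have e1 := congrArg norm (he t ht)
        rw [norm_mul, Complex.norm_exp, Complex.norm_real, Complex.norm_real] at e1
        have e2 : Real.exp (-(slowRoot ε γ a * t)).re ≤ 1 := by
          rw [Real.exp_le_one_iff]
          simp only [Complex.neg_re, Complex.re_mul_ofReal]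
          nlinarith
        rw [← sq_abs, ← sq_abs (z t)]
        have : |z 0| ≤ |z t| := by
          rw [← Real.norm_eq_abs, ← Real.norm_eq_abs, ← e1]
          exact mul_le_of_le_one_left (norm_nonneg _) e2
        gcongr
      have : IntegrableOn (fun _ : ℝ => z 0 ^ 2) (Iic 0) := by
        refine hi.mono' aestronglyMeasurable_const ?_
        refine (ae_restrict_iff' measurableSet_Iic).2 (Eventually.of_forall fun t ht => ?_)
        rw [Real.norm_eq_abs, abs_of_nonneg (by positivity)]
        exact hlow t ht
      rw [integrableOn_const_iff] at this
      simp [hne] at this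
  have hzt : z t = 0 := by
    have := he t ht
    rw [hz0, Complex.ofReal_zero] at this
    exact_mod_cast (mul_eq_zero.1 this).resolve_left (Complex.exp_ne_zero _)
  refine ⟨hzt, ?_⟩
  have := hq t ht
  rw [hzt, Complex.ofReal_zero, mul_zero] at this
  exact_mod_cast this

end

/-! ### The modal phase space and its relation to the energy space. -/

noncomputable section
open MeasureTheory Set Filter

/-- The modal phase space: `u, v` are encoded by `z n = √λₙ (u, eₙ) + i √ε (v, eₙ)`. -/
abbrev ModalSpace : Type := lp (fun _ : ℕ+ => ℂ) 2

section lpLift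
variable {𝕜 : Type*} [RCLike 𝕜] {V : Type*} [NormedAddCommGroup V] [NormedSpace ℝ V]

theorem memℓp_two_of_sum_le {f : ℕ+ → 𝕜} {C : ℝ} (h : ∀ s : Finset ℕ+, ∑ n ∈ s, ‖f n‖ ^ 2 ≤ C) :
    Memℓp f 2 :=
  memℓp_gen' (C := C) (by simpa using h)

theorem lp_two_norm_sq (f : lp (fun _ : ℕ+ => 𝕜) 2) : ‖f‖ ^ 2 = ∑' n, ‖f n‖ ^ 2 := by
  simpa using lp.norm_rpow_eq_tsum (p := 2) (by norm_num) f

theorem lp_two_summable (f : lp (fun _ : ℕ+ => 𝕜) 2) : Summable fun n => ‖f n‖ ^ 2 := by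
  simpa using (lp.memℓp f).summable (by norm_num)

theorem lp_two_sum_le (f : lp (fun _ : ℕ+ => 𝕜) 2) (s : Finset ℕ+) :
    ∑ n ∈ s, ‖f n‖ ^ 2 ≤ ‖f‖ ^ 2 := by
  rw [lp_two_norm_sq]
  exact (lp_two_summable f).sum_le_tsum s fun _ _ => by positivity

theorem lp_two_norm_le {f : lp (fun _ : ℕ+ => 𝕜) 2} {C : ℝ} (hC : 0 ≤ C)
    (h : ∀ s : Finset ℕ+, ∑ n ∈ s, ‖f n‖ ^ 2 ≤ C ^ 2) : ‖f‖ ≤ C :=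
  lp.norm_le_of_forall_sum_le (by norm_num) hC (by simpa using h)

/-- A bounded operator into `ℓ²` given by its coordinates. -/
def lpLift (B : V →ₗ[ℝ] (ℕ+ → 𝕜)) (C : ℝ) (hC : 0 ≤ C)
    (hB : ∀ v (s : Finset ℕ+), ∑ n ∈ s, ‖B v n‖ ^ 2 ≤ (C * ‖v‖) ^ 2) :
    V →L[ℝ] lp (fun _ : ℕ+ => 𝕜) 2 :=
  LinearMap.mkContinuous
    { toFun := fun v => ⟨B v, memℓp_two_of_sum_le (hB v)⟩
      map_add' := fun v w => by ext n; simp only [map_add]; rfl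
      map_smul' := fun c v => by ext n; simp only [map_smul]; rfl } C
    (fun v => lp_two_norm_le (by positivity) (hB v))

theorem lpLift_norm_le (B : V →ₗ[ℝ] (ℕ+ → 𝕜)) (C : ℝ) (hC : 0 ≤ C)
    (hB : ∀ v (s : Finset ℕ+), ∑ n ∈ s, ‖B v n‖ ^ 2 ≤ (C * ‖v‖) ^ 2) (v : V) :
    ‖lpLift B C hC hB v‖ ≤ C * ‖v‖ :=
  lp_two_norm_le (by positivity) (hB v)

/-- A curve in `ℓ²` with continuous coordinates that are dominated by a fixed square summable
sequence is continuous. -/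
theorem tendsto_lp_two_of_dominated {ι : Type*} {l : Filter ι} {z : ι → lp (fun _ : ℕ+ => 𝕜) 2}
    {z₀ : lp (fun _ : ℕ+ => 𝕜) 2} {b : ℕ+ → ℝ} (hb : Summable b)
    (hz : ∀ n, Tendsto (fun i => z i n) l (𝓝 (z₀ n)))
    (hbd : ∀ᶠ i in l, ∀ n, ‖z i n - z₀ n‖ ^ 2 ≤ b n) : Tendsto z l (𝓝 z₀) := by
  rw [tendsto_iff_norm_sub_tendsto_zero]
  have h1 : Tendsto (fun i => ∑' n, ‖z i n - z₀ n‖ ^ 2) l (𝓝 (∑' _ : ℕ+, (0 : ℝ))) := by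
    refine tendsto_tsum_of_dominated_convergence hb (fun n => ?_) ?_
    · have := ((hz n).sub_const (z₀ n)).norm.pow 2
      simpa using this
    · filter_upwards [hbd] with i hi n
      rw [Real.norm_of_nonneg (by positivity)]
      exact hi n
  rw [tsum_zero] at h1
  have h2 : ∀ i, ∑' n, ‖z i n - z₀ n‖ ^ 2 = ‖z i - z₀‖ ^ 2 := fun i => by
    rw [lp_two_norm_sq]; rfl
  simp_rw [h2] at h1
  have h3 := h1.sqrt
  simpa using h3

end lpLift

/-- The data of the damped wave equation in modal form. -/
structure WaveData (H : Type*) [NormedAddCommGroup H] [InnerProductSpace ℝ H] where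
  e : HilbertBasis ℕ+ ℝ H
  lam : ℕ+ → ℝ
  ε : ℝ
  ε_pos : 0 < ε
  lam_pos : ∀ n, 0 < lam n
  mono : Monotone lam
  F : H → H
  L : ℝ
  L_nonneg : 0 ≤ L
  F_lip : ∀ u v, ‖F u - F v‖ ≤ L * ‖u - v‖
  F_zero : F 0 = 0

namespace WaveData

variable {H : Type*} [NormedAddCommGroup H] [InnerProductSpace ℝ H] (d : WaveData H)

theorem hasSum_sq (u : H) : HasSum (fun n => ⟪u, d.e n⟫_ℝ ^ 2) (‖u‖ ^ 2) := by
  have := d.e.hasSum_inner_mul_inner u u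
  simp only [real_inner_self_eq_norm_sq, real_inner_comm u] at this
  simpa only [sq, real_inner_comm u] using this

theorem F_continuous : Continuous d.F := by
  exact (LipschitzWith.of_dist_le_mul (K := ⟨d.L, d.L_nonneg⟩) fun u v => by
    rw [dist_eq_norm, dist_eq_norm]; exact d.F_lip u v).continuous

theorem norm_F_le (u : H) : ‖d.F u‖ ≤ d.L * ‖u‖ := by
  simpa [d.F_zero] using d.F_lip u 0

theorem sqrt_lam_pos (n : ℕ+) : 0 < √(d.lam n) := Real.sqrt_pos.2 (d.lam_pos n)

theorem sqrt_ε_pos : 0 < √d.ε := Real.sqrt_pos.2 d.ε_pos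

/-- The position component of a modal state. -/
def pos : ModalSpace →L[ℝ] H :=
  (d.e.repr.symm.toContinuousLinearEquiv : _ →L[ℝ] H).comp
    (lpLift (𝕜 := ℝ)
      { toFun := fun z n => (z n).re / √(d.lam n)
        map_add' := fun z w => by ext n; simp; ring
        map_smul' := fun c z => by ext n; simp; ring } (√(d.lam 1))⁻¹ (by positivity)
      (fun z s => by
        refine le_trans ?_ ((mul_le_mul_of_nonneg_left (lp_two_sum_le z s)
          (sq_nonneg (√(d.lam 1))⁻¹)).trans_eq (by ring))
        rw [Finset.mul_sum]
        gcongr with n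
        simp only [LinearMap.coe_mk, AddHom.coe_mk]
        rw [← mul_pow]
        gcongr
        rw [norm_div, div_eq_inv_mul, Real.norm_eq_abs, Real.norm_eq_abs,
          abs_of_pos (d.sqrt_lam_pos n)]
        gcongr
        · exact d.sqrt_lam_pos 1
        · exact d.mono (one_le)
        · exact Complex.abs_re_le_norm _))

/-- The velocity component of a modal state. -/
def vel : ModalSpace →L[ℝ] H :=
  (d.e.repr.symm.toContinuousLinearEquiv : _ →L[ℝ] H).comp
    (lpLift (𝕜 := ℝ)
      { toFun := fun z n => (z n).im / √d.ε
        map_add' := fun z w => by ext n; simp; ring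
        map_smul' := fun c z => by ext n; simp; ring } (√d.ε)⁻¹ (by positivity)
      (fun z s => by
        refine le_trans ?_ ((mul_le_mul_of_nonneg_left (lp_two_sum_le z s)
          (sq_nonneg (√d.ε)⁻¹)).trans_eq (by ring))
        rw [Finset.mul_sum]
        gcongr with n
        simp only [LinearMap.coe_mk, AddHom.coe_mk]
        rw [← mul_pow]
        gcongr
        rw [norm_div, div_eq_inv_mul, Real.norm_eq_abs, Real.norm_eq_abs,
          abs_of_pos d.sqrt_ε_pos]
        gcongr
        exact Complex.abs_im_le_norm _))

theorem inner_repr_symm (f : lp (fun _ : ℕ+ => ℝ) 2) (n : ℕ+) :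
    ⟪d.e.repr.symm f, d.e n⟫_ℝ = f n := by
  rw [real_inner_comm, ← d.e.repr_apply_apply]; simp

theorem inner_pos (z : ModalSpace) (n : ℕ+) : ⟪d.pos z, d.e n⟫_ℝ = (z n).re / √(d.lam n) :=
  d.inner_repr_symm _ n

theorem inner_vel (z : ModalSpace) (n : ℕ+) : ⟪d.vel z, d.e n⟫_ℝ = (z n).im / √d.ε :=
  d.inner_repr_symm _ n

theorem ext_inner {u v : H} (h : ∀ n, ⟪u, d.e n⟫_ℝ = ⟪v, d.e n⟫_ℝ) : u = v := by
  apply d.e.repr.injective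
  ext n
  rw [d.e.repr_apply_apply, d.e.repr_apply_apply, real_inner_comm, h, real_inner_comm]

theorem re_eq (z : ModalSpace) (n : ℕ+) : (z n).re = √(d.lam n) * ⟪d.pos z, d.e n⟫_ℝ := by
  rw [inner_pos]; field_simp [(d.sqrt_lam_pos n).ne']

theorem im_eq (z : ModalSpace) (n : ℕ+) : (z n).im = √d.ε * ⟪d.vel z, d.e n⟫_ℝ := by
  rw [inner_vel]; field_simp [d.sqrt_ε_pos.ne']

theorem modal_ext {z w : ModalSpace} (h1 : ∀ n, ⟪d.pos z, d.e n⟫_ℝ = ⟪d.pos w, d.e n⟫_ℝ)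
    (h2 : ∀ n, ⟪d.vel z, d.e n⟫_ℝ = ⟪d.vel w, d.e n⟫_ℝ) : z = w := by
  ext n
  apply Complex.ext
  · rw [d.re_eq, d.re_eq, h1]
  · rw [d.im_eq, d.im_eq, h2]

theorem norm_sq_coord (z : ModalSpace) (n : ℕ+) :
    ‖z n‖ ^ 2 = d.lam n * ⟪d.pos z, d.e n⟫_ℝ ^ 2 + d.ε * ⟪d.vel z, d.e n⟫_ℝ ^ 2 := by
  rw [← Complex.normSq_eq_norm_sq, Complex.normSq_apply, d.re_eq, d.im_eq]
  have h1 := Real.sq_sqrt (d.lam_pos n).le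
  have h2 := Real.sq_sqrt d.ε_pos.le
  linear_combination ⟪d.pos z, d.e n⟫_ℝ ^ 2 * h1 + ⟪d.vel z, d.e n⟫_ℝ ^ 2 * h2

/-- The embedding `y ↦ (0, y)` of velocities. -/
def embV : H →L[ℝ] ModalSpace :=
  lpLift
    { toFun := fun y n => Complex.I * (√d.ε * ⟪y, d.e n⟫_ℝ : ℝ)
      map_add' := fun z w => by ext n; simp [inner_add_left]; ring
      map_smul' := fun c z => by ext n; simp [inner_smul_left]; ring } (√d.ε) (by positivity)
    (fun y s => by
      rw [mul_pow, ← (d.hasSum_sq y).tsum_eq]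
      refine le_trans (le_of_eq ?_) (mul_le_mul_of_nonneg_left
        ((d.hasSum_sq y).summable.sum_le_tsum s fun _ _ => by positivity) (sq_nonneg _))
      rw [Finset.mul_sum]
      refine Finset.sum_congr rfl fun n _ => ?_
      simp [mul_pow])

theorem embV_apply (y : H) (n : ℕ+) :
    d.embV y n = Complex.I * (√d.ε * ⟪y, d.e n⟫_ℝ : ℝ) := rfl

@[simp]
theorem inner_pos_embV (y : H) (n : ℕ+) : ⟪d.pos (d.embV y), d.e n⟫_ℝ = 0 := by
  rw [inner_pos, embV_apply]; simp

@[simp]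
theorem pos_embV (y : H) : d.pos (d.embV y) = 0 := d.ext_inner fun n => by simp

@[simp]
theorem vel_embV (y : H) : d.vel (d.embV y) = y := d.ext_inner fun n => by
  rw [inner_vel, embV_apply]
  have := d.sqrt_ε_pos.ne'
  simp [this]

/-- The modal state with given components. -/
def ofCoords (u v : ℕ+ → ℝ) (C : ℝ)
    (h : ∀ s : Finset ℕ+, ∑ n ∈ s, (d.lam n * u n ^ 2 + d.ε * v n ^ 2) ≤ C) : ModalSpace :=
  ⟨fun n => ⟨√(d.lam n) * u n, √d.ε * v n⟩, memℓp_two_of_sum_le (C := C) fun s => by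
    refine le_trans (le_of_eq (Finset.sum_congr rfl fun n _ => ?_)) (h s)
    rw [← Complex.normSq_eq_norm_sq, Complex.normSq_apply]
    have h1 := Real.sq_sqrt (d.lam_pos n).le
    have h2 := Real.sq_sqrt d.ε_pos.le
    linear_combination u n ^ 2 * h1 + v n ^ 2 * h2⟩

theorem inner_pos_ofCoords (u v : ℕ+ → ℝ) (C : ℝ) (h) (n : ℕ+) :
    ⟪d.pos (d.ofCoords u v C h), d.e n⟫_ℝ = u n := by
  rw [inner_pos]
  have := (d.sqrt_lam_pos n).ne'
  simp [ofCoords, this]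

theorem inner_vel_ofCoords (u v : ℕ+ → ℝ) (C : ℝ) (h) (n : ℕ+) :
    ⟪d.vel (d.ofCoords u v C h), d.e n⟫_ℝ = v n := by
  rw [inner_vel]
  have := d.sqrt_ε_pos.ne'
  simp [ofCoords, this]

attribute [irreducible] pos vel embV ofCoords

/-- The energy-space state of a modal state. -/
def toEnergy (z : ModalSpace) : energySpace d.e d.lam :=
  ⟨(d.pos z, d.vel z), by
    refine Summable.of_nonneg_of_le (fun n => ?_) (fun n => ?_) (lp_two_summable z)
    · have := d.lam_pos n; positivity
    · rw [Real.rpow_one, d.norm_sq_coord]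
      have := d.ε_pos
      exact le_add_of_nonneg_right (by positivity)⟩

/-- The modal state of an energy-space state. -/
def ofEnergy (ξ : energySpace d.e d.lam) : ModalSpace :=
  d.ofCoords (fun n => ⟪(ξ : H × H).1, d.e n⟫_ℝ) (fun n => ⟪(ξ : H × H).2, d.e n⟫_ℝ)
    ((∑' n, d.lam n * ⟪(ξ : H × H).1, d.e n⟫_ℝ ^ 2) + d.ε * ‖(ξ : H × H).2‖ ^ 2) (fun s => by
      have hs : Summable fun n => d.lam n * ⟪(ξ : H × H).1, d.e n⟫_ℝ ^ 2 := by
        simpa [MemHs, energySpace] using ξ.2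
      rw [Finset.sum_add_distrib, ← Finset.mul_sum]
      refine add_le_add (hs.sum_le_tsum s fun n _ => ?_) (mul_le_mul_of_nonneg_left ?_ d.ε_pos.le)
      · have := d.lam_pos n; positivity
      · rw [← (d.hasSum_sq _).tsum_eq]
        exact (d.hasSum_sq _).summable.sum_le_tsum s fun _ _ => by positivity)

@[simp]
theorem pos_ofEnergy (ξ : energySpace d.e d.lam) : d.pos (d.ofEnergy ξ) = (ξ : H × H).1 :=
  d.ext_inner fun _ => d.inner_pos_ofCoords ..

@[simp]
theorem vel_ofEnergy (ξ : energySpace d.e d.lam) : d.vel (d.ofEnergy ξ) = (ξ : H × H).2 :=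
  d.ext_inner fun _ => d.inner_vel_ofCoords ..

@[simp]
theorem toEnergy_fst (z : ModalSpace) : (d.toEnergy z : H × H).1 = d.pos z := rfl

@[simp]
theorem toEnergy_snd (z : ModalSpace) : (d.toEnergy z : H × H).2 = d.vel z := rfl

@[simp]
theorem toEnergy_ofEnergy (ξ : energySpace d.e d.lam) : d.toEnergy (d.ofEnergy ξ) = ξ :=
  Subtype.ext (Prod.ext (by simp) (by simp))

@[simp]
theorem ofEnergy_toEnergy (z : ModalSpace) : d.ofEnergy (d.toEnergy z) = z :=
  d.modal_ext (by simp) (by simp)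

/-- The modal norm accounts for every term of the energy norm except the one in H⁻¹. -/
theorem energyNorm_sq (z : ModalSpace) :
    energyNorm d.e d.lam d.ε (d.pos z, d.vel z) ^ 2 =
      ‖z‖ ^ 2 + ∑' n, (d.lam n)⁻¹ * ⟪d.vel z, d.e n⟫_ℝ ^ 2 := by
  have hl := d.lam_pos
  have hε := d.ε_pos
  have e1 : hsNormSq d.e d.lam (-1) (d.vel z) = ∑' n, (d.lam n)⁻¹ * ⟪d.vel z, d.e n⟫_ℝ ^ 2 := by
    simp [hsNormSq, Real.rpow_neg_one]
  have e2 : hsNormSq d.e d.lam 1 (d.pos z) = ∑' n, d.lam n * ⟪d.pos z, d.e n⟫_ℝ ^ 2 := by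
    simp [hsNormSq]
  have hs : Summable fun n => d.lam n * ⟪d.pos z, d.e n⟫_ℝ ^ 2 := by
    simpa [MemHs, energySpace] using (d.toEnergy z).2
  have hv := (d.hasSum_sq (d.vel z)).mul_left d.ε
  have h0 : 0 ≤ ∑' n, (d.lam n)⁻¹ * ⟪d.vel z, d.e n⟫_ℝ ^ 2 :=
    tsum_nonneg fun n => by have := hl n; positivity
  have h0' : 0 ≤ ∑' n, d.lam n * ⟪d.pos z, d.e n⟫_ℝ ^ 2 :=
    tsum_nonneg fun n => by have := hl n; positivity
  rw [energyNorm, e1, e2, Real.sq_sqrt (by positivity), lp_two_norm_sq]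
  simp_rw [d.norm_sq_coord]
  rw [hs.tsum_add hv.summable, hv.tsum_eq]
  ring

theorem norm_le_energyNorm (z : ModalSpace) :
    ‖z‖ ≤ energyNorm d.e d.lam d.ε (d.pos z, d.vel z) := by
  refine le_of_sq_le_sq ?_ (Real.sqrt_nonneg _)
  rw [d.energyNorm_sq]
  exact le_add_of_nonneg_right (tsum_nonneg fun n => by have := d.lam_pos n; positivity)

/-- The constant in the comparison of the energy norm with the modal norm. -/
def normConst : ℝ := √(1 + (d.ε * d.lam 1)⁻¹)

theorem normConst_pos : 0 < d.normConst := by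
  have := d.ε_pos; have := d.lam_pos 1
  exact Real.sqrt_pos.2 (by positivity)

/-- As λ_n ≥ λ_1, the H⁻¹ norm of the velocity is controlled by its H norm. With
`norm_le_energyNorm`, the two norms are equivalent, and estimates may be made in the modal norm. -/
theorem energyNorm_le (z : ModalSpace) :
    energyNorm d.e d.lam d.ε (d.pos z, d.vel z) ≤ d.normConst * ‖z‖ := by
  have hε := d.ε_pos
  have hl := d.lam_pos
  have hl1 := hl 1
  refine le_of_sq_le_sq ?_ (by have := d.normConst_pos; positivity)
  rw [d.energyNorm_sq, mul_pow, normConst, Real.sq_sqrt (by positivity), add_mul, one_mul]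
  gcongr
  rw [lp_two_norm_sq, ← tsum_mul_left]
  have hle : ∀ n, (d.lam n)⁻¹ * ⟪d.vel z, d.e n⟫_ℝ ^ 2 ≤ (d.ε * d.lam 1)⁻¹ * ‖z n‖ ^ 2 := by
    intro n
    rw [d.norm_sq_coord, mul_inv, mul_comm d.ε⁻¹, mul_assoc]
    have h1 : (d.lam n)⁻¹ ≤ (d.lam 1)⁻¹ := inv_anti₀ hl1 (d.mono (one_le))
    have h2 := hl n
    have h3 : ⟪d.vel z, d.e n⟫_ℝ ^ 2 ≤ d.ε⁻¹ * (d.lam n * ⟪d.pos z, d.e n⟫_ℝ ^ 2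
        + d.ε * ⟪d.vel z, d.e n⟫_ℝ ^ 2) := by
      rw [mul_add, ← mul_assoc, ← mul_assoc, inv_mul_cancel₀ hε.ne', one_mul]
      exact le_add_of_nonneg_left (by positivity)
    gcongr
  have hsum := (lp_two_summable z).mul_left (d.ε * d.lam 1)⁻¹
  exact (hsum.of_nonneg_of_le (fun n => by have := hl n; positivity) hle).tsum_le_tsum hle hsum

end WaveData

end

/-! ### Integral identities, and ordinary differential equations with Lipschitz field. -/

noncomputable section
open MeasureTheory Set Filter
open scoped NNReal BoundedContinuousFunction

section FTC
variable {E : Type*} [NormedAddCommGroup E] [NormedSpace ℝ E] {f g : ℝ → E} {I : Set ℝ}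

/-- This form passes from coordinates to vectors: scalar equations are integrated, assembled into a
vector identity, and differentiated again, endpoints of the interval included. -/
theorem hasDerivWithinAt_of_sub_eq_integral [CompleteSpace E] (hI : I.OrdConnected)
    (hg : ContinuousOn g I) (h : ∀ s ∈ I, ∀ t ∈ I, f t - f s = ∫ x in s..t, g x) {t : ℝ}
    (ht : t ∈ I) : HasDerivWithinAt f (g t) I t := by
  rw [hasDerivWithinAt_iff_isLittleO, Asymptotics.isLittleO_iff]
  intro c hc
  have h1 := Metric.continuousWithinAt_iff.1 (hg t ht) c hc
  obtain ⟨r, hr, hrc⟩ := h1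
  filter_upwards [self_mem_nhdsWithin, mem_nhdsWithin_of_mem_nhds (Metric.ball_mem_nhds t hr)]
    with s hs hsr
  have hsub : uIcc t s ⊆ I := hI.uIcc_subset ht hs
  have hgi : IntervalIntegrable g volume t s := (hg.mono hsub).intervalIntegrable
  have e : f s - f t - (s - t) • g t = ∫ x in t..s, (g x - g t) := by
    rw [intervalIntegral.integral_sub hgi (by simp), h t ht s hs]
    simp
  rw [e, Real.norm_eq_abs]
  refine intervalIntegral.norm_integral_le_of_norm_le_const fun x hx => ?_
  have hx' := uIoc_subset_uIcc hx
  rw [← dist_eq_norm]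
  refine (hrc (hsub hx') ?_).le
  rw [Real.dist_eq] at *
  have := abs_sub_left_of_mem_uIcc hx'
  rw [Metric.mem_ball, Real.dist_eq] at hsr
  exact this.trans_lt hsr

theorem sub_eq_integral_of_hasDerivWithinAt [CompleteSpace E] (hI : I.OrdConnected)
    (hg : ContinuousOn g I) (h : ∀ t ∈ I, HasDerivWithinAt f (g t) I t) {s t : ℝ}
    (hs : s ∈ I) (ht : t ∈ I) : f t - f s = ∫ x in s..t, g x := by
  have hsub : uIcc s t ⊆ I := hI.uIcc_subset hs ht
  refine (intervalIntegral.integral_eq_sub_of_hasDeriv_right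
    (fun x hx => (h x (hsub hx)).continuousWithinAt.mono hsub) (fun x hx => ?_)
    (hg.mono hsub).intervalIntegrable).symm
  have hx' : x ∈ I := hsub (Ioo_subset_Icc_self hx)
  have hn : I ∈ 𝓝 x := Filter.mem_of_superset (Icc_mem_nhds hx.1 hx.2) hsub
  exact ((h x hx').hasDerivAt hn).hasDerivWithinAt

end FTC

section ODE
variable {E : Type*} [NormedAddCommGroup E] [NormedSpace ℝ E] {g : ℝ → E → E} {K : ℝ≥0}

theorem abs_integral_exp_abs_le {κ : ℝ} (hκ : 0 < κ) (t : ℝ) :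
    |∫ s in (0 : ℝ)..t, Real.exp (κ * |s|)| ≤ Real.exp (κ * |t|) / κ := by
  have key : ∀ t, 0 ≤ t → ∫ s in (0 : ℝ)..t, Real.exp (κ * |s|) = (Real.exp (κ * t) - 1) / κ := by
    intro t ht
    rw [intervalIntegral.integral_congr (g := fun s => Real.exp (κ * s))]
    · have hd : ∀ x ∈ uIcc 0 t, HasDerivAt (fun s => Real.exp (κ * s) / κ) (Real.exp (κ * x)) x := by
        intro x _
        refine (((hasDerivAt_id x).const_mul κ).exp.div_const κ).congr_deriv ?_
        field_simp
        rfl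
      rw [intervalIntegral.integral_eq_sub_of_hasDerivAt hd
        ((by fun_prop : Continuous _).intervalIntegrable _ _)]
      simp; ring
    · intro s hs
      rw [uIcc_of_le ht] at hs
      simp only [abs_of_nonneg hs.1]
  have h0 : 0 ≤ ∫ s in (0 : ℝ)..|t|, Real.exp (κ * |s|) :=
    intervalIntegral.integral_nonneg (abs_nonneg t) fun s _ => (Real.exp_pos _).le
  have h1 : |∫ s in (0 : ℝ)..t, Real.exp (κ * |s|)| = ∫ s in (0 : ℝ)..|t|, Real.exp (κ * |s|) := by
    rcases le_total 0 t with h | h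
    · rw [abs_of_nonneg h] at h0 ⊢
      exact abs_of_nonneg h0
    · rw [abs_of_nonpos h] at h0 ⊢
      have := intervalIntegral.integral_comp_neg (a := 0) (b := -t)
        (fun s => Real.exp (κ * |s|))
      simp only [abs_neg, neg_neg, neg_zero] at this
      rw [this] at h0 ⊢
      rw [intervalIntegral.integral_symm, abs_neg, abs_of_nonneg h0]
  rw [h1, key _ (abs_nonneg t)]
  gcongr
  linarith

/-- Global existence for a globally Lipschitz vector field that vanishes at `0`. -/
theorem exists_global_solution [CompleteSpace E] (hg : Continuous (Function.uncurry g))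
    (hK : ∀ t, LipschitzWith K (g t)) (h0 : ∀ t, g t 0 = 0) (x₀ : E) :
    ∃ ζ : ℝ → E, ζ 0 = x₀ ∧ ∀ t, HasDerivAt ζ (g t (ζ t)) t := by
  -- The fixed point is sought for y = e^{-κ|t|} ζ among bounded continuous functions; the Picard
  -- map then contracts by K/κ, which is below 1/2, and no local solutions have to be glued.
  set κ : ℝ := 2 * K + 1 with hκ
  have hκ0 : 0 < κ := by positivity
  have hnorm : ∀ t x y, ‖g t x - g t y‖ ≤ K * ‖x - y‖ := fun t x y => by
    simpa [dist_eq_norm] using (hK t).dist_le_mul x y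
  have hnorm0 : ∀ t x, ‖g t x‖ ≤ K * ‖x‖ := fun t x => by simpa [h0] using hnorm t x 0
  have hexp : ∀ t : ℝ, Real.exp (-(κ * |t|)) * Real.exp (κ * |t|) = 1 := fun t => by
    rw [← Real.exp_add]; simp
  let G : (ℝ →ᵇ E) → ℝ → E := fun y s => g s (Real.exp (κ * |s|) • y s)
  have hGc : ∀ y : ℝ →ᵇ E, Continuous (G y) := fun y =>
    hg.comp (continuous_id.prodMk ((by fun_prop : Continuous fun s : ℝ =>
      Real.exp (κ * |s|)).smul y.continuous))
  have hint : ∀ (φ : ℝ → E) (M : ℝ), 0 ≤ M → (∀ s, ‖φ s‖ ≤ K * (Real.exp (κ * |s|) * M)) →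
      ∀ t, ‖Real.exp (-(κ * |t|)) • ∫ s in (0 : ℝ)..t, φ s‖ ≤ 2⁻¹ * M := by
    intro φ M hM hφ t
    have h1 : ‖∫ s in (0 : ℝ)..t, φ s‖ ≤ K * M * (Real.exp (κ * |t|) / κ) := by
      calc ‖∫ s in (0 : ℝ)..t, φ s‖ ≤ |∫ s in (0 : ℝ)..t, K * (Real.exp (κ * |s|) * M)| :=
            intervalIntegral.norm_integral_le_abs_of_norm_le (Eventually.of_forall fun s => hφ s)
              ((by fun_prop : Continuous _).intervalIntegrable _ _)
        _ = K * M * |∫ s in (0 : ℝ)..t, Real.exp (κ * |s|)| := by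
            rw [intervalIntegral.integral_const_mul, intervalIntegral.integral_mul_const, abs_mul,
              abs_mul, abs_of_nonneg (NNReal.coe_nonneg K), abs_of_nonneg hM]
            ring
        _ ≤ _ := by gcongr; exact abs_integral_exp_abs_le hκ0 t
    rw [norm_smul, Real.norm_of_nonneg (Real.exp_pos _).le]
    calc Real.exp (-(κ * |t|)) * ‖∫ s in (0 : ℝ)..t, φ s‖
        ≤ Real.exp (-(κ * |t|)) * (K * M * (Real.exp (κ * |t|) / κ)) := by gcongr
      _ = (K / κ) * M * (Real.exp (-(κ * |t|)) * Real.exp (κ * |t|)) := by ring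
      _ ≤ 2⁻¹ * M := by
          rw [hexp, mul_one]
          gcongr
          rw [div_le_iff₀ hκ0, hκ]
          have : (0 : ℝ) ≤ K := K.2
          linarith
  have hGb : ∀ y : ℝ →ᵇ E, ∀ s, ‖G y s‖ ≤ K * (Real.exp (κ * |s|) * ‖y‖) := by
    intro y s
    refine (hnorm0 _ _).trans ?_
    rw [norm_smul, Real.norm_of_nonneg (Real.exp_pos _).le]
    gcongr
    exact y.norm_coe_le_norm s
  let P : (ℝ →ᵇ E) → (ℝ →ᵇ E) := fun y => BoundedContinuousFunction.ofNormedAddCommGroup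
    (fun t => Real.exp (-(κ * |t|)) • (x₀ + ∫ s in (0 : ℝ)..t, G y s))
    ((by fun_prop : Continuous fun t : ℝ => Real.exp (-(κ * |t|))).smul (continuous_const.add
      (intervalIntegral.continuous_primitive (fun a b => (hGc y).intervalIntegrable a b) 0)))
    (‖x₀‖ + 2⁻¹ * ‖y‖) (fun t => by
      rw [smul_add]
      refine (norm_add_le _ _).trans (add_le_add ?_ (hint _ _ (norm_nonneg _) (hGb y) t))
      rw [norm_smul, Real.norm_of_nonneg (Real.exp_pos _).le]
      refine mul_le_of_le_one_left (norm_nonneg _) (Real.exp_le_one_iff.2 ?_)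
      have := abs_nonneg t
      nlinarith)
  have hP : ContractingWith 2⁻¹ P := by
    refine ⟨by rw [← NNReal.coe_lt_coe]; norm_num, LipschitzWith.of_dist_le_mul fun y z => ?_⟩
    rw [BoundedContinuousFunction.dist_le (by positivity)]
    intro t
    change dist (Real.exp (-(κ * |t|)) • (x₀ + ∫ s in (0 : ℝ)..t, G y s))
      (Real.exp (-(κ * |t|)) • (x₀ + ∫ s in (0 : ℝ)..t, G z s)) ≤ _
    rw [dist_eq_norm, ← smul_sub, add_sub_add_left_eq_sub,
      ← intervalIntegral.integral_sub ((hGc y).intervalIntegrable _ _)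
        ((hGc z).intervalIntegrable _ _), dist_eq_norm]
    refine (hint _ _ (norm_nonneg (y - z)) (fun s => ?_) t).trans (le_of_eq (by simp))
    refine (hnorm _ _ _).trans ?_
    rw [← smul_sub, norm_smul, Real.norm_of_nonneg (Real.exp_pos _).le]
    gcongr
    exact (y - z).norm_coe_le_norm s
  obtain ⟨y, hy, -⟩ := hP.exists_fixedPoint (0 : ℝ →ᵇ E) (edist_ne_top _ _)
  have hyt : ∀ t, Real.exp (κ * |t|) • y t = x₀ + ∫ s in (0 : ℝ)..t, G y s := by
    intro t
    have : y t = Real.exp (-(κ * |t|)) • (x₀ + ∫ s in (0 : ℝ)..t, G y s) :=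
      (DFunLike.congr_fun hy t).symm
    rw [this, smul_smul, mul_comm, hexp, one_smul]
  refine ⟨fun t => Real.exp (κ * |t|) • y t, by simpa using hyt 0, fun t => ?_⟩
  have h1 : HasDerivAt (fun t => x₀ + ∫ s in (0 : ℝ)..t, G y s) (G y t) t :=
    (intervalIntegral.integral_hasDerivAt_right ((hGc y).intervalIntegrable _ _)
      ((hGc y).stronglyMeasurableAtFilter _ _) (hGc y).continuousAt).const_add x₀
  simp_rw [← hyt] at h1
  exact h1

theorem solution_unique_of_ordConnected (hK : ∀ t, LipschitzWith K (g t)) {I : Set ℝ}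
    (hI : I.OrdConnected) (h0 : (0 : ℝ) ∈ I) {f₁ f₂ : ℝ → E}
    (h1 : ∀ t ∈ I, HasDerivWithinAt f₁ (g t (f₁ t)) I t)
    (h2 : ∀ t ∈ I, HasDerivWithinAt f₂ (g t (f₂ t)) I t) (h : f₁ 0 = f₂ 0) {t : ℝ} (ht : t ∈ I) :
    f₁ t = f₂ t := by
  rcases le_total 0 t with hle | hle
  · have hsub : Icc 0 t ⊆ I := hI.out h0 ht
    have hd : ∀ {f : ℝ → E}, (∀ t ∈ I, HasDerivWithinAt f (g t (f t)) I t) →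
        ∀ s ∈ Ico 0 t, HasDerivWithinAt f (g s (f s)) (Ici s) s := fun h s hs =>
      (h s (hsub (Ico_subset_Icc_self hs))).mono_of_mem_nhdsWithin
        (Filter.mem_of_superset (Icc_mem_nhdsGE hs.2)
          ((Icc_subset_Icc_left hs.1).trans hsub))
    exact ODE_solution_unique_of_mem_Icc_right (s := fun _ => univ)
      (fun t _ => (hK t).lipschitzOnWith)
      (fun s hs => (h1 s (hsub hs)).continuousWithinAt.mono hsub) (hd h1) (fun _ _ => trivial)
      (fun s hs => (h2 s (hsub hs)).continuousWithinAt.mono hsub) (hd h2) (fun _ _ => trivial) h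
      ⟨hle, le_rfl⟩
  · have hsub : Icc t 0 ⊆ I := hI.out ht h0
    have hd : ∀ {f : ℝ → E}, (∀ t ∈ I, HasDerivWithinAt f (g t (f t)) I t) →
        ∀ s ∈ Ioc t 0, HasDerivWithinAt f (g s (f s)) (Iic s) s := fun h s hs =>
      (h s (hsub (Ioc_subset_Icc_self hs))).mono_of_mem_nhdsWithin
        (Filter.mem_of_superset (Icc_mem_nhdsLE hs.1)
          ((Icc_subset_Icc_right hs.2).trans hsub))
    exact ODE_solution_unique_of_mem_Icc_left (s := fun _ => univ)
      (fun t _ => (hK t).lipschitzOnWith)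
      (fun s hs => (h1 s (hsub hs)).continuousWithinAt.mono hsub) (hd h1) (fun _ _ => trivial)
      (fun s hs => (h2 s (hsub hs)).continuousWithinAt.mono hsub) (hd h2) (fun _ _ => trivial) h
      ⟨le_rfl, hle⟩

/-- Grönwall's inequality against the zero trajectory. -/
theorem norm_le_exp_of_solution (hK : ∀ t, LipschitzWith K (g t)) (h0 : ∀ t, g t 0 = 0)
    {f : ℝ → E} (hf : ∀ t, HasDerivAt f (g t (f t)) t) {t : ℝ} (ht : 0 ≤ t) :
    ‖f t‖ ≤ Real.exp (K * t) * ‖f 0‖ := by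
  have := dist_le_of_trajectories_ODE (f := f) (g := fun _ => 0) (a := 0) (b := t) (δ := ‖f 0‖) hK
    (fun s _ => (hf s).continuousAt.continuousWithinAt) (fun s _ => (hf s).hasDerivWithinAt)
    continuousOn_const (fun s _ => by simpa [h0] using hasDerivWithinAt_const s _ (0 : E))
    (by simp) t ⟨ht, le_rfl⟩
  simpa [mul_comm] using this

end ODE

end

/-! ### The solution flow, constructed in the interaction picture. -/

noncomputable section
open MeasureTheory Set Filter
open scoped NNReal

namespace WaveData

variable {H : Type*} [NormedAddCommGroup H] [InnerProductSpace ℝ H] (d : WaveData H)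

/-- The frequency of the `n`-th mode of `ε u'' + A u = 0`. -/
def freq (n : ℕ+) : ℝ := √(d.lam n) / √d.ε

theorem norm_exp_I_mul (x : ℝ) : ‖Complex.exp (-(Complex.I * x))‖ = 1 := by
  rw [Complex.norm_exp]; simp

/-- The unitary group of `ε u'' + A u = 0`. -/
def rot (t : ℝ) : ModalSpace →L[ℝ] ModalSpace :=
  lpLift
    { toFun := fun z n => Complex.exp (-(Complex.I * (d.freq n * t : ℝ))) * z n
      map_add' := fun z w => by ext n; simp; ring
      map_smul' := fun c z => by ext n; simp; ring } 1 zero_le_one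
    (fun z s => by
      rw [one_mul]
      refine le_trans (le_of_eq (Finset.sum_congr rfl fun n _ => ?_)) (lp_two_sum_le z s)
      simp only [LinearMap.coe_mk, AddHom.coe_mk]
      rw [norm_mul, norm_exp_I_mul, one_mul])

theorem rot_apply (t : ℝ) (z : ModalSpace) (n : ℕ+) :
    d.rot t z n = Complex.exp (-(Complex.I * (d.freq n * t : ℝ))) * z n := rfl

@[simp]
theorem rot_zero (z : ModalSpace) : d.rot 0 z = z := by
  ext n; simp [rot_apply]

theorem rot_rot (s t : ℝ) (z : ModalSpace) : d.rot s (d.rot t z) = d.rot (s + t) z := by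
  ext n
  rw [rot_apply, rot_apply, rot_apply, ← mul_assoc, ← Complex.exp_add]
  congr 2; push_cast; ring

@[simp]
theorem rot_rot_neg (t : ℝ) (z : ModalSpace) : d.rot t (d.rot (-t) z) = z := by
  rw [rot_rot]; simp

@[simp]
theorem norm_rot (t : ℝ) (z : ModalSpace) : ‖d.rot t z‖ = ‖z‖ := by
  have : ‖d.rot t z‖ ^ 2 = ‖z‖ ^ 2 := by
    rw [lp_two_norm_sq, lp_two_norm_sq]
    simp_rw [rot_apply, norm_mul, norm_exp_I_mul, one_mul]
  exact (pow_left_inj₀ (norm_nonneg _) (norm_nonneg _) two_ne_zero).1 this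

/-- Only strong continuity is claimed, as no bound on the frequencies is available. Coordinatewise
convergence is dominated by 4|z_n|², since two phases differ by at most 2. -/
theorem continuous_rot_apply (z : ModalSpace) : Continuous fun t => d.rot t z := by
  rw [continuous_iff_continuousAt]
  intro t
  refine tendsto_lp_two_of_dominated ((lp_two_summable z).mul_left 4) (fun n => ?_)
    (Eventually.of_forall fun s n => ?_)
  · simp_rw [rot_apply]
    exact (by fun_prop : Continuous fun t : ℝ =>
      Complex.exp (-(Complex.I * (d.freq n * t : ℝ))) * z n).tendsto t
  · rw [rot_apply, rot_apply, ← sub_mul, norm_mul, mul_pow]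
    have h : ‖Complex.exp (-(Complex.I * (d.freq n * s : ℝ))) -
        Complex.exp (-(Complex.I * (d.freq n * t : ℝ)))‖ ≤ 2 := by
      refine (norm_sub_le _ _).trans ?_
      rw [norm_exp_I_mul, norm_exp_I_mul]; norm_num
    have : ‖Complex.exp (-(Complex.I * (d.freq n * s : ℝ))) -
        Complex.exp (-(Complex.I * (d.freq n * t : ℝ)))‖ ^ 2 ≤ 4 :=
      (pow_le_pow_left₀ (norm_nonneg _) h 2).trans (by norm_num)
    gcongr

theorem continuous_rot : Continuous fun p : ℝ × ModalSpace => d.rot p.1 p.2 := by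
  rw [continuous_iff_continuousAt]
  rintro ⟨t, z⟩
  rw [ContinuousAt, tendsto_iff_norm_sub_tendsto_zero]
  have h1 : Tendsto (fun p : ℝ × ModalSpace => ‖p.2 - z‖ + ‖d.rot p.1 z - d.rot t z‖) (𝓝 (t, z))
      (𝓝 0) := by
    have : Continuous fun p : ℝ × ModalSpace => ‖p.2 - z‖ + ‖d.rot p.1 z - d.rot t z‖ :=
      (continuous_snd.sub continuous_const).norm.add
        (((d.continuous_rot_apply z).comp continuous_fst).sub continuous_const).norm
    simpa using this.tendsto (t, z)
  refine squeeze_zero (fun _ => norm_nonneg _) (fun p => ?_) h1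
  calc ‖d.rot p.1 p.2 - d.rot t z‖
      = ‖d.rot p.1 (p.2 - z) + (d.rot p.1 z - d.rot t z)‖ := by rw [map_sub]; congr 1; abel
    _ ≤ _ := (norm_add_le _ _).trans_eq (by rw [norm_rot])

attribute [irreducible] rot

variable {d} in
theorem continuous_rot_comp {α : Type*} [TopologicalSpace α] {f : α → ℝ} {g : α → ModalSpace}
    (hf : Continuous f) (hg : Continuous g) : Continuous fun a => d.rot (f a) (g a) :=
  d.continuous_rot.comp (hf.prodMk hg)

variable {d} in
theorem continuousOn_rot_comp {α : Type*} [TopologicalSpace α] {f : α → ℝ} {g : α → ModalSpace}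
    {s : Set α} (hf : ContinuousOn f s) (hg : ContinuousOn g s) :
    ContinuousOn (fun a => d.rot (f a) (g a)) s :=
  d.continuous_rot.comp_continuousOn (hf.prodMk hg)

/-- The damping and the nonlinearity, as a vector field on the modal space. -/
def field (z : ModalSpace) : ModalSpace := d.embV (d.ε⁻¹ • (d.F (d.pos z) - d.vel z))

/-- A Lipschitz constant of `field`. -/
def fieldConst : ℝ≥0 :=
  ⟨‖d.embV‖ * (d.ε⁻¹ * (d.L * ‖d.pos‖ + ‖d.vel‖)), by
    have := d.L_nonneg; have := d.ε_pos; positivity⟩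

theorem coe_fieldConst :
    (d.fieldConst : ℝ) = ‖d.embV‖ * (d.ε⁻¹ * (d.L * ‖d.pos‖ + ‖d.vel‖)) := rfl

theorem lipschitz_field : LipschitzWith d.fieldConst d.field := by
  have hL := d.L_nonneg
  have hε := d.ε_pos
  refine LipschitzWith.of_dist_le_mul fun z w => ?_
  rw [dist_eq_norm, dist_eq_norm, field, field, ← map_sub, ← smul_sub]
  calc ‖d.embV (d.ε⁻¹ • (d.F (d.pos z) - d.vel z - (d.F (d.pos w) - d.vel w)))‖
      ≤ ‖d.embV‖ * (d.ε⁻¹ * ‖(d.F (d.pos z) - d.F (d.pos w)) - d.vel (z - w)‖) := by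
        refine (d.embV.le_opNorm _).trans_eq ?_
        rw [norm_smul, Real.norm_of_nonneg (by positivity), map_sub]
        congr 3
        abel
    _ ≤ ‖d.embV‖ * (d.ε⁻¹ * (d.L * (‖d.pos‖ * ‖z - w‖) + ‖d.vel‖ * ‖z - w‖)) := by
        gcongr
        refine (norm_sub_le _ _).trans (add_le_add ((d.F_lip _ _).trans ?_) (d.vel.le_opNorm _))
        rw [← map_sub]
        gcongr
        exact d.pos.le_opNorm _
    _ = _ := by rw [coe_fieldConst]; ring

theorem field_zero : d.field 0 = 0 := by simp [field, d.F_zero]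

/-- The vector field in the interaction picture. -/
def rotField (t : ℝ) (z : ModalSpace) : ModalSpace := d.rot (-t) (d.field (d.rot t z))

theorem lipschitz_rotField (t : ℝ) : LipschitzWith d.fieldConst (d.rotField t) := by
  refine LipschitzWith.of_dist_le_mul fun z w => ?_
  rw [dist_eq_norm, rotField, rotField, ← map_sub, norm_rot, ← dist_eq_norm]
  refine (d.lipschitz_field.dist_le_mul _ _).trans_eq ?_
  rw [dist_eq_norm, ← map_sub, norm_rot, ← dist_eq_norm]

theorem rotField_zero (t : ℝ) : d.rotField t 0 = 0 := by simp [rotField, field_zero]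

theorem continuous_rotField : Continuous (Function.uncurry d.rotField) := by
  have h1 : Continuous fun p : ℝ × ModalSpace => d.field (d.rot p.1 p.2) :=
    d.lipschitz_field.continuous.comp d.continuous_rot
  have h2 : Continuous fun p : ℝ × ModalSpace => d.rot (-p.1) (d.field (d.rot p.1 p.2)) :=
    continuous_rot_comp continuous_fst.neg h1
  exact h2

/-- Solutions of the wave equation on `I`, mode by mode. -/
structure IsModalSolution (I : Set ℝ) (z : ℝ → ModalSpace) : Prop where
  continuousOn : ContinuousOn z I
  deriv_pos : ∀ n, ∀ t ∈ I,
    HasDerivWithinAt (fun s => ⟪d.pos (z s), d.e n⟫_ℝ) ⟪d.vel (z t), d.e n⟫_ℝ I t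
  deriv_vel : ∀ n, ∀ t ∈ I, HasDerivWithinAt (fun s => ⟪d.vel (z s), d.e n⟫_ℝ)
    ((⟪d.F (d.pos (z t)), d.e n⟫_ℝ - ⟪d.vel (z t), d.e n⟫_ℝ
      - d.lam n * ⟪d.pos (z t), d.e n⟫_ℝ) / d.ε) I t

variable {d}

theorem IsModalSolution.mono {I J : Set ℝ} {z : ℝ → ModalSpace} (h : d.IsModalSolution I z)
    (hJ : J ⊆ I) : d.IsModalSolution J z :=
  ⟨h.continuousOn.mono hJ, fun n t ht => (h.deriv_pos n t (hJ ht)).mono hJ,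
    fun n t ht => (h.deriv_vel n t (hJ ht)).mono hJ⟩

variable (d)

theorem field_apply (z : ModalSpace) (n : ℕ+) : d.field z n =
    Complex.I * (√d.ε * ((⟪d.F (d.pos z), d.e n⟫_ℝ - ⟪d.vel z, d.e n⟫_ℝ) / d.ε) : ℝ) := by
  rw [field, embV_apply]
  simp only [inner_smul_left, inner_sub_left]
  congr 3
  simp
  ring

theorem modal_coord (z : ModalSpace) (n : ℕ+) :
    z n = (√(d.lam n) : ℂ) * (⟪d.pos z, d.e n⟫_ℝ : ℂ)
      + Complex.I * ((√d.ε : ℂ) * (⟪d.vel z, d.e n⟫_ℝ : ℂ)) := by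
  rw [← Complex.re_add_im (z n), d.re_eq, d.im_eq]
  push_cast
  ring

/-- In the complex coordinate the mode equation is a rotation with frequency √(λ_n/ε), plus a
forcing in the imaginary direction that carries damping and nonlinearity. -/
theorem freq_coord (u v f : ℝ) (n : ℕ+) :
    (√(d.lam n) : ℂ) * (v : ℂ) + Complex.I * ((√d.ε : ℂ) *
      (((f - v - d.lam n * u) / d.ε : ℝ) : ℂ)) =
    -(Complex.I * d.freq n) * ((√(d.lam n) : ℂ) * (u : ℂ) + Complex.I * ((√d.ε : ℂ) * (v : ℂ)))
      + Complex.I * (√d.ε * ((f - v) / d.ε) : ℝ) := by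
  have h1 : (√(d.lam n) : ℝ) ^ 2 = d.lam n := Real.sq_sqrt (d.lam_pos n).le
  have h2 : (√d.ε : ℝ) ^ 2 = d.ε := Real.sq_sqrt d.ε_pos.le
  have h3 := d.sqrt_ε_pos.ne'
  have h4 := d.ε_pos.ne'
  have e1 : (√d.ε : ℝ) * ((f - v - d.lam n * u) / d.ε) =
      -d.freq n * √(d.lam n) * u + √d.ε * ((f - v) / d.ε) := by
    rw [freq]
    field_simp
    rw [h1, h2]; ring
  have e2 : d.freq n * √d.ε = √(d.lam n) := by rw [freq]; field_simp
  apply Complex.ext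
  · simp
    rw [← mul_assoc, e2]
  · simp at e1 ⊢
    rw [e1]; ring

theorem hasDerivAt_phase (c t : ℝ) : HasDerivAt
    (fun s : ℝ => Complex.exp (-(Complex.I * (c * s : ℝ))))
    (-(Complex.I * c) * Complex.exp (-(Complex.I * (c * t : ℝ)))) t := by
  have := hasDerivAt_cexp_neg_mul (Complex.I * c) t
  simpa [mul_assoc] using this

/-- Modal solutions are the solutions of the ordinary differential equation of the interaction
picture. -/
theorem isModalSolution_iff {I : Set ℝ} (hI : I.OrdConnected) {z : ℝ → ModalSpace} :
    d.IsModalSolution I z ↔ ∀ t ∈ I,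
      HasDerivWithinAt (fun s => d.rot (-s) (z s)) (d.rotField t (d.rot (-t) (z t))) I t := by
  have hfld : ∀ t, d.rotField t (d.rot (-t) (z t)) = d.rot (-t) (d.field (z t)) := fun t => by
    rw [rotField, rot_rot_neg]
  constructor
  · intro h t ht
    -- Each coordinate satisfies the equation; since the field is continuous along the curve, the
    -- integrated coordinates assemble into an identity in ℓ², which can be differentiated.
    have hc : ContinuousOn (fun t => d.rotField t (d.rot (-t) (z t))) I := by
      simp_rw [hfld]
      exact continuousOn_rot_comp continuousOn_neg
        (d.lipschitz_field.continuous.comp_continuousOn h.continuousOn)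
    refine hasDerivWithinAt_of_sub_eq_integral hI hc (fun a ha b hb => ?_) ht
    ext n
    have hn : ∀ t ∈ I, HasDerivWithinAt (fun s => d.rot (-s) (z s) n)
        (d.rotField t (d.rot (-t) (z t)) n) I t := by
      intro t ht
      have h1 : HasDerivWithinAt (fun s => z s n) (-(Complex.I * d.freq n) * z t n
          + d.field (z t) n) I t := by
        rw [field_apply, d.modal_coord, ← freq_coord]
        simp_rw [d.modal_coord]
        exact ((h.deriv_pos n t ht).ofReal_comp.const_mul _).add
          (((h.deriv_vel n t ht).ofReal_comp.const_mul _).const_mul _)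
      have h2 := (hasDerivAt_phase (-d.freq n) t).hasDerivWithinAt (s := I)
      rw [hfld, rot_apply]
      have h3 : ∀ s : ℝ, d.rot (-s) (z s) n =
          Complex.exp (-(Complex.I * (-d.freq n * s : ℝ))) * z s n := fun s => by
        rw [rot_apply]; congr 3; push_cast; ring
      simp_rw [h3]
      refine (h2.mul h1).congr_deriv ?_
      rw [mul_neg (d.freq n) t, ← neg_mul]
      push_cast
      ring_nf
    have hcn : ContinuousOn (fun t => d.rotField t (d.rot (-t) (z t)) n) I :=
      (lp.evalCLM ℝ (fun _ : ℕ+ => ℂ) 2 n).continuous.comp_continuousOn hc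
    have := sub_eq_integral_of_hasDerivWithinAt hI hcn hn ha hb
    rw [lp.coeFn_sub, Pi.sub_apply, this]
    exact (lp.evalCLM ℝ (fun _ : ℕ+ => ℂ) 2 n).intervalIntegral_comp_comm
      (hc.mono (hI.uIcc_subset ha hb)).intervalIntegrable
  · intro h
    -- Undoing the rotation preserves differentiability of each coordinate, though not of the curve
    -- in ℓ².
    have hzrot : ∀ s, z s = d.rot s (d.rot (-s) (z s)) := fun s => (d.rot_rot_neg s _).symm
    have hn : ∀ n, ∀ t ∈ I, HasDerivWithinAt (fun s => z s n)
        (-(Complex.I * d.freq n) * z t n + d.field (z t) n) I t := by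
      intro n t ht
      have h1 := (lp.evalCLM ℝ (fun _ : ℕ+ => ℂ) 2 n).hasFDerivAt.comp_hasDerivWithinAt t (h t ht)
      have h2 := (hasDerivAt_phase (d.freq n) t).hasDerivWithinAt (s := I)
      have h3 := h2.mul h1
      refine (h3.congr_deriv ?_).congr_of_mem (fun s _ => ?_) ht
      · change _ * d.rot (-t) (z t) n + _ * (d.rotField t (d.rot (-t) (z t))) n = _
        rw [hfld, mul_assoc, ← rot_apply, rot_rot_neg, ← rot_apply, rot_rot_neg]
      · change z s n = _ * d.rot (-s) (z s) n
        rw [← rot_apply, rot_rot_neg]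
    refine ⟨?_, fun n t ht => ?_, fun n t ht => ?_⟩
    · rw [show z = fun s => d.rot s (d.rot (-s) (z s)) from funext hzrot]
      exact continuousOn_rot_comp continuousOn_id fun t ht => (h t ht).continuousWithinAt
    · have h1 := Complex.reCLM.hasFDerivAt.comp_hasDerivWithinAt t (hn n t ht)
      have h2 := h1.div_const (√(d.lam n))
      refine (h2.congr_deriv ?_).congr_of_mem (fun s _ => d.inner_pos _ _) ht
      rw [field_apply, d.modal_coord, ← freq_coord]
      have := (d.sqrt_lam_pos n).ne'
      simp
      field_simp
    · have h1 := Complex.imCLM.hasFDerivAt.comp_hasDerivWithinAt t (hn n t ht)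
      have h2 := h1.div_const (√d.ε)
      refine (h2.congr_deriv ?_).congr_of_mem (fun s _ => d.inner_vel _ _) ht
      rw [field_apply, d.modal_coord, ← freq_coord]
      have := d.sqrt_ε_pos.ne'
      simp
      field_simp

theorem exists_interaction_solution (z₀ : ModalSpace) : ∃ ζ : ℝ → ModalSpace, ζ 0 = z₀ ∧
    ∀ t, HasDerivAt ζ (d.rotField t (ζ t)) t :=
  exists_global_solution d.continuous_rotField d.lipschitz_rotField d.rotField_zero z₀

/-- The solution in the interaction picture. -/
def interaction (z₀ : ModalSpace) : ℝ → ModalSpace := (d.exists_interaction_solution z₀).choose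

theorem interaction_zero (z₀ : ModalSpace) : d.interaction z₀ 0 = z₀ :=
  (d.exists_interaction_solution z₀).choose_spec.1

theorem hasDerivAt_interaction (z₀ : ModalSpace) (t : ℝ) :
    HasDerivAt (d.interaction z₀) (d.rotField t (d.interaction z₀ t)) t :=
  (d.exists_interaction_solution z₀).choose_spec.2 t

/-- The solution group of the wave equation in modal form. -/
def flow (t : ℝ) (z₀ : ModalSpace) : ModalSpace := d.rot t (d.interaction z₀ t)

theorem rot_neg_flow (t : ℝ) (z₀ : ModalSpace) : d.rot (-t) (d.flow t z₀) = d.interaction z₀ t := by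
  rw [flow, rot_rot]; simp

@[simp]
theorem flow_zero (z₀ : ModalSpace) : d.flow 0 z₀ = z₀ := by
  rw [flow, interaction_zero, rot_zero]

theorem isModalSolution_flow (z₀ : ModalSpace) :
    d.IsModalSolution univ (fun t => d.flow t z₀) := by
  rw [isModalSolution_iff d ordConnected_univ]
  intro t _
  simp_rw [rot_neg_flow]
  exact (d.hasDerivAt_interaction z₀ t).hasDerivWithinAt

theorem continuous_flow (z₀ : ModalSpace) : Continuous fun t => d.flow t z₀ :=
  continuousOn_univ.1 (d.isModalSolution_flow z₀).continuousOn

variable {d}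

theorem IsModalSolution.eq_flow {I : Set ℝ} (hI : I.OrdConnected) (h0 : (0 : ℝ) ∈ I)
    {z : ℝ → ModalSpace} (h : d.IsModalSolution I z) {t : ℝ} (ht : t ∈ I) :
    z t = d.flow t (z 0) := by
  have h1 := (d.isModalSolution_iff hI).1 h
  have h2 := (d.isModalSolution_iff hI).1 ((d.isModalSolution_flow (z 0)).mono (subset_univ I))
  have := solution_unique_of_ordConnected d.lipschitz_rotField hI h0 h1 h2 (by simp) ht
  rw [← d.rot_rot_neg t (z t), this, rot_rot_neg]

theorem IsModalSolution.comp_add_const {z : ℝ → ModalSpace} (h : d.IsModalSolution univ z)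
    (c : ℝ) : d.IsModalSolution univ (fun t => z (t + c)) := by
  refine ⟨?_, fun n t _ => ?_, fun n t _ => ?_⟩
  · exact h.continuousOn.comp (by fun_prop) (fun _ _ => trivial)
  · rw [hasDerivWithinAt_univ]
    exact (hasDerivWithinAt_univ.1 (h.deriv_pos n (t + c) trivial)).comp_add_const t c
  · rw [hasDerivWithinAt_univ]
    exact (hasDerivWithinAt_univ.1 (h.deriv_vel n (t + c) trivial)).comp_add_const t c

variable (d)

theorem flow_add (s t : ℝ) (z₀ : ModalSpace) : d.flow (s + t) z₀ = d.flow s (d.flow t z₀) := by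
  simpa using ((d.isModalSolution_flow z₀).comp_add_const t).eq_flow ordConnected_univ trivial
    (mem_univ s)

theorem norm_flow_le {t : ℝ} (ht : 0 ≤ t) (z₀ : ModalSpace) :
    ‖d.flow t z₀‖ ≤ Real.exp (d.fieldConst * t) * ‖z₀‖ := by
  rw [flow, norm_rot]
  simpa [interaction_zero] using norm_le_exp_of_solution d.lipschitz_rotField d.rotField_zero
    (d.hasDerivAt_interaction z₀) ht

end WaveData

end

/-! ### Modal solutions and weak solutions. -/

noncomputable section
open MeasureTheory Set Filter
open scoped NNReal

theorem IsPositiveSelfAdjointCompactInverse.inner_apply_comm {H : Type*} [NormedAddCommGroup H]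
    [InnerProductSpace ℝ H] [CompleteSpace H] {A : H →ₗ.[ℝ] H}
    (hA : IsPositiveSelfAdjointCompactInverse A) (x y : A.domain) :
    ⟪A x, (y : H)⟫_ℝ = ⟪(x : H), A y⟫_ℝ := by
  have h := A.adjoint_isFormalAdjoint hA.selfAdjoint.dense_domain
  have h2 := LinearPMap.isSelfAdjoint_def.1 hA.selfAdjoint
  rw [h2] at h
  exact h x y

theorem IsEigensystem.lam_pos {H : Type*} [NormedAddCommGroup H]
    [InnerProductSpace ℝ H] [CompleteSpace H] {A : H →ₗ.[ℝ] H} {e : HilbertBasis ℕ+ ℝ H}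
    {lam : ℕ+ → ℝ} (he : IsEigensystem A e lam) (hA : IsPositiveSelfAdjointCompactInverse A)
    (n : ℕ+) : 0 < lam n := by
  have h := hA.positive ⟨e n, he.mem_domain n⟩ (e.orthonormal.ne_zero n)
  rw [he.apply_eq, inner_smul_left, real_inner_self_eq_norm_sq, e.orthonormal.norm_eq_one] at h
  simpa using h

theorem IsEigensystem.inner_apply {H : Type*} [NormedAddCommGroup H]
    [InnerProductSpace ℝ H] [CompleteSpace H] {A : H →ₗ.[ℝ] H} {e : HilbertBasis ℕ+ ℝ H}
    {lam : ℕ+ → ℝ} (he : IsEigensystem A e lam) (hA : IsPositiveSelfAdjointCompactInverse A)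
    (φ : A.domain) (n : ℕ+) : ⟪A φ, e n⟫_ℝ = lam n * ⟪(φ : H), e n⟫_ℝ := by
  rw [hA.inner_apply_comm φ ⟨e n, he.mem_domain n⟩, he.apply_eq, inner_smul_right]

namespace WaveData

variable {H : Type*} [NormedAddCommGroup H] [InnerProductSpace ℝ H] (d : WaveData H)

theorem inner_eq_tsum (x y : H) : HasSum (fun n => ⟪x, d.e n⟫_ℝ * ⟪y, d.e n⟫_ℝ) ⟪x, y⟫_ℝ := by
  have := d.e.hasSum_inner_mul_inner x y
  simpa only [real_inner_comm y] using this

variable {A : H →ₗ.[ℝ] H}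

theorem IsModalSolution.hasDerivWithinAt_pos [CompleteSpace H] {I : Set ℝ} (hI : I.OrdConnected)
    {z : ℝ → ModalSpace} (h : d.IsModalSolution I z) {t : ℝ} (ht : t ∈ I) :
    HasDerivWithinAt (fun s => d.pos (z s)) (d.vel (z t)) I t := by
  have hc : ContinuousOn (fun s => d.vel (z s)) I := d.vel.continuous.comp_continuousOn h.continuousOn
  refine hasDerivWithinAt_of_sub_eq_integral hI hc (fun a ha b hb => d.ext_inner fun n => ?_) ht
  rw [inner_sub_left, sub_eq_integral_of_hasDerivWithinAt hI
    (g := fun s => ⟪d.vel (z s), d.e n⟫_ℝ) (hc.inner continuousOn_const)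
    (fun t ht => h.deriv_pos n t ht) ha hb]
  have hi : IntervalIntegrable (fun s => d.vel (z s)) volume a b :=
    (hc.mono (hI.uIcc_subset ha hb)).intervalIntegrable
  have := (innerSL ℝ (d.e n)).intervalIntegral_comp_comm hi
  simp only [innerSL_apply_apply] at this
  simp only [real_inner_comm (d.e n)]
  exact this

theorem IsModalSolution.isSolutionOn [CompleteSpace H] (he : IsEigensystem A d.e d.lam)
    (hA : IsPositiveSelfAdjointCompactInverse A) {I : Set ℝ} (hI : I.OrdConnected)
    {z : ℝ → ModalSpace} (h : d.IsModalSolution I z) :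
    IsSolutionOn A d.e d.lam d.F d.ε I (fun t => d.toEnergy (z t)) := by
  have hu : ContinuousOn (fun s => d.pos (z s)) I := d.pos.continuous.comp_continuousOn h.continuousOn
  have hv : ContinuousOn (fun s => d.vel (z s)) I := d.vel.continuous.comp_continuousOn h.continuousOn
  have hF : ContinuousOn (fun s => d.F (d.pos (z s))) I := d.F_continuous.comp_continuousOn hu
  refine ⟨fun t ht => ?_, fun t ht => h.hasDerivWithinAt_pos d hI ht, fun φ t ht => ?_⟩
  · have h1 : Tendsto (fun s => d.normConst * ‖z s - z t‖) (𝓝[I] t) (𝓝 0) := by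
      have := (tendsto_iff_norm_sub_tendsto_zero.1 (h.continuousOn t ht)).const_mul d.normConst
      simpa using this
    refine squeeze_zero (fun s => Real.sqrt_nonneg _) (fun s => ?_) h1
    have := d.energyNorm_le (z s - z t)
    rw [map_sub, map_sub] at this
    exact this
  · refine hasDerivWithinAt_of_sub_eq_integral hI (g := fun t =>
      ⟪d.F (d.pos (z t)), (φ : H)⟫_ℝ - ⟪d.vel (z t), (φ : H)⟫_ℝ - ⟪d.pos (z t), A φ⟫_ℝ)
      (((hF.inner continuousOn_const).sub (hv.inner continuousOn_const)).sub
        (hu.inner continuousOn_const)) (fun a ha b hb => ?_) ht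
    have hsub := hI.uIcc_subset ha hb
    have iu : IntervalIntegrable (fun s => d.pos (z s)) volume a b :=
      (hu.mono hsub).intervalIntegrable
    have iG : IntervalIntegrable (fun s => d.F (d.pos (z s)) - d.vel (z s)) volume a b :=
      ((hF.sub hv).mono hsub).intervalIntegrable
    have hcomm : ∀ (g : ℝ → H) (x : H), IntervalIntegrable g volume a b →
        ⟪∫ s in a..b, g s, x⟫_ℝ = ∫ s in a..b, ⟪g s, x⟫_ℝ := by
      intro g x hg
      have := (innerSL ℝ x).intervalIntegral_comp_comm hg
      simp only [innerSL_apply_apply] at this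
      simp only [real_inner_comm x]
      exact this.symm
    have hcont : ∀ (g : ℝ → H) (x : H), ContinuousOn g I →
        IntervalIntegrable (fun s => ⟪g s, x⟫_ℝ) volume a b := fun g x hg =>
      ((hg.mono hsub).inner continuousOn_const).intervalIntegrable
    -- The time-integrated equation reads P + A Q = 0 in the weak sense. Mode by mode it is the
    -- integrated modal equation, and Parseval's identity sums it against φ because (Aφ, e_n) = λ_n
    -- (φ, e_n).
    set P : H := d.ε • (d.vel (z b) - d.vel (z a)) - ∫ s in a..b, (d.F (d.pos (z s)) - d.vel (z s))
      with hP
    set Q : H := ∫ s in a..b, d.pos (z s) with hQ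
    have hPQ : ∀ n, ⟪P, d.e n⟫_ℝ + d.lam n * ⟪Q, d.e n⟫_ℝ = 0 := by
      intro n
      have h1 := sub_eq_integral_of_hasDerivWithinAt hI (by
        exact (((hF.inner continuousOn_const).sub (hv.inner continuousOn_const)).sub
          ((hu.inner continuousOn_const).const_mul (d.lam n))).div_const d.ε)
        (fun t ht => h.deriv_vel n t ht) ha hb
      rw [intervalIntegral.integral_div, eq_div_iff d.ε_pos.ne',
        intervalIntegral.integral_sub ((hcont _ _ hF).sub (hcont _ _ hv))
        ((hcont _ _ hu).const_mul _), intervalIntegral.integral_const_mul] at h1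
      rw [hP, hQ, inner_sub_left, hcomm _ _ iG, hcomm _ _ iu, inner_smul_left, inner_sub_left]
      simp only [inner_sub_left, RCLike.conj_to_real]
      linarith
    have hzero : ⟪P, (φ : H)⟫_ℝ + ⟪Q, A φ⟫_ℝ = 0 := by
      have h1 := (d.inner_eq_tsum P φ).add (d.inner_eq_tsum Q (A φ))
      refine h1.unique ?_
      convert hasSum_zero with n
      rw [he.inner_apply hA]
      linear_combination ⟪(φ : H), d.e n⟫_ℝ * hPQ n
    rw [hP, hQ, inner_sub_left, hcomm _ _ iG, hcomm _ _ iu, inner_smul_left, inner_sub_left] at hzero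
    simp only [toEnergy_snd]
    simp only [inner_sub_left, RCLike.conj_to_real] at hzero
    rw [intervalIntegral.integral_sub ((hcont _ _ hF).sub (hcont _ _ hv)) (hcont _ _ hu)]
    linarith

/-- Eigenvectors are admissible test vectors, and the energy norm dominates the modal norm. -/
theorem isModalSolution_of_isSolutionOn (he : IsEigensystem A d.e d.lam) {I : Set ℝ}
    {ξ : ℝ → energySpace d.e d.lam} (h : IsSolutionOn A d.e d.lam d.F d.ε I ξ) :
    d.IsModalSolution I (fun t => d.ofEnergy (ξ t)) := by
  refine ⟨fun t ht => ?_, fun n t ht => ?_, fun n t ht => ?_⟩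
  · refine tendsto_iff_norm_sub_tendsto_zero.2
      (squeeze_zero (fun s => norm_nonneg _) (fun s => ?_) (h.continuous t ht))
    have := d.norm_le_energyNorm (d.ofEnergy (ξ s) - d.ofEnergy (ξ t))
    rw [map_sub, map_sub, pos_ofEnergy, pos_ofEnergy, vel_ofEnergy, vel_ofEnergy] at this
    exact this
  · simp only [pos_ofEnergy, vel_ofEnergy]
    have := (h.hasDeriv t ht).inner ℝ (hasDerivWithinAt_const t I (d.e n))
    simpa using this
  · simp only [pos_ofEnergy, vel_ofEnergy]
    have := (h.equation ⟨d.e n, he.mem_domain n⟩ t ht).div_const d.ε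
    rw [he.apply_eq] at this
    have hε := d.ε_pos.ne'
    refine (this.congr_deriv ?_).congr_of_mem (fun s _ => ?_) ht
    · rw [inner_smul_right]
    · field_simp

/-- The solution semigroup on the energy space. -/
def semigroup (t : ℝ) (ξ : energySpace d.e d.lam) : energySpace d.e d.lam :=
  d.toEnergy (d.flow t (d.ofEnergy ξ))

theorem isSolutionSemigroup [CompleteSpace H] (he : IsEigensystem A d.e d.lam)
    (hA : IsPositiveSelfAdjointCompactInverse A) :
    IsSolutionSemigroup A d.e d.lam d.F d.ε d.semigroup where
  initial ξ := by simp [semigroup]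
  solution ξ := ((d.isModalSolution_flow _).mono (subset_univ _)).isSolutionOn d he hA ordConnected_Ici
  unique ξ hξ t ht := by
    have := (d.isModalSolution_of_isSolutionOn he hξ).eq_flow ordConnected_Ici
      (mem_Ici.2 le_rfl) (mem_Ici.2 ht)
    rw [semigroup, ← this, toEnergy_ofEnergy]

end WaveData

end

/-! ### Arithmetic of the spectral gap. -/

noncomputable section
open MeasureTheory Set Filter
open scoped NNReal ENNReal

/-- The data of the damped wave equation together with a spectral gap. -/
structure GapData (H : Type*) [NormedAddCommGroup H] [InnerProductSpace ℝ H] extends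
    WaveData H where
  N : ℕ+
  gap : 2 * L < lam (N + 1) - lam N
  gap_le : 3 * lam (N + 1) + lam N ≤ 1 / ε

namespace GapData

variable {H : Type*} [NormedAddCommGroup H] [InnerProductSpace ℝ H] (d : GapData H)

/-- The midpoint of the spectral gap. -/
def mid : ℝ := (d.lam (d.N + 1) + d.lam d.N) / 2

/-- Half the width of the spectral gap. -/
def δ : ℝ := (d.lam (d.N + 1) - d.lam d.N) / 2

/-- The damping of the shifted equation. -/
def γ : ℝ := √(1 - 4 * d.ε * d.mid)

/-- The decay rate. -/
def θ : ℝ := (1 - d.γ) / (2 * d.ε)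

/-- The distance of an eigenvalue to the midpoint of the spectral gap. -/
def shift (n : ℕ+) : ℝ := d.lam n - d.mid

theorem L_lt_δ : d.L < d.δ := by have := d.gap; unfold δ; linarith

theorem δ_pos : 0 < d.δ := d.L_nonneg.trans_lt d.L_lt_δ

theorem mid_pos : 0 < d.mid := by
  have h1 := d.lam_pos d.N; have h2 := d.lam_pos (d.N + 1); unfold mid; linarith

/-- An exact reformulation of 3λ_{N+1} + λ_N ≤ 1/ε. It also makes the radicand in γ positive. -/
theorem two_mul_ε_mul_δ_le : 2 * d.ε * d.δ ≤ 1 - 4 * d.ε * d.mid := by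
  have h := (le_div_iff₀ d.ε_pos).1 d.gap_le
  unfold δ mid; linarith

theorem γ_sq : d.γ ^ 2 = 1 - 4 * d.ε * d.mid :=
  Real.sq_sqrt (by
    have := d.two_mul_ε_mul_δ_le; have := d.δ_pos; have := d.ε_pos
    have : 0 < 2 * d.ε * d.δ := by positivity
    linarith)

theorem gap_le_γ_sq : 2 * d.ε * d.δ ≤ d.γ ^ 2 := d.γ_sq ▸ d.two_mul_ε_mul_δ_le

theorem γ_pos : 0 < d.γ := by
  have := d.two_mul_ε_mul_δ_le; have := d.δ_pos; have := d.ε_pos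
  have : 0 < 2 * d.ε * d.δ := by positivity
  exact Real.sqrt_pos.2 (by linarith)

theorem γ_eq : d.γ = 1 - 2 * d.ε * d.θ := by
  have := d.ε_pos.ne'
  unfold θ; field_simp; ring

/-- The quadratic equation for θ: it makes A - mid the zeroth-order operator in the equation for
e^{θt} u. -/
theorem mid_eq : d.θ - d.ε * d.θ ^ 2 = d.mid := by
  have h := d.γ_sq
  rw [d.γ_eq] at h
  have := d.ε_pos
  have h2 : 4 * d.ε * (d.θ - d.ε * d.θ ^ 2 - d.mid) = 0 := by linarith
  have := (mul_eq_zero.1 h2).resolve_left (by positivity)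
  linarith

theorem θ_pos : 0 < d.θ := by
  have h := d.γ_sq
  have h1 := d.ε_pos
  have h2 := d.mid_pos
  have h3 : 0 < 4 * d.ε * d.mid := by positivity
  have : d.γ < 1 := by nlinarith [d.γ_pos]
  exact div_pos (by linarith) (by linarith)

theorem isLeast_θ :
    IsLeast {x : ℝ | 2 * x * (d.ε * x - 1) + d.lam (d.N + 1) + d.lam d.N = 0} d.θ := by
  have hm := d.mid_eq
  have hmid : d.lam (d.N + 1) + d.lam d.N = 2 * d.mid := by unfold mid; ring
  refine ⟨?_, fun x hx => ?_⟩
  · simp only [mem_ofPred_eq]; linarith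
  · simp only [mem_ofPred_eq] at hx
    by_contra hlt
    push Not at hlt
    have h1 := d.γ_eq
    have h2 := d.γ_pos
    have h3 := d.ε_pos
    -- For x < θ the second factor is below 2εθ - 1 = -γ < 0, so x cannot be a root.
    have h4 : (x - d.θ) * (d.ε * (x + d.θ) - 1) = 0 := by linarith
    have h5 : d.ε * (x + d.θ) - 1 < 0 := by nlinarith
    rcases mul_eq_zero.1 h4 with h | h <;> linarith

/-- By monotonicity no eigenvalue lies strictly between λ_N and λ_{N+1}, whose distance to the
midpoint is δ. -/
theorem δ_le_abs_shift (n : ℕ+) : d.δ ≤ |d.shift n| := by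
  rcases le_or_gt n d.N with h | h
  · refine le_trans ?_ (neg_le_abs _)
    have := d.mono h
    unfold δ shift mid; linarith
  · refine le_trans ?_ (le_abs_self _)
    have := d.mono (PNat.add_one_le_iff.2 h)
    unfold δ shift mid; linarith

theorem shift_ne_zero (n : ℕ+) : d.shift n ≠ 0 :=
  abs_pos.1 (d.δ_pos.trans_le (d.δ_le_abs_shift n))

theorem shift_neg_iff (n : ℕ+) : d.shift n < 0 ↔ n ≤ d.N := by
  have := d.δ_pos
  constructor
  · intro h
    by_contra hn
    have := d.mono (PNat.add_one_le_iff.2 (not_le.1 hn))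
    unfold δ at *; unfold shift mid at h; linarith
  · intro h
    have := d.mono h
    unfold δ at *; unfold shift mid; linarith

theorem discriminant_eq (n : ℕ+) : d.γ ^ 2 - 4 * d.ε * d.shift n = 1 - 4 * d.ε * d.lam n := by
  rw [d.γ_sq]; unfold shift; ring

theorem discriminant_pos {n : ℕ+} (hn : n ≤ d.N) : 0 < 1 - 4 * d.ε * d.lam n := by
  rw [← d.discriminant_eq]
  have h1 := (d.shift_neg_iff n).2 hn
  have h2 := d.ε_pos
  nlinarith [sq_nonneg d.γ, mul_pos h2 (neg_pos.2 h1)]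

end GapData

/-! ### Square integrable functions with values in H and their coordinates. -/

section SquareIntegrable

variable {H : Type*} [NormedAddCommGroup H] [InnerProductSpace ℝ H]

theorem MeasureTheory.MemLp.ofReal_integral_norm_sq {E : Type*} [NormedAddCommGroup E]
    {g : ℝ → E} (hg : MemLp g 2) : ENNReal.ofReal (∫ t, ‖g t‖ ^ 2) = ∫⁻ t, ‖g t‖ₑ ^ 2 := by
  rw [ofReal_integral_eq_lintegral_ofReal hg.integrable_norm_sq_real
    (Eventually.of_forall fun t => by positivity)]
  refine lintegral_congr fun t => ?_
  rw [ENNReal.ofReal_pow (norm_nonneg _), ofReal_norm]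

theorem memLp_two_of_lintegral_lt_top {E : Type*} [NormedAddCommGroup E] {g : ℝ → E}
    (hg : AEStronglyMeasurable g) (h : ∫⁻ t, ‖g t‖ₑ ^ 2 < ∞) : MemLp g 2 := by
  refine ⟨hg, ?_⟩
  rw [eLpNorm_lt_top_iff_lintegral_rpow_enorm_lt_top (by norm_num) (by norm_num)]
  simpa using h

theorem norm_sq_toLp {E : Type*} [NormedAddCommGroup E] {g : ℝ → E} (hg : MemLp g 2) :
    ‖hg.toLp g‖ ^ 2 = ∫ t, ‖g t‖ ^ 2 := by
  have h1 : eLpNorm g 2 ^ (2 : ℝ) = ∫⁻ t, ‖g t‖ₑ ^ (2 : ℝ) := by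
    simpa using eLpNorm_nnreal_pow_eq_lintegral (f := g) (μ := volume) (p := 2) (by norm_num)
  rw [Lp.norm_toLp, ← ENNReal.toReal_pow]
  have h2 : eLpNorm g 2 ^ 2 = ∫⁻ t, ‖g t‖ₑ ^ 2 := by simpa using h1
  rw [h2, ← hg.ofReal_integral_norm_sq, ENNReal.toReal_ofReal (integral_nonneg fun t => by positivity)]

theorem Lp_norm_sq {E : Type*} [NormedAddCommGroup E] (h : Lp E 2 (volume : Measure ℝ)) :
    ‖h‖ ^ 2 = ∫ t, ‖h t‖ ^ 2 := by
  have := norm_sq_toLp (Lp.memLp h)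
  rwa [Lp.toLp_coeFn] at this

/-- Parseval pointwise and Tonelli. With values in [0, ∞] the identity can be used to prove square
integrability, not only to compute norms. -/
theorem lintegral_enorm_sq_eq_tsum (e : HilbertBasis ℕ+ ℝ H) {g : ℝ → H}
    (hg : AEStronglyMeasurable g) :
    ∫⁻ t, ‖g t‖ₑ ^ 2 = ∑' n, ∫⁻ t, ‖⟪g t, e n⟫_ℝ‖ₑ ^ 2 := by
  have e0 : ∀ x : ℝ, ‖x‖ₑ ^ 2 = ENNReal.ofReal (x ^ 2) := fun x => by
    rw [← ofReal_norm, ← ENNReal.ofReal_pow (norm_nonneg _), Real.norm_eq_abs, sq_abs]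
  rw [← lintegral_tsum]
  · refine lintegral_congr fun t => ?_
    have h := e.hasSum_inner_mul_inner (g t) (g t)
    simp only [real_inner_self_eq_norm_sq, real_inner_comm (g t), ← sq] at h
    rw [← ofReal_norm, ← ENNReal.ofReal_pow (norm_nonneg _), ← h.tsum_eq,
      ENNReal.ofReal_tsum_of_nonneg (fun n => by positivity) h.summable]
    simp only [e0]
  · intro n
    exact ((hg.inner aestronglyMeasurable_const).enorm.pow_const 2)

theorem MeasureTheory.MemLp.inner_basis (e : HilbertBasis ℕ+ ℝ H) {g : ℝ → H} (hg : MemLp g 2)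
    (n : ℕ+) : MemLp (fun t => ⟪g t, e n⟫_ℝ) 2 := hg.inner_const (e n)

theorem hasSum_integral_inner_sq (e : HilbertBasis ℕ+ ℝ H) {g : ℝ → H} (hg : MemLp g 2) :
    HasSum (fun n => ∫ t, ⟪g t, e n⟫_ℝ ^ 2) (∫ t, ‖g t‖ ^ 2) := by
  have h1 := lintegral_enorm_sq_eq_tsum e hg.1
  have h2 : ∀ n, ∫⁻ t, ‖⟪g t, e n⟫_ℝ‖ₑ ^ 2 = ENNReal.ofReal (∫ t, ⟪g t, e n⟫_ℝ ^ 2) := fun n => by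
    rw [← (hg.inner_basis e n).ofReal_integral_norm_sq]
    simp
  simp_rw [h2, ← hg.ofReal_integral_norm_sq] at h1
  have h3 : ∀ n, 0 ≤ ∫ t, ⟪g t, e n⟫_ℝ ^ 2 := fun n => integral_nonneg fun t => by positivity
  have h4 := ENNReal.summable_toReal (h1.symm ▸ ENNReal.ofReal_ne_top :
    ∑' n, ENNReal.ofReal (∫ t, ⟪g t, e n⟫_ℝ ^ 2) ≠ ∞)
  simp only [fun n => ENNReal.toReal_ofReal (h3 n)] at h4
  rw [← ENNReal.ofReal_tsum_of_nonneg h3 h4, ENNReal.ofReal_eq_ofReal_iff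
    (integral_nonneg fun t => by positivity) (tsum_nonneg h3)] at h1
  rw [h1]
  exact h4.hasSum

end SquareIntegrable
end

/-! ### The linear solution operator on L²(ℝ, H) and the Lyapunov-Perron equation. -/

noncomputable section
open MeasureTheory Set Filter
open scoped NNReal ENNReal

namespace GapData

variable {H : Type*} [NormedAddCommGroup H] [InnerProductSpace ℝ H] (d : GapData H)

/-- The constant in the pointwise bound of `evol`. -/
def evolConst : ℝ := √(1 / (2 * d.γ) + d.mid * (1 / d.δ ^ 2 + 1 / d.γ ^ 2))

theorem evolConst_sq :
    d.evolConst ^ 2 = 1 / (2 * d.γ) + d.mid * (1 / d.δ ^ 2 + 1 / d.γ ^ 2) :=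
  Real.sq_sqrt (by have := d.γ_pos; have := d.mid_pos; positivity)

section
variable {h : ℝ → ℝ} (hh : MemLp h 2) (n : ℕ+)
include hh

theorem memLp_modePos_shift : MemLp (modePos d.ε d.γ (d.shift n) h) 2 :=
  memLp_modePos d.ε_pos d.γ_pos (d.shift_ne_zero n) hh

theorem mode_bound (t : ℝ) : d.ε * modeVel d.ε d.γ (d.shift n) h t ^ 2
    + d.lam n * modePos d.ε d.γ (d.shift n) h t ^ 2 ≤ d.evolConst ^ 2 * ∫ t, h t ^ 2 := by
  rw [evolConst_sq]
  exact mode_sup_le d.ε_pos d.γ_pos hh (memLp_modePos d.ε_pos d.γ_pos (d.shift_ne_zero n) hh)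
    (memLp_modeVel d.ε_pos d.γ_pos (d.shift_ne_zero n) hh)
    (isPrimitive_modePos d.ε_pos d.γ_pos (d.shift_ne_zero n) hh)
    (isPrimitive_modeVel d.ε_pos d.γ_pos (d.shift_ne_zero n) hh) d.δ_pos
    (d.δ_le_abs_shift n) d.gap_le_γ_sq d.mid_pos.le (by unfold shift; ring) t

theorem mode_integral_bound :
    d.δ ^ 2 * ∫ t, modePos d.ε d.γ (d.shift n) h t ^ 2 ≤ ∫ t, h t ^ 2 :=
  mode_sq_integral_le d.ε_pos hh (memLp_modePos d.ε_pos d.γ_pos (d.shift_ne_zero n) hh)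
    (memLp_modeVel d.ε_pos d.γ_pos (d.shift_ne_zero n) hh)
    (isPrimitive_modePos d.ε_pos d.γ_pos (d.shift_ne_zero n) hh)
    (isPrimitive_modeVel d.ε_pos d.γ_pos (d.shift_ne_zero n) hh) d.δ_pos.le
    (d.δ_le_abs_shift n) d.gap_le_γ_sq

end

/-- The coordinates of `evol`. -/
def evolCoord (t : ℝ) : Lp H 2 (volume : Measure ℝ) →ₗ[ℝ] (ℕ+ → ℂ) where
  toFun h n := ⟨√(d.lam n) * modePos d.ε d.γ (d.shift n) (fun s => ⟪h s, d.e n⟫_ℝ) t,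
    √d.ε * modeVel d.ε d.γ (d.shift n) (fun s => ⟪h s, d.e n⟫_ℝ) t⟩
  map_add' h₁ h₂ := by
    ext n
    have m1 := (Lp.memLp h₁).inner_basis d.e n
    have m2 := (Lp.memLp h₂).inner_basis d.e n
    have hae : (fun s => ⟪(h₁ + h₂ : Lp H 2 (volume : Measure ℝ)) s, d.e n⟫_ℝ) =ᵐ[volume]
        fun s => ⟪h₁ s, d.e n⟫_ℝ + ⟪h₂ s, d.e n⟫_ℝ := by
      filter_upwards [Lp.coeFn_add h₁ h₂] with s hs
      rw [hs, Pi.add_apply, inner_add_left]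
    rw [modePos_congr hae, modeVel_congr hae,
      modePos_add d.ε_pos d.γ_pos (d.shift_ne_zero n) m1 m2,
      modeVel_add d.ε_pos d.γ_pos (d.shift_ne_zero n) m1 m2]
    apply Complex.ext
    · simp; ring
    · simp; ring
  map_smul' c h := by
    ext n
    have hae : (fun s => ⟪(c • h : Lp H 2 (volume : Measure ℝ)) s, d.e n⟫_ℝ) =ᵐ[volume]
        fun s => c * ⟪h s, d.e n⟫_ℝ := by
      filter_upwards [Lp.coeFn_smul c h] with s hs
      rw [hs, Pi.smul_apply, real_inner_smul_left]
    rw [modePos_congr hae, modeVel_congr hae, modePos_const_mul, modeVel_const_mul]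
    apply Complex.ext
    · simp; ring
    · simp; ring

theorem norm_evolCoord_sq (t : ℝ) (h : Lp H 2 (volume : Measure ℝ)) (n : ℕ+) :
    ‖d.evolCoord t h n‖ ^ 2 ≤ d.evolConst ^ 2 * ∫ t, ⟪h t, d.e n⟫_ℝ ^ 2 := by
  refine le_trans (le_of_eq ?_) (d.mode_bound ((Lp.memLp h).inner_basis d.e n) n t)
  rw [← Complex.normSq_eq_norm_sq, Complex.normSq_apply]
  have h1 := Real.sq_sqrt (d.lam_pos n).le
  have h2 := Real.sq_sqrt d.ε_pos.le
  simp only [evolCoord, LinearMap.coe_mk, AddHom.coe_mk]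
  linear_combination modePos d.ε d.γ (d.shift n) (fun s => ⟪h s, d.e n⟫_ℝ) t ^ 2 * h1
    + modeVel d.ε d.γ (d.shift n) (fun s => ⟪h s, d.e n⟫_ℝ) t ^ 2 * h2

/-- The state at time `t` of the solution in `L²(ℝ, H)` of `ε w'' + γ w' + (A - mid) w = h`. -/
def evol (t : ℝ) : Lp H 2 (volume : Measure ℝ) →L[ℝ] ModalSpace :=
  lpLift (d.evolCoord t) d.evolConst (Real.sqrt_nonneg _) (fun h s => by
    have hs := hasSum_integral_inner_sq d.e (Lp.memLp h)
    rw [mul_pow, Lp_norm_sq, ← hs.tsum_eq]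
    refine (Finset.sum_le_sum fun n _ => d.norm_evolCoord_sq t h n).trans ?_
    rw [← Finset.mul_sum]
    exact mul_le_mul_of_nonneg_left (hs.summable.sum_le_tsum s fun n _ =>
      integral_nonneg fun t => by positivity) (sq_nonneg _))

theorem norm_evol_le (t : ℝ) (h : Lp H 2 (volume : Measure ℝ)) :
    ‖d.evol t h‖ ≤ d.evolConst * ‖h‖ := lpLift_norm_le ..

theorem evol_apply (t : ℝ) (h : Lp H 2 (volume : Measure ℝ)) (n : ℕ+) : d.evol t h n =
    ⟨√(d.lam n) * modePos d.ε d.γ (d.shift n) (fun s => ⟪h s, d.e n⟫_ℝ) t,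
      √d.ε * modeVel d.ε d.γ (d.shift n) (fun s => ⟪h s, d.e n⟫_ℝ) t⟩ := rfl

theorem inner_pos_evol (t : ℝ) (h : Lp H 2 (volume : Measure ℝ)) (n : ℕ+) :
    ⟪d.pos (d.evol t h), d.e n⟫_ℝ =
      modePos d.ε d.γ (d.shift n) (fun s => ⟪h s, d.e n⟫_ℝ) t := by
  rw [d.inner_pos]
  have := (d.sqrt_lam_pos n).ne'
  simp [evol_apply, this]

theorem inner_vel_evol (t : ℝ) (h : Lp H 2 (volume : Measure ℝ)) (n : ℕ+) :
    ⟪d.vel (d.evol t h), d.e n⟫_ℝ =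
      modeVel d.ε d.γ (d.shift n) (fun s => ⟪h s, d.e n⟫_ℝ) t := by
  rw [d.inner_vel]
  have := d.sqrt_ε_pos.ne'
  simp [evol_apply, this]

/-- The coordinates are continuous, and `norm_evolCoord_sq` dominates them uniformly in t by a
summable sequence. -/
theorem continuous_evol (h : Lp H 2 (volume : Measure ℝ)) : Continuous fun t => d.evol t h := by
  rw [continuous_iff_continuousAt]
  intro t
  have hs := (hasSum_integral_inner_sq d.e (Lp.memLp h)).summable.mul_left (4 * d.evolConst ^ 2)
  refine tendsto_lp_two_of_dominated hs (fun n => ?_) (Eventually.of_forall fun s n => ?_)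
  · have m := (Lp.memLp h).inner_basis d.e n
    have h1 := (isPrimitive_modePos d.ε_pos d.γ_pos (d.shift_ne_zero n) m).continuous
    have h2 := (isPrimitive_modeVel d.ε_pos d.γ_pos (d.shift_ne_zero n) m).continuous
    have h3 : Continuous fun t => d.evol t h n := by
      have : (fun t => d.evol t h n) = fun t =>
          ((√(d.lam n) * modePos d.ε d.γ (d.shift n) (fun s => ⟪h s, d.e n⟫_ℝ) t : ℝ) : ℂ) +
          ((√d.ε * modeVel d.ε d.γ (d.shift n) (fun s => ⟪h s, d.e n⟫_ℝ) t : ℝ) : ℂ) * Complex.I := by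
        funext t
        apply Complex.ext <;> simp [evol_apply]
      rw [this]
      fun_prop
    exact h3.tendsto t
  · have h1 := d.norm_evolCoord_sq s h n
    have h2 := d.norm_evolCoord_sq t h n
    change ‖d.evolCoord s h n - d.evolCoord t h n‖ ^ 2 ≤ _
    have h3 := norm_sub_le (d.evolCoord s h n) (d.evolCoord t h n)
    have h4 := pow_le_pow_left₀ (norm_nonneg _) h3 2
    nlinarith [sq_nonneg (‖d.evolCoord s h n‖ - ‖d.evolCoord t h n‖)]

attribute [irreducible] evol

/-- The sharp bound 1/δ of a single mode is the same for all modes, so it passes to H by Parseval.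
-/
theorem memLp_pos_evol_and_le (h : Lp H 2 (volume : Measure ℝ)) :
    MemLp (fun t => d.pos (d.evol t h)) 2 ∧
      d.δ ^ 2 * ∫ t, ‖d.pos (d.evol t h)‖ ^ 2 ≤ ‖h‖ ^ 2 := by
  have hδ := d.δ_pos
  have hc : AEStronglyMeasurable fun t => d.pos (d.evol t h) :=
    (d.pos.continuous.comp (d.continuous_evol h)).aestronglyMeasurable
  have m := fun n => (Lp.memLp h).inner_basis d.e n
  have hs := hasSum_integral_inner_sq d.e (Lp.memLp h)
  have hn : ∀ n, ∫⁻ t, ‖⟪d.pos (d.evol t h), d.e n⟫_ℝ‖ₑ ^ 2 ≤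
      ENNReal.ofReal ((d.δ ^ 2)⁻¹ * ∫ t, ⟪h t, d.e n⟫_ℝ ^ 2) := by
    intro n
    simp_rw [inner_pos_evol]
    rw [← (d.memLp_modePos_shift (m n) n).ofReal_integral_norm_sq]
    refine ENNReal.ofReal_le_ofReal ?_
    rw [inv_mul_eq_div, le_div_iff₀' (by positivity)]
    simpa using d.mode_integral_bound (m n) n
  have htot : ∫⁻ t, ‖d.pos (d.evol t h)‖ₑ ^ 2 ≤ ENNReal.ofReal ((d.δ ^ 2)⁻¹ * ‖h‖ ^ 2) := by
    rw [lintegral_enorm_sq_eq_tsum d.e hc, Lp_norm_sq, ← (hs.mul_left _).tsum_eq,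
      ENNReal.ofReal_tsum_of_nonneg (fun n => mul_nonneg (by positivity)
        (integral_nonneg fun t => by positivity)) (hs.mul_left _).summable]
    exact ENNReal.tsum_le_tsum hn
  have hm := memLp_two_of_lintegral_lt_top hc (htot.trans_lt ENNReal.ofReal_lt_top)
  refine ⟨hm, ?_⟩
  rw [← hm.ofReal_integral_norm_sq, ENNReal.ofReal_le_ofReal_iff (by positivity),
    inv_mul_eq_div, le_div_iff₀' (by positivity)] at htot
  exact htot

theorem memLp_pos_evol (h : Lp H 2 (volume : Measure ℝ)) :
    MemLp (fun t => d.pos (d.evol t h)) 2 := (d.memLp_pos_evol_and_le h).1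

theorem norm_pos_evol_le (h : Lp H 2 (volume : Measure ℝ)) :
    d.δ * ‖(d.memLp_pos_evol h).toLp _‖ ≤ ‖h‖ := by
  have := (d.memLp_pos_evol_and_le h).2
  rw [← norm_sq_toLp (d.memLp_pos_evol h), ← mul_pow] at this
  exact le_of_sq_le_sq this (norm_nonneg _)

/-- The basic a priori estimate of the Lyapunov-Perron method. -/
theorem norm_le_of_ae {h : Lp H 2 (volume : Measure ℝ)} {k : ℝ → ℝ} (hk : MemLp k 2)
    (hle : ∀ᵐ t, ‖h t‖ ≤ d.L * ‖d.pos (d.evol t h)‖ + ‖k t‖) :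
    (1 - d.L / d.δ) * ‖h‖ ≤ ‖hk.toLp k‖ := by
  have hw := (d.memLp_pos_evol h).norm
  have hsum : MemLp (fun t => d.L * ‖d.pos (d.evol t h)‖ + ‖k t‖) 2 := (hw.const_mul d.L).add hk.norm
  have h1 : ‖h‖ ≤ ‖hsum.toLp _‖ := by
    refine Lp.norm_le_norm_of_ae_le ?_
    filter_upwards [hle, hsum.coeFn_toLp] with t h1 h2
    rw [h2]
    exact h1.trans (le_abs_self _)
  have h2 : ‖hsum.toLp _‖ ≤ d.L * ‖hw.toLp _‖ + ‖hk.norm.toLp _‖ := by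
    have : hsum.toLp _ = d.L • hw.toLp _ + hk.norm.toLp _ := by
      rw [← MemLp.toLp_const_smul, ← MemLp.toLp_add]; rfl
    rw [this]
    refine (norm_add_le _ _).trans_eq ?_
    rw [norm_smul, Real.norm_of_nonneg d.L_nonneg]
  have h3 : ‖hw.toLp _‖ = ‖(d.memLp_pos_evol h).toLp _‖ := by
    rw [Lp.norm_toLp, Lp.norm_toLp, eLpNorm_norm]
  have h4 : ‖hk.norm.toLp _‖ = ‖hk.toLp k‖ := by
    rw [Lp.norm_toLp, Lp.norm_toLp, eLpNorm_norm]
  have h5 := d.norm_pos_evol_le h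
  have hδ := d.δ_pos
  rw [← le_div_iff₀' hδ] at h5
  rw [h3, h4] at h2
  have h6 := mul_le_mul_of_nonneg_left h5 d.L_nonneg
  have : d.L * (‖h‖ / d.δ) = d.L / d.δ * ‖h‖ := by ring
  linarith

theorem L_div_δ_lt_one : d.L / d.δ < 1 := (div_lt_one d.δ_pos).2 d.L_lt_δ

/-- The Lyapunov-Perron equation `h = G(·, w)`, where `w` solves the linear equation with right-hand
side `h`, is solvable. -/
theorem exists_fixedPoint [CompleteSpace H] {G : ℝ → H → H} (h0 : MemLp (fun t => G t 0) 2)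
    (hm : ∀ f : ℝ → H, Continuous f → AEStronglyMeasurable (fun t => G t (f t)))
    (hG : ∀ t x y, ‖G t x - G t y‖ ≤ d.L * ‖x - y‖) :
    ∃ h : Lp H 2 (volume : Measure ℝ), ∀ᵐ t, h t = G t (d.pos (d.evol t h)) := by
  have hmem : ∀ h : Lp H 2 (volume : Measure ℝ), MemLp (fun t => G t (d.pos (d.evol t h))) 2 := by
    intro h
    have h1 : MemLp (fun t => G t (d.pos (d.evol t h)) - G t 0) 2 := by
      refine ((d.memLp_pos_evol h).norm.const_mul d.L).mono ((hm _
        (d.pos.continuous.comp (d.continuous_evol h))).sub h0.1) (Eventually.of_forall fun t => ?_)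
      refine (hG _ _ _).trans ?_
      rw [sub_zero]
      exact le_abs_self _
    refine (h1.add h0).ae_eq (Eventually.of_forall fun t => ?_)
    simp
  set Φ : Lp H 2 (volume : Measure ℝ) → Lp H 2 (volume : Measure ℝ) := fun h => (hmem h).toLp _
    with hΦ
  -- The factor L comes from the nonlinearity and 1/δ from the linear solution operator.
  have hlip : LipschitzWith ⟨d.L / d.δ, div_nonneg d.L_nonneg d.δ_pos.le⟩ Φ := by
    refine LipschitzWith.of_dist_le_mul fun h₁ h₂ => ?_
    rw [dist_eq_norm, dist_eq_norm]
    have hw := d.memLp_pos_evol (h₁ - h₂)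
    have h5 := d.norm_pos_evol_le (h₁ - h₂)
    rw [← le_div_iff₀' d.δ_pos] at h5
    have h6 : ‖Φ h₁ - Φ h₂‖ ≤ d.L * ‖hw.toLp _‖ := by
      refine Lp.norm_le_mul_norm_of_ae_le_mul ?_
      filter_upwards [Lp.coeFn_sub (Φ h₁) (Φ h₂), (hmem h₁).coeFn_toLp, (hmem h₂).coeFn_toLp,
        hw.coeFn_toLp] with t e1 e2 e3 e4
      rw [e1, Pi.sub_apply, e2, e3, e4]
      refine (hG _ _ _).trans_eq ?_
      simp only [map_sub]
    refine h6.trans ((mul_le_mul_of_nonneg_left h5 d.L_nonneg).trans_eq ?_)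
    change _ = d.L / d.δ * _
    ring
  have hc : ContractingWith ⟨d.L / d.δ, div_nonneg d.L_nonneg d.δ_pos.le⟩ Φ :=
    ⟨d.L_div_δ_lt_one, hlip⟩
  refine ⟨hc.fixedPoint, ?_⟩
  have h1 : Φ hc.fixedPoint = hc.fixedPoint := hc.fixedPoint_isFixedPt
  have h2 := (hmem hc.fixedPoint).coeFn_toLp
  change Φ hc.fixedPoint =ᵐ[volume] _ at h2
  rw [h1] at h2
  exact h2

end GapData
end

/-! ### Return to the original variable, and the slow projection. -/

noncomputable section
open MeasureTheory Set Filter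
open scoped NNReal ENNReal

/-- Replacing the density by a continuous representative upgrades the derivative from almost
everywhere to everywhere on I. The sources are continuous only on parts of the line, because of the
jumps of the indicator and the pulse. -/
theorem IsPrimitive.hasDerivWithinAt_of_ae_eq {f g₀ g : ℝ → ℝ} (hf : IsPrimitive f g₀) {I : Set ℝ}
    (hI : I.OrdConnected) (hg : ContinuousOn g I) (hae : ∀ᵐ t, t ∈ I → g₀ t = g t) {t : ℝ}
    (ht : t ∈ I) : HasDerivWithinAt f (g t) I t := by
  refine hasDerivWithinAt_of_sub_eq_integral hI hg (fun a ha b hb => ?_) ht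
  rw [hf.sub_eq]
  refine intervalIntegral.integral_congr_ae ?_
  filter_upwards [hae] with s hs hs'
  exact hs (hI.uIcc_subset ha hb (uIoc_subset_uIcc hs'))

namespace GapData

variable {H : Type*} [NormedAddCommGroup H] [InnerProductSpace ℝ H] (d : GapData H)

section
variable {h : Lp H 2 (volume : Measure ℝ)} {g : ℝ → H} {I : Set ℝ} (hI : I.OrdConnected)
  (hg : ContinuousOn g I) (hae : ∀ᵐ t, t ∈ I → h t = g t) (n : ℕ+) {t : ℝ} (ht : t ∈ I)

theorem hasDerivAt_pos_evol (h : Lp H 2 (volume : Measure ℝ)) (n : ℕ+) (t : ℝ) :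
    HasDerivAt (fun s => ⟪d.pos (d.evol s h), d.e n⟫_ℝ) ⟪d.vel (d.evol t h), d.e n⟫_ℝ t := by
  have m := (Lp.memLp h).inner_basis d.e n
  simp_rw [inner_pos_evol, inner_vel_evol]
  rw [← hasDerivWithinAt_univ]
  exact (isPrimitive_modePos d.ε_pos d.γ_pos (d.shift_ne_zero n) m).hasDerivWithinAt_of_ae_eq
    ordConnected_univ (isPrimitive_modeVel d.ε_pos d.γ_pos
      (d.shift_ne_zero n) m).continuous.continuousOn (Eventually.of_forall fun _ _ => rfl) trivial

include hI hg hae ht in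
theorem hasDerivWithinAt_vel_evol :
    HasDerivWithinAt (fun s => ⟪d.vel (d.evol s h), d.e n⟫_ℝ)
      ((⟪g t, d.e n⟫_ℝ - d.γ * ⟪d.vel (d.evol t h), d.e n⟫_ℝ
        - d.shift n * ⟪d.pos (d.evol t h), d.e n⟫_ℝ) / d.ε) I t := by
  have m := (Lp.memLp h).inner_basis d.e n
  have c1 := (isPrimitive_modePos d.ε_pos d.γ_pos (d.shift_ne_zero n) m).continuous
  have p2 := isPrimitive_modeVel d.ε_pos d.γ_pos (d.shift_ne_zero n) m
  have c2 := p2.continuous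
  simp_rw [inner_pos_evol, inner_vel_evol]
  refine p2.hasDerivWithinAt_of_ae_eq hI (g := fun t => (⟪g t, d.e n⟫_ℝ -
    d.γ * modeVel d.ε d.γ (d.shift n) (fun s => ⟪h s, d.e n⟫_ℝ) t -
    d.shift n * modePos d.ε d.γ (d.shift n) (fun s => ⟪h s, d.e n⟫_ℝ) t) / d.ε) ?_ ?_ ht
  · exact ((((hg.inner continuousOn_const)).sub (c2.continuousOn.const_mul _)).sub
      (c1.continuousOn.const_mul _)).div_const _
  · filter_upwards [hae] with s hs hs'
    rw [hs hs']

end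

/-- The state of the original equation that corresponds to a state of the equation for
`w = exp (θ t) u`. -/
def unshift (t : ℝ) : ModalSpace →L[ℝ] ModalSpace :=
  Real.exp (-(d.θ * t)) • (ContinuousLinearMap.id ℝ ModalSpace - d.θ • d.embV.comp d.pos)

theorem unshift_apply (t : ℝ) (z : ModalSpace) :
    d.unshift t z = Real.exp (-(d.θ * t)) • (z - d.θ • d.embV (d.pos z)) := rfl

@[simp]
theorem pos_unshift (t : ℝ) (z : ModalSpace) :
    d.pos (d.unshift t z) = Real.exp (-(d.θ * t)) • d.pos z := by
  simp [unshift_apply]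

@[simp]
theorem vel_unshift (t : ℝ) (z : ModalSpace) :
    d.vel (d.unshift t z) = Real.exp (-(d.θ * t)) • (d.vel z - d.θ • d.pos z) := by
  simp [unshift_apply]

/-- The operator norm of the velocity correction in `unshift`. -/
def unshiftConst : ℝ := ‖ContinuousLinearMap.id ℝ ModalSpace - d.θ • d.embV.comp d.pos‖

theorem unshiftConst_nonneg : 0 ≤ d.unshiftConst := norm_nonneg _

theorem norm_unshift_le (t : ℝ) (z : ModalSpace) :
    ‖d.unshift t z‖ ≤ Real.exp (-(d.θ * t)) * (d.unshiftConst * ‖z‖) := by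
  change ‖Real.exp (-(d.θ * t)) •
    (ContinuousLinearMap.id ℝ ModalSpace - d.θ • d.embV.comp d.pos) z‖ ≤ _
  rw [norm_smul, Real.norm_of_nonneg (Real.exp_pos _).le]
  exact mul_le_mul_of_nonneg_left (ContinuousLinearMap.le_opNorm _ _) (Real.exp_pos _).le

theorem continuous_unshift_evol (h : Lp H 2 (volume : Measure ℝ)) :
    Continuous fun t => d.unshift t (d.evol t h) := by
  have h1 := d.continuous_evol h
  have h2 := d.embV.continuous.comp (d.pos.continuous.comp h1)
  have h3 : Continuous fun t => Real.exp (-(d.θ * t)) := by fun_prop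
  exact h3.smul (h1.sub (h2.const_smul d.θ))

theorem hasDerivAt_exp_neg (t : ℝ) : HasDerivAt (fun s => Real.exp (-(d.θ * s)))
    (-d.θ * Real.exp (-(d.θ * t))) t := by
  have h1 : HasDerivAt (fun s : ℝ => -(d.θ * s)) (-d.θ) t := by
    simpa using ((hasDerivAt_id t).const_mul d.θ).fun_neg
  simpa [mul_comm] using h1.exp

theorem hasDerivAt_pos_unshift_evol (h : Lp H 2 (volume : Measure ℝ)) (n : ℕ+) (t : ℝ) :
    HasDerivAt (fun s => ⟪d.pos (d.unshift s (d.evol s h)), d.e n⟫_ℝ)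
      ⟪d.vel (d.unshift t (d.evol t h)), d.e n⟫_ℝ t := by
  simp only [pos_unshift, vel_unshift, real_inner_smul_left, inner_sub_left]
  refine ((d.hasDerivAt_exp_neg t).fun_mul (d.hasDerivAt_pos_evol h n t)).congr_deriv ?_
  ring

/-- The terms from differentiating e^{-θt} recombine through γ = 1 - 2εθ and mid = θ - εθ² into the
unshifted equation. -/
theorem hasDerivWithinAt_vel_unshift_evol {h : Lp H 2 (volume : Measure ℝ)} {g : ℝ → H}
    {I : Set ℝ} (hI : I.OrdConnected) (hg : ContinuousOn g I) (hae : ∀ᵐ t, t ∈ I → h t = g t)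
    (n : ℕ+) {t : ℝ} (ht : t ∈ I) :
    HasDerivWithinAt (fun s => ⟪d.vel (d.unshift s (d.evol s h)), d.e n⟫_ℝ)
      ((⟪Real.exp (-(d.θ * t)) • g t, d.e n⟫_ℝ - ⟪d.vel (d.unshift t (d.evol t h)), d.e n⟫_ℝ
        - d.lam n * ⟪d.pos (d.unshift t (d.evol t h)), d.e n⟫_ℝ) / d.ε) I t := by
  simp only [pos_unshift, vel_unshift, real_inner_smul_left, inner_sub_left]
  refine ((d.hasDerivAt_exp_neg t).hasDerivWithinAt.fun_mul
    ((d.hasDerivWithinAt_vel_evol hI hg hae n ht).fun_sub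
      ((d.hasDerivAt_pos_evol h n t).hasDerivWithinAt.const_mul d.θ))).congr_deriv ?_
  have h1 := d.mid_eq
  have h2 := d.γ_eq
  have h3 := d.ε_pos.ne'
  unfold shift
  rw [h2, ← h1]
  field_simp
  ring

/-- Solutions of the Lyapunov-Perron equation are solutions of the wave equation. -/
theorem isModalSolution_unshift_evol {h : Lp H 2 (volume : Measure ℝ)} {I : Set ℝ}
    (hI : I.OrdConnected) (hae : ∀ᵐ t, t ∈ I → h t =
      Real.exp (d.θ * t) • d.F (Real.exp (-(d.θ * t)) • d.pos (d.evol t h))) :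
    d.IsModalSolution I (fun t => d.unshift t (d.evol t h)) := by
  have hw : Continuous fun t => d.pos (d.evol t h) := d.pos.continuous.comp (d.continuous_evol h)
  have hg : Continuous fun t =>
      Real.exp (d.θ * t) • d.F (Real.exp (-(d.θ * t)) • d.pos (d.evol t h)) := by
    refine Continuous.smul (by fun_prop) (d.F_continuous.comp (Continuous.smul (by fun_prop) hw))
  refine ⟨(d.continuous_unshift_evol h).continuousOn,
    fun n t _ => (d.hasDerivAt_pos_unshift_evol h n t).hasDerivWithinAt, fun n t ht => ?_⟩
  refine (d.hasDerivWithinAt_vel_unshift_evol hI hg.continuousOn hae n ht).congr_deriv ?_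
  rw [smul_smul, ← Real.exp_add, neg_add_cancel, Real.exp_zero, one_smul, pos_unshift]

/-- The number `d_n` of the slow projection. -/
def disc (n : ℕ+) : ℝ := √(1 - 4 * d.ε * d.lam n)

theorem disc_pos {n : ℕ+} (hn : n ≤ d.N) : 0 < d.disc n := Real.sqrt_pos.2 (d.discriminant_pos hn)

/-- The slow projection on the modal space. -/
def slow : ModalSpace →L[ℝ] H :=
  ∑ n ∈ Finset.Icc 1 d.N, ((d.ε / d.disc n) • (innerSL ℝ (d.e n)).comp d.vel
    + ((1 + d.disc n) / (2 * d.disc n)) • (innerSL ℝ (d.e n)).comp d.pos).smulRight (d.e n)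

theorem slow_apply (z : ModalSpace) :
    d.slow z = slowProjection d.e d.lam d.ε d.N (d.pos z, d.vel z) := by
  rw [slow, slowProjection, sum_apply]
  refine Finset.sum_congr rfl fun n _ => ?_
  simp [disc, real_inner_comm (d.e n)]

theorem inner_slow (z : ModalSpace) {n : ℕ+} (hn : n ≤ d.N) :
    ⟪d.slow z, d.e n⟫_ℝ = d.ε / d.disc n * ⟪d.vel z, d.e n⟫_ℝ
      + (1 + d.disc n) / (2 * d.disc n) * ⟪d.pos z, d.e n⟫_ℝ := by
  rw [slow_apply, slowProjection, sum_inner]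
  simp only [real_inner_smul_left]
  rw [Finset.sum_eq_single n]
  · rw [real_inner_self_eq_norm_sq, d.e.orthonormal.norm_eq_one]
    simp [disc]
  · intro m _ hm
    rw [d.e.orthonormal.inner_eq_zero hm, mul_zero]
  · intro h
    exact absurd (Finset.mem_Icc.2 ⟨one_le, hn⟩) h

theorem inner_slow_eq_zero (z : ModalSpace) {n : ℕ+} (hn : ¬ n ≤ d.N) : ⟪d.slow z, d.e n⟫_ℝ = 0 := by
  rw [slow_apply, slowProjection, sum_inner]
  refine Finset.sum_eq_zero fun m hm => ?_
  rw [real_inner_smul_left, d.e.orthonormal.inner_eq_zero, mul_zero]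
  rintro rfl
  exact hn (Finset.mem_Icc.1 hm).2

/-- Up to ε/d_n, the slow coefficient is the coordinate w' - q w along the growing exponential of
the shifted mode. Prescribing the slow projection therefore means prescribing `modeAux` at time 0.
-/
theorem inner_slow_unshift (z : ModalSpace) {n : ℕ+} (hn : n ≤ d.N) :
    ⟪d.slow (d.unshift 0 z), d.e n⟫_ℝ = d.ε / d.disc n * (⟪d.vel z, d.e n⟫_ℝ
      - (fastRoot d.ε d.γ (d.shift n)).re * ⟪d.pos z, d.e n⟫_ℝ) := by
  rw [d.inner_slow _ hn, fastRoot_re, d.discriminant_eq]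
  have h1 := (d.disc_pos hn).ne'
  have h2 := d.ε_pos.ne'
  have h3 := d.γ_eq
  simp only [pos_unshift, vel_unshift, mul_zero, neg_zero, Real.exp_zero, one_smul, inner_sub_left,
    real_inner_smul_left]
  change _ = d.ε / d.disc n * (_ - (-d.γ - d.disc n) / (2 * d.ε) * _)
  rw [h3]
  field_simp
  ring

theorem inner_eq_zero_of_mem_spectralSpace {p : H} (hp : p ∈ spectralSpace d.e d.N) {n : ℕ+}
    (hn : ¬ n ≤ d.N) : ⟪p, d.e n⟫_ℝ = 0 := by
  induction hp using Submodule.span_induction with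
  | mem x hx =>
    obtain ⟨m, hm, rfl⟩ := hx
    exact d.e.orthonormal.inner_eq_zero (by rintro rfl; exact hn hm.2)
  | zero => simp
  | add x y _ _ hx hy => rw [inner_add_left, hx, hy, add_zero]
  | smul c x _ hx => rw [real_inner_smul_left, hx, mul_zero]

theorem slow_mem_spectralSpace (z : ModalSpace) : d.slow z ∈ spectralSpace d.e d.N := by
  rw [slow_apply, slowProjection]
  exact Submodule.sum_mem _ fun n hn => Submodule.smul_mem _ _
    (Submodule.subset_span ⟨n, Finset.mem_Icc.1 hn, rfl⟩)

end GapData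
end

/-! ### Backward solutions with prescribed slow component. -/

noncomputable section
open MeasureTheory Set Filter
open scoped NNReal ENNReal

/-- The pulse `x` on the unit interval. -/
def pulse {E : Type*} [Zero E] (x : E) (t : ℝ) : E := (Ioo (0 : ℝ) 1).indicator (fun _ => x) t

theorem pulse_of_nonpos {E : Type*} [Zero E] (x : E) {t : ℝ} (ht : t ≤ 0) : pulse x t = 0 :=
  indicator_of_notMem (fun h => ht.not_gt h.1) _

theorem memLp_pulse {E : Type*} [NormedAddCommGroup E] (x : E) : MemLp (pulse x) 2 :=
  memLp_indicator_const 2 measurableSet_Ioo x (Or.inr (by simp))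

theorem norm_toLp_pulse (x : ℝ) : ‖(memLp_pulse x).toLp _‖ = ‖x‖ := by
  have h : ‖(memLp_pulse x).toLp _‖ ^ 2 = ‖x‖ ^ 2 := by
    rw [norm_sq_toLp]
    have : (fun t => ‖pulse x t‖ ^ 2) = (Ioo (0 : ℝ) 1).indicator (fun _ => ‖x‖ ^ 2) := by
      funext t
      by_cases ht : t ∈ Ioo (0 : ℝ) 1
      · simp [pulse, indicator_of_mem ht]
      · simp [pulse, indicator_of_notMem ht]
    rw [this, integral_indicator measurableSet_Ioo]
    simp
  exact (pow_left_inj₀ (norm_nonneg _) (norm_nonneg _) two_ne_zero).1 h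

namespace GapData

variable {H : Type*} [NormedAddCommGroup H] [InnerProductSpace ℝ H] (d : GapData H)

/-- The factor by which the pulse in the `n`-th mode is scaled. -/
def kickCoeff (n : ℕ+) : ℝ := d.disc n / (d.ε * pulseCoeff d.ε d.γ (d.shift n))

/-- The strength of the pulse that produces a solution with given slow components. -/
def kick : H →L[ℝ] H :=
  ∑ n ∈ Finset.Icc 1 d.N, (d.kickCoeff n • innerSL ℝ (d.e n)).smulRight (d.e n)

theorem inner_kick (p : H) {n : ℕ+} (hn : n ≤ d.N) :
    ⟪d.kick p, d.e n⟫_ℝ = d.kickCoeff n * ⟪p, d.e n⟫_ℝ := by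
  rw [kick, sum_apply, sum_inner, Finset.sum_eq_single n]
  · simp [real_inner_smul_left, d.e.orthonormal.norm_eq_one, real_inner_comm p]
  · intro m _ hm
    simp [real_inner_smul_left, d.e.orthonormal.inner_eq_zero hm]
  · intro h
    exact absurd (Finset.mem_Icc.2 ⟨one_le, hn⟩) h

/-- The right-hand side of the Lyapunov-Perron equation for backward solutions. -/
def backField (p : H) (t : ℝ) (x : H) : H :=
  (Iic (0 : ℝ)).indicator (fun t => Real.exp (d.θ * t) • d.F (Real.exp (-(d.θ * t)) • x)) t
    + pulse (d.kick p) t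

theorem norm_shifted_sub_le (t : ℝ) (x y : H) :
    ‖Real.exp (d.θ * t) • d.F (Real.exp (-(d.θ * t)) • x)
      - Real.exp (d.θ * t) • d.F (Real.exp (-(d.θ * t)) • y)‖ ≤ d.L * ‖x - y‖ := by
  rw [← smul_sub, norm_smul, Real.norm_of_nonneg (Real.exp_pos _).le]
  calc _ ≤ Real.exp (d.θ * t) * (d.L * ‖Real.exp (-(d.θ * t)) • x - Real.exp (-(d.θ * t)) • y‖) :=
        mul_le_mul_of_nonneg_left (d.F_lip _ _) (Real.exp_pos _).le
    _ = Real.exp (d.θ * t) * Real.exp (-(d.θ * t)) * (d.L * ‖x - y‖) := by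
        rw [← smul_sub, norm_smul, Real.norm_of_nonneg (Real.exp_pos _).le]; ring
    _ = _ := by rw [← Real.exp_add, add_neg_cancel, Real.exp_zero, one_mul]

theorem norm_backField_sub_le (p q : H) (t : ℝ) (x y : H) :
    ‖d.backField p t x - d.backField q t y‖ ≤ d.L * ‖x - y‖ + ‖pulse ‖d.kick (p - q)‖ t‖ := by
  have hp : ‖pulse (d.kick p) t - pulse (d.kick q) t‖ ≤ ‖pulse ‖d.kick (p - q)‖ t‖ := by
    unfold pulse
    by_cases ht : t ∈ Ioo (0 : ℝ) 1
    · simp [indicator_of_mem ht]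
    · simp [indicator_of_notMem ht]
  unfold backField
  rw [add_sub_add_comm]
  refine (norm_add_le _ _).trans (add_le_add ?_ hp)
  by_cases ht : t ∈ Iic (0 : ℝ)
  · rw [indicator_of_mem ht, indicator_of_mem ht]
    exact d.norm_shifted_sub_le t x y
  · rw [indicator_of_notMem ht, indicator_of_notMem ht, sub_self, norm_zero]
    have := d.L_nonneg
    positivity

theorem exists_backSource [CompleteSpace H] (p : H) : ∃ h : Lp H 2 (volume : Measure ℝ),
    ∀ᵐ t, h t = d.backField p t (d.pos (d.evol t h)) := by
  refine d.exists_fixedPoint ?_ (fun f hf => ?_) (fun t x y => ?_)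
  · refine (memLp_pulse (d.kick p)).ae_eq (Eventually.of_forall fun t => ?_)
    simp [backField, d.F_zero]
  · unfold backField
    refine AEStronglyMeasurable.add ?_ (memLp_pulse _).1
    have : Continuous fun t => Real.exp (d.θ * t) • d.F (Real.exp (-(d.θ * t)) • f t) :=
      Continuous.smul (by fun_prop) (d.F_continuous.comp (Continuous.smul (by fun_prop) hf))
    exact (this.aestronglyMeasurable.indicator (measurableSet_Iic (a := (0 : ℝ))))
  · simpa [pulse] using d.norm_backField_sub_le p p t x y

/-- The difference of two sources obeys the a priori estimate with the difference of the pulses as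
forcing. It gives the Lipschitz dependence on p and, for p = q, uniqueness. -/
theorem norm_backSource_sub_le {p q : H} {h k : Lp H 2 (volume : Measure ℝ)}
    (hh : ∀ᵐ t, h t = d.backField p t (d.pos (d.evol t h)))
    (hk : ∀ᵐ t, k t = d.backField q t (d.pos (d.evol t k))) :
    (1 - d.L / d.δ) * ‖h - k‖ ≤ ‖d.kick (p - q)‖ := by
  refine (d.norm_le_of_ae (memLp_pulse ‖d.kick (p - q)‖) ?_).trans_eq ?_
  · filter_upwards [hh, hk, Lp.coeFn_sub h k] with t h1 h2 h3
    rw [h3, Pi.sub_apply, h1, h2, map_sub, map_sub]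
    exact d.norm_backField_sub_le ..
  · rw [norm_toLp_pulse, norm_norm]

/-- The slow components of a solution of the linear equation are determined by the right-hand side
for positive times. -/
theorem inner_slow_unshift_evol {h : Lp H 2 (volume : Measure ℝ)} {p : H}
    (hh : ∀ᵐ t, 0 < t → h t = pulse (d.kick p) t) {n : ℕ+} (hn : n ≤ d.N) :
    ⟪d.slow (d.unshift 0 (d.evol 0 h)), d.e n⟫_ℝ = ⟪p, d.e n⟫_ℝ := by
  have hε := d.ε_pos
  have hneg := (d.shift_neg_iff n).2 hn
  have hpc := pulseCoeff_ne_zero hε d.γ_pos hneg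
  have hdisc := (d.disc_pos hn).ne'
  have hd : 0 ≤ d.γ ^ 2 - 4 * d.ε * d.shift n := by
    rw [d.discriminant_eq]; exact (d.discriminant_pos hn).le
  rw [d.inner_slow_unshift _ hn, d.inner_vel_evol, d.inner_pos_evol, modeVel_sub_fastRoot_mul hd]
  set c := d.kickCoeff n * ⟪p, d.e n⟫_ℝ with hc
  have m := (Lp.memLp h).inner_basis d.e n
  have mp : MemLp ((Ioo (0 : ℝ) 1).indicator (1 : ℝ → ℝ)) 2 := memLp_pulse (1 : ℝ)
  have mr : MemLp (fun t => ⟪h t, d.e n⟫_ℝ - c * (Ioo (0 : ℝ) 1).indicator (1 : ℝ → ℝ) t) 2 :=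
    m.sub (mp.const_mul c)
  -- The first summand vanishes for t > 0 and so does not affect the unstable component; the second
  -- contributes c times `pulseCoeff`, and `kickCoeff` is normalized to cancel this factor and
  -- ε/d_n.
  have hsplit : (fun t => ⟪h t, d.e n⟫_ℝ) = fun t =>
      (⟪h t, d.e n⟫_ℝ - c * (Ioo (0 : ℝ) 1).indicator (1 : ℝ → ℝ) t)
        + c * (Ioo (0 : ℝ) 1).indicator (1 : ℝ → ℝ) t := by funext t; ring
  rw [hsplit, modeAux_add hε d.γ_pos hneg.ne mr (mp.const_mul c), modeAux_const_mul]
  simp only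
  rw [modeAux_zero_of_ae hε d.γ_pos hneg, zero_add, Complex.re_ofReal_mul]
  · change _ * (c * pulseCoeff d.ε d.γ (d.shift n)) = _
    rw [hc, kickCoeff]
    field_simp
  · filter_upwards [hh] with t ht ht0
    rw [ht ht0]
    by_cases hm : t ∈ Ioo (0 : ℝ) 1
    · simp only [pulse, indicator_of_mem hm, d.inner_kick p hn, Pi.one_apply]
      rw [hc]; ring
    · simp [pulse, indicator_of_notMem hm]

variable [CompleteSpace H]

/-- The right-hand side that belongs to the backward solution with slow component `p`. -/
def backSource (p : H) : Lp H 2 (volume : Measure ℝ) := (d.exists_backSource p).choose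

theorem backSource_ae (p : H) :
    ∀ᵐ t, d.backSource p t = d.backField p t (d.pos (d.evol t (d.backSource p))) :=
  (d.exists_backSource p).choose_spec

/-- The backward solution with slow component `p`. -/
def backSolution (p : H) (t : ℝ) : ModalSpace := d.unshift t (d.evol t (d.backSource p))

theorem backSource_ae_of_pos (p : H) :
    ∀ᵐ t, 0 < t → d.backSource p t = pulse (d.kick p) t := by
  filter_upwards [d.backSource_ae p] with t ht h0
  rw [ht, backField, indicator_of_notMem (by simpa using h0), zero_add]

theorem isModalSolution_backSolution (p : H) : d.IsModalSolution (Iic 0) (d.backSolution p) := by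
  refine d.isModalSolution_unshift_evol ordConnected_Iic ?_
  filter_upwards [d.backSource_ae p] with t ht h0
  rw [ht, backField, indicator_of_mem h0, pulse_of_nonpos _ h0, add_zero]

theorem slow_backSolution {p : H} (hp : p ∈ spectralSpace d.e d.N) :
    d.slow (d.backSolution p 0) = p := by
  refine d.ext_inner fun n => ?_
  by_cases hn : n ≤ d.N
  · exact d.inner_slow_unshift_evol (d.backSource_ae_of_pos p) hn
  · rw [d.inner_slow_eq_zero _ hn, d.inner_eq_zero_of_mem_spectralSpace hp hn]

theorem norm_backSolution_sub_le : ∃ K, ∀ p q : H,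
    ‖d.backSolution p 0 - d.backSolution q 0‖ ≤ K * ‖p - q‖ := by
  have h1 := d.L_div_δ_lt_one
  refine ⟨d.unshiftConst * (d.evolConst * (‖d.kick‖ / (1 - d.L / d.δ))), fun p q => ?_⟩
  have h2 := d.norm_backSource_sub_le (d.backSource_ae p) (d.backSource_ae q)
  rw [← le_div_iff₀' (by linarith)] at h2
  have h3 := (d.kick.le_opNorm (p - q))
  have h0 : 0 ≤ d.evolConst := Real.sqrt_nonneg _
  rw [backSolution, backSolution, ← map_sub, ← map_sub]
  calc _ ≤ Real.exp (-(d.θ * 0)) * (d.unshiftConst *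
        ‖d.evol 0 (d.backSource p - d.backSource q)‖) := d.norm_unshift_le _ _
    _ = d.unshiftConst * ‖d.evol 0 (d.backSource p - d.backSource q)‖ := by simp
    _ ≤ d.unshiftConst * (d.evolConst * ((‖d.kick‖ * ‖p - q‖) / (1 - d.L / d.δ))) := by
        refine mul_le_mul_of_nonneg_left ((d.norm_evol_le _ _).trans ?_) d.unshiftConst_nonneg
        refine mul_le_mul_of_nonneg_left (h2.trans ?_) h0
        exact div_le_div_of_nonneg_right h3 (by linarith)
    _ = _ := by ring

theorem integrableOn_backSolution (p : H) :
    IntegrableOn (fun t => Real.exp (2 * d.θ * t) * ‖d.pos (d.backSolution p t)‖ ^ 2) (Iic 0) := by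
  refine (d.memLp_pos_evol (d.backSource p)).integrable_norm_sq_real.integrableOn.congr
    (Eventually.of_forall fun t => ?_)
  simp only [backSolution, pos_unshift, norm_smul, mul_pow, ← mul_assoc]
  rw [Real.norm_of_nonneg (Real.exp_pos _).le, ← Real.exp_nat_mul, ← Real.exp_add]
  norm_num
  ring_nf
  simp

/-- Backward solutions of tempered growth are determined by their slow component. -/
theorem eq_backSolution {z : ℝ → ModalSpace} (hz : d.IsModalSolution (Iic 0) z)
    (hi : IntegrableOn (fun t => Real.exp (2 * d.θ * t) * ‖d.pos (z t)‖ ^ 2) (Iic 0)) :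
    z 0 = d.backSolution (d.slow (z 0)) 0 := by
  set p := d.slow (z 0) with hp
  have hu : ContinuousOn (fun t => d.pos (z t)) (Iic 0) :=
    d.pos.continuous.comp_continuousOn hz.continuousOn
  have hgc : ContinuousOn (fun t => Real.exp (d.θ * t) • d.F (d.pos (z t))) (Iic 0) :=
    ContinuousOn.smul (by fun_prop) (d.F_continuous.comp_continuousOn hu)
  have hexp : ∀ t, Real.exp (2 * d.θ * t) = Real.exp (d.θ * t) ^ 2 := fun t => by
    rw [← Real.exp_nat_mul]; norm_num; ring_nf
  have hm1 : MemLp ((Iic (0 : ℝ)).indicator fun t => Real.exp (d.θ * t) • d.F (d.pos (z t))) 2 := by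
    rw [memLp_indicator_iff_restrict measurableSet_Iic]
    have hmeas := hgc.aestronglyMeasurable (μ := volume) measurableSet_Iic
    rw [← memLp_norm_iff hmeas, memLp_two_iff_integrable_sq hmeas.norm]
    refine (hi.const_mul (d.L ^ 2)).mono' (hmeas.norm.pow 2) (Eventually.of_forall fun t => ?_)
    rw [Real.norm_of_nonneg (by positivity), norm_smul, Real.norm_of_nonneg (Real.exp_pos _).le,
      hexp, mul_pow]
    have := pow_le_pow_left₀ (norm_nonneg _) (d.norm_F_le (d.pos (z t))) 2
    rw [mul_pow] at this
    calc _ ≤ Real.exp (d.θ * t) ^ 2 * (d.L ^ 2 * ‖d.pos (z t)‖ ^ 2) := by gcongr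
      _ = _ := by ring
  have hm := hm1.add (memLp_pulse (d.kick p))
  -- The source seen by z for t ≤ 0, extended by the pulse that belongs to the slow component of
  -- z(0).
  set k : Lp H 2 (volume : Measure ℝ) := hm.toLp _ with hk
  have hkae := hm.coeFn_toLp
  rw [← hk] at hkae
  have hk0 : ∀ᵐ t, t ∈ Iic (0 : ℝ) → k t = Real.exp (d.θ * t) • d.F (d.pos (z t)) := by
    filter_upwards [hkae] with t ht h0
    rw [ht, Pi.add_apply, indicator_of_mem h0, pulse_of_nonpos _ h0, add_zero]
  have hk1 : ∀ᵐ t, 0 < t → k t = pulse (d.kick p) t := by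
    filter_upwards [hkae] with t ht h0
    rw [ht, Pi.add_apply, indicator_of_notMem (by simpa using h0), zero_add]
  set y : ℝ → ModalSpace := fun t => d.unshift t (d.evol t k) with hy
  have hyi := (d.memLp_pos_evol k).integrable_norm_sq_real
  -- On (-∞, 0] both z and y solve the linear equation with this source. After multiplication by
  -- e^{θt} their difference is a square integrable homogeneous solution, without unstable component
  -- because the slow projections agree at 0.
  have hzero : ∀ n, ∀ t ∈ Iic (0 : ℝ), ⟪d.pos (z t), d.e n⟫_ℝ = ⟪d.pos (y t), d.e n⟫_ℝ ∧
      ⟪d.vel (z t), d.e n⟫_ℝ = ⟪d.vel (y t), d.e n⟫_ℝ := by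
    intro n t ht
    set a : ℝ → ℝ := fun t => ⟪d.pos (z t), d.e n⟫_ℝ - ⟪d.pos (y t), d.e n⟫_ℝ with ha
    set b : ℝ → ℝ := fun t => ⟪d.vel (z t), d.e n⟫_ℝ - ⟪d.vel (y t), d.e n⟫_ℝ with hb
    have hE : ∀ t, HasDerivAt (fun s => Real.exp (d.θ * s)) (d.θ * Real.exp (d.θ * t)) t := by
      intro t
      have h1 : HasDerivAt (fun s : ℝ => d.θ * s) d.θ t := by
        simpa using (hasDerivAt_id t).const_mul d.θ
      simpa [mul_comm] using h1.exp
    have hda : ∀ t ∈ Iic (0 : ℝ), HasDerivWithinAt a (b t) (Iic 0) t := fun t ht =>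
      (hz.deriv_pos n t ht).fun_sub (d.hasDerivAt_pos_unshift_evol k n t).hasDerivWithinAt
    have hdb : ∀ t ∈ Iic (0 : ℝ), HasDerivWithinAt b ((-b t - d.lam n * a t) / d.ε) (Iic 0) t := by
      intro t ht
      refine ((hz.deriv_vel n t ht).fun_sub (d.hasDerivWithinAt_vel_unshift_evol ordConnected_Iic
        hgc hk0 n ht)).congr_deriv ?_
      rw [smul_smul, ← Real.exp_add, neg_add_cancel, Real.exp_zero, one_smul]
      simp only [ha, hb, hy]
      ring
    have hshift := homogeneous_mode_eq_zero d.ε_pos d.γ_pos (d.shift_ne_zero n)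
      (z := fun t => Real.exp (d.θ * t) * a t)
      (z₁ := fun t => Real.exp (d.θ * t) * (b t + d.θ * a t))
      (fun t ht => ((hE t).hasDerivWithinAt.fun_mul (hda t ht)).congr_deriv (by ring))
      (fun t ht => ((hE t).hasDerivWithinAt.fun_mul ((hdb t ht).fun_add
        ((hda t ht).const_mul d.θ))).congr_deriv (by
          have h1 := d.mid_eq
          have h2 := d.γ_eq
          have h3 := d.ε_pos.ne'
          unfold shift
          rw [h2, ← h1]
          field_simp
          ring)) ?_ ?_ ht
    · obtain ⟨h1, h2⟩ := hshift
      have h3 := (mul_eq_zero.1 h1).resolve_left (Real.exp_pos _).ne'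
      have h4 := (mul_eq_zero.1 h2).resolve_left (Real.exp_pos _).ne'
      rw [h3, mul_zero, add_zero] at h4
      exact ⟨sub_eq_zero.1 h3, sub_eq_zero.1 h4⟩
    · have hac : ContinuousOn a (Iic 0) := fun t ht => (hda t ht).continuousWithinAt
      have hmeas : AEStronglyMeasurable (fun t => (Real.exp (d.θ * t) * a t) ^ 2)
          (volume.restrict (Iic 0)) :=
        ((ContinuousOn.mul (by fun_prop) hac).pow 2).aestronglyMeasurable measurableSet_Iic
      refine ((hi.const_mul 2).add (hyi.integrableOn.const_mul 2)).mono' hmeas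
        (Eventually.of_forall fun t => ?_)
      have i1 : ∀ x : H, ⟪x, d.e n⟫_ℝ ^ 2 ≤ ‖x‖ ^ 2 := fun x => by
        have := abs_real_inner_le_norm x (d.e n)
        rw [d.e.orthonormal.norm_eq_one, mul_one] at this
        rw [← sq_abs]
        gcongr
      have i2 := i1 (d.pos (z t))
      have i3 := i1 (d.pos (d.evol t k))
      have i4 : Real.exp (d.θ * t) * ⟪d.pos (y t), d.e n⟫_ℝ = ⟪d.pos (d.evol t k), d.e n⟫_ℝ := by
        simp only [hy, pos_unshift, real_inner_smul_left]
        rw [← mul_assoc, ← Real.exp_add, add_neg_cancel, Real.exp_zero, one_mul]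
      rw [Real.norm_of_nonneg (by positivity)]
      simp only [ha, mul_sub, i4]
      simp only [Pi.add_apply]
      rw [hexp]
      have i5 := mul_le_mul_of_nonneg_left i2 (sq_nonneg (Real.exp (d.θ * t)))
      nlinarith [sq_nonneg (Real.exp (d.θ * t) * ⟪d.pos (z t), d.e n⟫_ℝ
        + ⟪d.pos (d.evol t k), d.e n⟫_ℝ)]
    · intro hneg
      have hn := (d.shift_neg_iff n).1 hneg
      have h1 : ⟪d.slow (z 0 - y 0), d.e n⟫_ℝ = 0 := by
        rw [map_sub, inner_sub_left, d.inner_slow_unshift_evol hk1 hn, sub_self]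
      rw [d.inner_slow _ hn, map_sub, map_sub, inner_sub_left, inner_sub_left] at h1
      change d.ε / d.disc n * b 0 + (1 + d.disc n) / (2 * d.disc n) * a 0 = 0 at h1
      have h2 := (d.disc_pos hn).ne'
      have h3 := d.ε_pos.ne'
      have h4 := d.γ_eq
      rw [fastRoot_re, d.discriminant_eq]
      change _ = (-d.γ - d.disc n) / (2 * d.ε) * _
      rw [h4]
      simp only [mul_zero, Real.exp_zero, one_mul]
      field_simp at h1 ⊢
      linear_combination h1
  have heq : ∀ t ∈ Iic (0 : ℝ), z t = y t := fun t ht =>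
    d.modal_ext (fun n => (hzero n t ht).1) fun n => (hzero n t ht).2
  -- Since z = y, the source k depends on its own linear solution and solves the Lyapunov-Perron
  -- equation; uniqueness identifies it with `backSource p`.
  have hfix : ∀ᵐ t, k t = d.backField p t (d.pos (d.evol t k)) := by
    filter_upwards [hkae] with t ht
    rw [ht, Pi.add_apply, backField]
    congr 1
    by_cases h0 : t ∈ Iic (0 : ℝ)
    · rw [indicator_of_mem h0, indicator_of_mem h0, heq t h0]
      simp only [hy, pos_unshift]
    · rw [indicator_of_notMem h0, indicator_of_notMem h0]
  have h1 := d.norm_backSource_sub_le hfix (d.backSource_ae p)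
  rw [sub_self, map_zero, norm_zero] at h1
  have h2 := d.L_div_δ_lt_one
  have h3 : ‖k - d.backSource p‖ = 0 := by
    refine le_antisymm ?_ (norm_nonneg _)
    by_contra hlt
    have := mul_pos (by linarith : 0 < 1 - d.L / d.δ) (not_le.1 hlt)
    linarith
  rw [heq 0 (mem_Iic.2 le_rfl), backSolution, ← sub_eq_zero.1 (norm_eq_zero.1 h3)]

end GapData
end

/-! ### The cutoff and the tracking trajectory. -/

noncomputable section
open MeasureTheory Set Filter
open scoped NNReal ENNReal

theorem deriv_eq_zero_of_eqOn_Iic {f : ℝ → ℝ} {c t : ℝ} (hf : DifferentiableAt ℝ f t)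
    (h : ∀ s ≤ t, f s = c) : deriv f t = 0 :=
  (uniqueDiffWithinAt_Iic t).eq_deriv _ hf.hasDerivAt.hasDerivWithinAt
    ((hasDerivWithinAt_const t (Iic t) c).congr (fun s hs => h s hs) (h t le_rfl))

theorem deriv_eq_zero_of_eqOn_Ici {f : ℝ → ℝ} {c t : ℝ} (hf : DifferentiableAt ℝ f t)
    (h : ∀ s ≥ t, f s = c) : deriv f t = 0 :=
  (uniqueDiffWithinAt_Ici t).eq_deriv _ hf.hasDerivAt.hasDerivWithinAt
    ((hasDerivWithinAt_const t (Ici t) c).congr (fun s hs => h s hs) (h t le_rfl))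

/-- A twice differentiable transition from `0` to `1` on the unit interval. -/
structure Cutoff where
  φ : ℝ → ℝ
  φ₁ : ℝ → ℝ
  φ₂ : ℝ → ℝ
  B : ℝ
  deriv : ∀ t, HasDerivAt φ (φ₁ t) t
  deriv₁ : ∀ t, HasDerivAt φ₁ (φ₂ t) t
  continuous₂ : Continuous φ₂
  left : ∀ t ≤ 0, φ t = 0 ∧ φ₁ t = 0 ∧ φ₂ t = 0
  right : ∀ t, 1 ≤ t → φ t = 1 ∧ φ₁ t = 0 ∧ φ₂ t = 0
  nonneg : ∀ t, 0 ≤ φ t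
  le_one : ∀ t, φ t ≤ 1
  abs_le₁ : ∀ t, |φ₁ t| ≤ B
  abs_le₂ : ∀ t, |φ₂ t| ≤ B

theorem nonempty_cutoff : Nonempty Cutoff := by
  have h0 : ContDiff ℝ 2 Real.smoothTransition := Real.smoothTransition.contDiff
  have h1 : ContDiff ℝ 1 (deriv Real.smoothTransition) := h0.iterate_deriv' 1 1
  have h2 : Continuous (deriv (deriv Real.smoothTransition)) := h1.continuous_deriv le_rfl
  have d0 : Differentiable ℝ Real.smoothTransition := h0.differentiable (by norm_num)
  have d1 : Differentiable ℝ (deriv Real.smoothTransition) := h1.differentiable (by norm_num)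
  have l1 : ∀ t ≤ 0, deriv Real.smoothTransition t = 0 := fun t ht =>
    deriv_eq_zero_of_eqOn_Iic (d0 t) fun s hs => Real.smoothTransition.zero_of_nonpos (hs.trans ht)
  have l2 : ∀ t ≤ 0, deriv (deriv Real.smoothTransition) t = 0 := fun t ht =>
    deriv_eq_zero_of_eqOn_Iic (d1 t) fun s hs => l1 s (hs.trans ht)
  have r1 : ∀ t, 1 ≤ t → deriv Real.smoothTransition t = 0 := fun t ht =>
    deriv_eq_zero_of_eqOn_Ici (d0 t) fun s hs => Real.smoothTransition.one_of_one_le (ht.trans hs)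
  have r2 : ∀ t, 1 ≤ t → deriv (deriv Real.smoothTransition) t = 0 := fun t ht =>
    deriv_eq_zero_of_eqOn_Ici (d1 t) fun s hs => r1 s (ht.trans hs)
  have hbd : ∀ f : ℝ → ℝ, Continuous f → (∀ t ≤ 0, f t = 0) → (∀ t, 1 ≤ t → f t = 0) →
      ∃ B, ∀ t, |f t| ≤ B := by
    intro f hf hl hr
    obtain ⟨B, hB⟩ := (isCompact_Icc (a := (0 : ℝ)) (b := 1)).exists_bound_of_continuousOn
      hf.continuousOn
    have hB0 : 0 ≤ B := (norm_nonneg _).trans (hB 0 (by simp))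
    refine ⟨B, fun t => ?_⟩
    by_cases ht0 : t ≤ 0
    · rw [hl t ht0, abs_zero]; exact hB0
    by_cases ht1 : 1 ≤ t
    · rw [hr t ht1, abs_zero]; exact hB0
    exact hB t ⟨(not_le.1 ht0).le, (not_le.1 ht1).le⟩
  obtain ⟨B₁, hB₁⟩ := hbd _ h1.continuous l1 r1
  obtain ⟨B₂, hB₂⟩ := hbd _ h2 l2 r2
  exact ⟨{
    φ := Real.smoothTransition
    φ₁ := deriv Real.smoothTransition
    φ₂ := deriv (deriv Real.smoothTransition)
    B := max B₁ B₂
    deriv := fun t => (d0 t).hasDerivAt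
    deriv₁ := fun t => (d1 t).hasDerivAt
    continuous₂ := h2
    left := fun t ht => ⟨Real.smoothTransition.zero_of_nonpos ht, l1 t ht, l2 t ht⟩
    right := fun t ht => ⟨Real.smoothTransition.one_of_one_le ht, r1 t ht, r2 t ht⟩
    nonneg := Real.smoothTransition.nonneg
    le_one := Real.smoothTransition.le_one
    abs_le₁ := fun t => (hB₁ t).trans (le_max_left _ _)
    abs_le₂ := fun t => (hB₂ t).trans (le_max_right _ _) }⟩

namespace Cutoff

variable (c : Cutoff)

theorem continuous : Continuous c.φ := continuous_iff_continuousAt.2 fun t => (c.deriv t).continuousAt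

theorem continuous₁ : Continuous c.φ₁ :=
  continuous_iff_continuousAt.2 fun t => (c.deriv₁ t).continuousAt

theorem B_nonneg : 0 ≤ c.B := (abs_nonneg _).trans (c.abs_le₁ 0)

end Cutoff

namespace GapData

variable {H : Type*} [NormedAddCommGroup H] [InnerProductSpace ℝ H] (d : GapData H) (c : Cutoff)
  (z₀ : ModalSpace)

/-- The commutator of the linear wave operator with the cutoff, applied to a trajectory. -/
def cutoffSource (t : ℝ) : H :=
  (d.ε * c.φ₂ t + c.φ₁ t) • d.pos (d.flow t z₀) + (2 * d.ε * c.φ₁ t) • d.vel (d.flow t z₀)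

/-- The right-hand side of the Lyapunov-Perron equation for the tracking trajectory. -/
def trackField (t : ℝ) (x : H) : H :=
  Real.exp (d.θ * t) • (d.F (Real.exp (-(d.θ * t)) • x + c.φ t • d.pos (d.flow t z₀))
    - c.φ t • d.F (d.pos (d.flow t z₀)) - d.cutoffSource c z₀ t)

theorem norm_trackField_sub_le (t : ℝ) (x y : H) :
    ‖d.trackField c z₀ t x - d.trackField c z₀ t y‖ ≤ d.L * ‖x - y‖ := by
  unfold trackField
  rw [← smul_sub, norm_smul, Real.norm_of_nonneg (Real.exp_pos _).le, sub_sub_sub_cancel_right,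
    sub_sub_sub_cancel_right]
  calc _ ≤ Real.exp (d.θ * t) * (d.L * ‖Real.exp (-(d.θ * t)) • x + c.φ t • d.pos (d.flow t z₀)
          - (Real.exp (-(d.θ * t)) • y + c.φ t • d.pos (d.flow t z₀))‖) :=
        mul_le_mul_of_nonneg_left (d.F_lip _ _) (Real.exp_pos _).le
    _ = Real.exp (d.θ * t) * Real.exp (-(d.θ * t)) * (d.L * ‖x - y‖) := by
        rw [add_sub_add_right_eq_sub, ← smul_sub, norm_smul,
          Real.norm_of_nonneg (Real.exp_pos _).le]; ring
    _ = _ := by rw [← Real.exp_add, add_neg_cancel, Real.exp_zero, one_mul]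

theorem continuous_cutoffSource : Continuous (d.cutoffSource c z₀) := by
  have h := d.continuous_flow z₀
  have h1 := d.pos.continuous.comp h
  have h2 := d.vel.continuous.comp h
  have c1 := c.continuous₁
  have c2 := c.continuous₂
  exact (Continuous.smul (by fun_prop) h1).add (Continuous.smul (by fun_prop) h2)

theorem continuous_trackField {f : ℝ → H} (hf : Continuous f) :
    Continuous fun t => d.trackField c z₀ t (f t) := by
  have h1 := d.pos.continuous.comp (d.continuous_flow z₀)
  have c0 := c.continuous
  exact Continuous.smul (by fun_prop) (((d.F_continuous.comp ((Continuous.smul (by fun_prop) hf).add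
    (c0.smul h1))).sub (c0.smul (d.F_continuous.comp h1))).sub (d.continuous_cutoffSource c z₀))

/-- A bound for trajectories on the unit interval. -/
def unitGrowth : ℝ := Real.exp d.fieldConst

theorem norm_flow_le_unitGrowth {t : ℝ} (h0 : 0 ≤ t) (h1 : t ≤ 1) :
    ‖d.flow t z₀‖ ≤ d.unitGrowth * ‖z₀‖ := by
  refine (d.norm_flow_le h0 z₀).trans (mul_le_mul_of_nonneg_right ?_ (norm_nonneg _))
  refine Real.exp_le_exp.2 ?_
  have := d.fieldConst.2
  exact mul_le_of_le_one_right this h1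

/-- The constant in the bound of `trackField` at the origin. -/
def trackConst : ℝ := Real.exp d.θ * ((2 * d.L + (d.ε * c.B + c.B)) * ‖d.pos‖
  + 2 * d.ε * c.B * ‖d.vel‖) * d.unitGrowth

theorem trackConst_nonneg : 0 ≤ d.trackConst c := by
  have h1 := d.L_nonneg
  have h2 := c.B_nonneg
  have h3 := d.ε_pos
  have h4 : 0 ≤ d.unitGrowth := (Real.exp_pos _).le
  unfold trackConst
  positivity

/-- Before time 0 everything is cut off and F(0) = 0; after time 1 the cutoff is 1, so the two
nonlinear terms cancel and the commutator vanishes. -/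
theorem trackField_zero_of_notMem {t : ℝ} (ht : t ∉ Ioo (0 : ℝ) 1) : d.trackField c z₀ t 0 = 0 := by
  by_cases h : t ≤ 0
  · obtain ⟨h0, h1, h2⟩ := c.left t h
    simp [trackField, cutoffSource, h0, h1, h2, d.F_zero]
  · have h' : 1 ≤ t := by
      by_contra h1
      exact ht ⟨not_le.1 h, not_le.1 h1⟩
    obtain ⟨h0, h1, h2⟩ := c.right t h'
    simp [trackField, cutoffSource, h0, h1, h2]

theorem norm_trackField_zero_le (t : ℝ) :
    ‖d.trackField c z₀ t 0‖ ≤ ‖pulse (d.trackConst c * ‖z₀‖) t‖ := by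
  by_cases ht : t ∈ Ioo (0 : ℝ) 1
  · have hB := c.B_nonneg
    have hε := d.ε_pos
    have hL := d.L_nonneg
    have hθ := d.θ_pos
    have hz := d.norm_flow_le_unitGrowth z₀ ht.1.le ht.2.le
    set z := d.flow t z₀ with hzd
    have hp := d.pos.le_opNorm z
    have hv := d.vel.le_opNorm z
    have hφ : |c.φ t| ≤ 1 := abs_le.2 ⟨by linarith [c.nonneg t], c.le_one t⟩
    have e1 : ‖d.F (c.φ t • d.pos z)‖ ≤ d.L * ‖d.pos z‖ := by
      refine (d.norm_F_le _).trans (mul_le_mul_of_nonneg_left ?_ hL)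
      rw [norm_smul]
      exact mul_le_of_le_one_left (norm_nonneg _) hφ
    have e2 : ‖c.φ t • d.F (d.pos z)‖ ≤ d.L * ‖d.pos z‖ := by
      rw [norm_smul]
      exact (mul_le_of_le_one_left (norm_nonneg _) hφ).trans (d.norm_F_le _)
    have e3 : ‖d.cutoffSource c z₀ t‖ ≤ (d.ε * c.B + c.B) * ‖d.pos z‖
        + 2 * d.ε * c.B * ‖d.vel z‖ := by
      refine (norm_add_le _ _).trans (add_le_add ?_ ?_)
      · rw [norm_smul]
        refine mul_le_mul_of_nonneg_right ((norm_add_le _ _).trans (add_le_add ?_ (c.abs_le₁ t)))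
          (norm_nonneg _)
        rw [norm_mul, Real.norm_of_nonneg hε.le]
        exact mul_le_mul_of_nonneg_left (c.abs_le₂ t) hε.le
      · rw [norm_smul, norm_mul, Real.norm_of_nonneg (by positivity)]
        exact mul_le_mul_of_nonneg_right (mul_le_mul_of_nonneg_left (c.abs_le₁ t) (by positivity))
          (norm_nonneg _)
    have e4 : ‖d.F (c.φ t • d.pos z) - c.φ t • d.F (d.pos z) - d.cutoffSource c z₀ t‖ ≤
        (2 * d.L + (d.ε * c.B + c.B)) * ‖d.pos z‖ + 2 * d.ε * c.B * ‖d.vel z‖ := by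
      have := norm_sub_le (d.F (c.φ t • d.pos z) - c.φ t • d.F (d.pos z)) (d.cutoffSource c z₀ t)
      have := norm_sub_le (d.F (c.φ t • d.pos z)) (c.φ t • d.F (d.pos z))
      linarith
    rw [pulse, indicator_of_mem ht, trackField, smul_zero, zero_add, norm_smul,
      Real.norm_of_nonneg (Real.exp_pos _).le,
      Real.norm_of_nonneg (mul_nonneg (d.trackConst_nonneg c) (norm_nonneg _))]
    calc _ ≤ Real.exp d.θ * ((2 * d.L + (d.ε * c.B + c.B)) * (‖d.pos‖ * (d.unitGrowth * ‖z₀‖))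
          + 2 * d.ε * c.B * (‖d.vel‖ * (d.unitGrowth * ‖z₀‖))) := by
          gcongr
          · nlinarith [ht.2]
          · refine e4.trans ?_
            gcongr
            · exact hp.trans (by gcongr)
            · exact hv.trans (by gcongr)
      _ = _ := by unfold trackConst; ring
  · rw [d.trackField_zero_of_notMem c z₀ ht, norm_zero]
    exact norm_nonneg _

/-- The inhomogeneity lives on the unit interval, where the trajectory is bounded by a multiple of
its initial value. No decay or boundedness of the trajectory at later times is needed, and the
source is linear in size in z₀. -/
theorem exists_trackSource [CompleteSpace H] : ∃ h : Lp H 2 (volume : Measure ℝ),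
    (∀ᵐ t, h t = d.trackField c z₀ t (d.pos (d.evol t h))) ∧
      (1 - d.L / d.δ) * ‖h‖ ≤ d.trackConst c * ‖z₀‖ := by
  have h0 : MemLp (fun t => d.trackField c z₀ t 0) 2 :=
    (memLp_pulse (d.trackConst c * ‖z₀‖)).mono
      (d.continuous_trackField c z₀ continuous_const).aestronglyMeasurable
      (Eventually.of_forall fun t => d.norm_trackField_zero_le c z₀ t)
  obtain ⟨h, hh⟩ := d.exists_fixedPoint h0
    (fun f hf => (d.continuous_trackField c z₀ hf).aestronglyMeasurable)
    (d.norm_trackField_sub_le c z₀)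
  refine ⟨h, hh, (d.norm_le_of_ae (memLp_pulse (d.trackConst c * ‖z₀‖)) ?_).trans_eq ?_⟩
  · filter_upwards [hh] with t ht
    rw [ht]
    have h1 := d.norm_trackField_sub_le c z₀ t (d.pos (d.evol t h)) 0
    have h2 := d.norm_trackField_zero_le c z₀ t
    have h3 := norm_sub_norm_le (d.trackField c z₀ t (d.pos (d.evol t h)))
      (d.trackField c z₀ t 0)
    rw [sub_zero] at h1
    linarith
  · rw [norm_toLp_pulse, Real.norm_of_nonneg (mul_nonneg (d.trackConst_nonneg c) (norm_nonneg _))]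

/-- The trajectory assembled from a solution of the Lyapunov-Perron equation and the cut off
original trajectory. -/
def trackCurve (h : Lp H 2 (volume : Measure ℝ)) (t : ℝ) : ModalSpace :=
  d.unshift t (d.evol t h) + (c.φ t • d.flow t z₀ + c.φ₁ t • d.embV (d.pos (d.flow t z₀)))

/-- Applying the linear wave operator to φu gives φF(u) plus `cutoffSource`. Both are subtracted in
`trackField`, which leaves F evaluated at the position of the whole curve. -/
theorem isModalSolution_trackCurve {h : Lp H 2 (volume : Measure ℝ)}
    (hh : ∀ᵐ t, h t = d.trackField c z₀ t (d.pos (d.evol t h))) :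
    d.IsModalSolution univ (d.trackCurve c z₀ h) := by
  have hz := d.isModalSolution_flow z₀
  have hw : Continuous fun t => d.pos (d.evol t h) := d.pos.continuous.comp (d.continuous_evol h)
  have hposc : ∀ t, d.pos (d.trackCurve c z₀ h t) =
      d.pos (d.unshift t (d.evol t h)) + c.φ t • d.pos (d.flow t z₀) := fun t => by
    simp [trackCurve]
  have hvelc : ∀ t, d.vel (d.trackCurve c z₀ h t) = d.vel (d.unshift t (d.evol t h)) +
      (c.φ t • d.vel (d.flow t z₀) + c.φ₁ t • d.pos (d.flow t z₀)) := fun t => by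
    simp [trackCurve]
  refine ⟨Continuous.continuousOn ?_, fun n t _ => ?_, fun n t ht => ?_⟩
  · have h1 := d.continuous_flow z₀
    exact (d.continuous_unshift_evol h).add ((c.continuous.smul h1).add
      (c.continuous₁.smul (d.embV.continuous.comp (d.pos.continuous.comp h1))))
  · simp only [hposc, hvelc, inner_add_left, real_inner_smul_left]
    refine ((d.hasDerivAt_pos_unshift_evol h n t).hasDerivWithinAt.fun_add
      ((c.deriv t).hasDerivWithinAt.fun_mul (hz.deriv_pos n t trivial))).congr_deriv ?_
    ring
  · have key := (d.hasDerivWithinAt_vel_unshift_evol ordConnected_univ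
      (d.continuous_trackField c z₀ hw).continuousOn (hh.mono fun t ht _ => ht) n ht).fun_add
      (((c.deriv t).hasDerivWithinAt.fun_mul (hz.deriv_vel n t trivial)).fun_add
        ((c.deriv₁ t).hasDerivWithinAt.fun_mul (hz.deriv_pos n t trivial)))
    have hF : Real.exp (-(d.θ * t)) • d.trackField c z₀ t (d.pos (d.evol t h)) =
        d.F (d.pos (d.trackCurve c z₀ h t)) - c.φ t • d.F (d.pos (d.flow t z₀))
          - d.cutoffSource c z₀ t := by
      rw [trackField, smul_smul, ← Real.exp_add, neg_add_cancel, Real.exp_zero, one_smul, hposc,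
        pos_unshift]
    rw [hF] at key
    have hfun : (fun s => ⟪d.vel (d.trackCurve c z₀ h s), d.e n⟫_ℝ) = fun s =>
        ⟪d.vel (d.unshift s (d.evol s h)), d.e n⟫_ℝ + (c.φ s * ⟪d.vel (d.flow s z₀), d.e n⟫_ℝ
          + c.φ₁ s * ⟪d.pos (d.flow s z₀), d.e n⟫_ℝ) := by
      funext s
      rw [hvelc, inner_add_left, inner_add_left, real_inner_smul_left, real_inner_smul_left]
    rw [hfun]
    refine key.congr_deriv ?_
    have hε := d.ε_pos.ne'
    rw [hposc t, hvelc t, cutoffSource]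
    simp only [inner_add_left, inner_sub_left, real_inner_smul_left]
    field_simp
    ring

end GapData
end

/-! ### The inertial manifold. -/

noncomputable section
open MeasureTheory Set Filter
open scoped NNReal ENNReal

namespace GapData

variable {H : Type*} [NormedAddCommGroup H] [InnerProductSpace ℝ H] (d : GapData H)

/-- The states whose backward trajectory is square integrable with the weight `exp (θ t)`. -/
def unstableSet : Set ModalSpace :=
  {z₀ | IntegrableOn (fun t => Real.exp (2 * d.θ * t) * ‖d.pos (d.flow t z₀)‖ ^ 2) (Iic 0)}

/-- A time shift multiplies the weight by a constant and changes the half-line by a bounded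
interval, on which the integrand is continuous. Negative s is allowed, which gives both inclusions
of strict invariance. -/
theorem flow_mem_unstableSet {z₀ : ModalSpace} (hz : z₀ ∈ d.unstableSet) (s : ℝ) :
    d.flow s z₀ ∈ d.unstableSet := by
  have hc : Continuous fun t => Real.exp (2 * d.θ * t) * ‖d.pos (d.flow t z₀)‖ ^ 2 :=
    Continuous.mul (by fun_prop) ((d.pos.continuous.comp (d.continuous_flow z₀)).norm.pow 2)
  have h1 : IntegrableOn (fun t => Real.exp (2 * d.θ * t) * ‖d.pos (d.flow t z₀)‖ ^ 2) (Iic s) := by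
    refine (IntegrableOn.union hz (hc.integrableOn_Icc (a := 0) (b := s))).mono_set fun t ht => ?_
    rcases le_or_gt t 0 with h | h
    · exact Or.inl h
    · exact Or.inr ⟨h.le, ht⟩
  have h2 := (measurePreserving_add_right volume s).integrableOn_comp_preimage
    (measurableEmbedding_addRight s) (s := Iic s)
    (f := fun t => Real.exp (2 * d.θ * t) * ‖d.pos (d.flow t z₀)‖ ^ 2)
  rw [preimage_add_const_Iic, sub_self] at h2
  refine ((h2.2 h1).const_mul (Real.exp (-(2 * d.θ * s)))).congr (Eventually.of_forall fun t => ?_)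
  simp only [Function.comp, WaveData.flow_add]
  rw [← mul_assoc, ← Real.exp_add]
  congr 2
  ring

theorem mem_unstableSet_of_isModalSolution {z : ℝ → ModalSpace} (hz : d.IsModalSolution (Iic 0) z)
    (hi : IntegrableOn (fun t => Real.exp (2 * d.θ * t) * ‖d.pos (z t)‖ ^ 2) (Iic 0)) :
    z 0 ∈ d.unstableSet := by
  refine hi.congr_fun (fun t ht => ?_) measurableSet_Iic
  simp only
  rw [hz.eq_flow ordConnected_Iic (mem_Iic.2 le_rfl) ht]

theorem backSolution_mem_unstableSet [CompleteSpace H] (p : H) :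
    d.backSolution p 0 ∈ d.unstableSet :=
  d.mem_unstableSet_of_isModalSolution (d.isModalSolution_backSolution p)
    (d.integrableOn_backSolution p)

theorem eq_backSolution_of_mem_unstableSet [CompleteSpace H] {z₀ : ModalSpace}
    (hz : z₀ ∈ d.unstableSet) : z₀ = d.backSolution (d.slow z₀) 0 := by
  simpa using d.eq_backSolution ((d.isModalSolution_flow z₀).mono (subset_univ _)) hz

theorem norm_unshift_evol_le (t : ℝ) (h : Lp H 2 (volume : Measure ℝ)) :
    ‖d.unshift t (d.evol t h)‖ ≤ Real.exp (-(d.θ * t)) * (d.unshiftConst * (d.evolConst * ‖h‖)) :=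
  (d.norm_unshift_le t _).trans (mul_le_mul_of_nonneg_left
    (mul_le_mul_of_nonneg_left (d.norm_evol_le t h) d.unshiftConst_nonneg) (Real.exp_pos _).le)

/-- Every trajectory is tracked by one on the unstable set. -/
theorem exists_tracking [CompleteSpace H] : ∃ C, 0 < C ∧ ∀ z₀ : ModalSpace,
    ∃ y₀ ∈ d.unstableSet, ∀ t, 0 ≤ t →
      ‖d.flow t z₀ - d.flow t y₀‖ ≤ C * ‖z₀‖ * Real.exp (-(d.θ * t)) := by
  obtain ⟨c⟩ := nonempty_cutoff
  have hgap : 0 < 1 - d.L / d.δ := by linarith [d.L_div_δ_lt_one]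
  have hev : 0 ≤ d.evolConst := Real.sqrt_nonneg _
  have hun := d.unshiftConst_nonneg
  have hg : 0 ≤ d.unitGrowth := (Real.exp_pos _).le
  have hB := c.B_nonneg
  have htc := d.trackConst_nonneg c
  set K := d.unshiftConst * (d.evolConst * (d.trackConst c / (1 - d.L / d.δ))) with hK
  set K' := (1 + c.B * (‖d.embV‖ * ‖d.pos‖)) * d.unitGrowth * Real.exp d.θ with hK'
  have hK0 : 0 ≤ K := by positivity
  have hK'0 : 0 ≤ K' := by positivity
  refine ⟨K + K' + 1, by positivity, fun z₀ => ?_⟩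
  obtain ⟨h, hh, hle⟩ := d.exists_trackSource c z₀
  have hsol := d.isModalSolution_trackCurve c z₀ hh
  have hflow : ∀ t, d.trackCurve c z₀ h t = d.flow t (d.trackCurve c z₀ h 0) := fun t =>
    hsol.eq_flow ordConnected_univ trivial (mem_univ t)
  refine ⟨d.trackCurve c z₀ h 0, ?_, fun t ht => ?_⟩
  -- For t ≤ 0 the cutoff vanishes and the curve is e^{-θt} times a function in L².
  · refine d.mem_unstableSet_of_isModalSolution (hsol.mono (subset_univ _)) ?_
    refine (d.memLp_pos_evol h).integrable_norm_sq_real.integrableOn.congr_fun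
      (fun t ht => ?_) measurableSet_Iic
    obtain ⟨h0, h1, -⟩ := c.left t ht
    simp only [trackCurve, h0, h1, zero_smul, add_zero, pos_unshift, norm_smul, mul_pow]
    rw [Real.norm_of_nonneg (Real.exp_pos _).le, ← mul_assoc, ← Real.exp_nat_mul, ← Real.exp_add]
    norm_num
    ring_nf
    simp
  · rw [← hflow t]
    rw [← le_div_iff₀' hgap] at hle
    have h1 : ‖d.unshift t (d.evol t h)‖ ≤ K * ‖z₀‖ * Real.exp (-(d.θ * t)) := by
      refine (d.norm_unshift_evol_le t h).trans ?_
      calc _ ≤ Real.exp (-(d.θ * t)) * (d.unshiftConst * (d.evolConst *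
            (d.trackConst c * ‖z₀‖ / (1 - d.L / d.δ)))) := by gcongr
        _ = _ := by rw [hK]; ring
    -- The cutoff error is zero for t ≥ 1; on [0, 1] it is bounded by a multiple of ‖z₀‖, and the
    -- factor e^θ in K' compensates for e^{-θt}.
    have h2 : ‖(1 - c.φ t) • d.flow t z₀ - c.φ₁ t • d.embV (d.pos (d.flow t z₀))‖ ≤
        K' * ‖z₀‖ * Real.exp (-(d.θ * t)) := by
      rcases le_total 1 t with ht1 | ht1
      · obtain ⟨e0, e1, -⟩ := c.right t ht1
        rw [e0, e1, sub_self, zero_smul, zero_smul, sub_self, norm_zero]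
        positivity
      · have hz := d.norm_flow_le_unitGrowth z₀ ht ht1
        have hexp : 1 ≤ Real.exp d.θ * Real.exp (-(d.θ * t)) := by
          rw [← Real.exp_add]
          exact Real.one_le_exp (by nlinarith [d.θ_pos])
        have a1 : ‖(1 - c.φ t) • d.flow t z₀‖ ≤ ‖d.flow t z₀‖ := by
          rw [norm_smul, Real.norm_of_nonneg (by linarith [c.le_one t])]
          exact mul_le_of_le_one_left (norm_nonneg _) (by linarith [c.nonneg t])
        have a2 : ‖c.φ₁ t • d.embV (d.pos (d.flow t z₀))‖ ≤
            c.B * (‖d.embV‖ * (‖d.pos‖ * ‖d.flow t z₀‖)) := by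
          rw [norm_smul]
          refine mul_le_mul (c.abs_le₁ t) ((d.embV.le_opNorm _).trans ?_) (norm_nonneg _) hB
          exact mul_le_mul_of_nonneg_left (d.pos.le_opNorm _) (norm_nonneg _)
        calc _ ≤ ‖d.flow t z₀‖ + c.B * (‖d.embV‖ * (‖d.pos‖ * ‖d.flow t z₀‖)) :=
              (norm_sub_le _ _).trans (add_le_add a1 a2)
          _ = (1 + c.B * (‖d.embV‖ * ‖d.pos‖)) * ‖d.flow t z₀‖ * 1 := by ring
          _ ≤ (1 + c.B * (‖d.embV‖ * ‖d.pos‖)) * (d.unitGrowth * ‖z₀‖) *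
              (Real.exp d.θ * Real.exp (-(d.θ * t))) := by gcongr
          _ = _ := by rw [hK']; ring
    have hdiff : d.flow t z₀ - d.trackCurve c z₀ h t =
        ((1 - c.φ t) • d.flow t z₀ - c.φ₁ t • d.embV (d.pos (d.flow t z₀)))
          - d.unshift t (d.evol t h) := by
      rw [trackCurve, sub_smul, one_smul]; abel
    rw [hdiff]
    refine (norm_sub_le _ _).trans ((add_le_add h2 h1).trans ?_)
    have : 0 ≤ ‖z₀‖ * Real.exp (-(d.θ * t)) := by positivity
    nlinarith

/-- The inertial manifold. -/
def manifold : Set (energySpace d.e d.lam) := {ξ | d.ofEnergy ξ ∈ d.unstableSet}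

theorem toEnergy_mem_manifold {z : ModalSpace} : d.toEnergy z ∈ d.manifold ↔ z ∈ d.unstableSet := by
  change d.ofEnergy (d.toEnergy z) ∈ d.unstableSet ↔ _
  rw [WaveData.ofEnergy_toEnergy]

theorem energyNorm_toEnergy_sub (z w : ModalSpace) :
    energyNorm d.e d.lam d.ε ((d.toEnergy z : H × H) - (d.toEnergy w : H × H)) =
      energyNorm d.e d.lam d.ε (d.pos (z - w), d.vel (z - w)) := by
  rw [map_sub, map_sub]; rfl

variable [CompleteSpace H] {A : H →ₗ.[ℝ] H}

/-- By backward uniqueness, a solution on (-∞, 0] is the restriction of the flow through its value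
at 0, so the existence of a solution becomes a condition on the flow. -/
theorem manifold_eq (hA : IsPositiveSelfAdjointCompactInverse A) (he : IsEigensystem A d.e d.lam) :
    d.manifold = {ξ₀ | ∃ ξ : ℝ → energySpace d.e d.lam,
      IsSolutionOn A d.e d.lam d.F d.ε (Iic 0) ξ ∧
        MemWeightedL2 d.θ (Iic 0) (fun t => (ξ t : H × H).1) ∧ ξ 0 = ξ₀} := by
  ext ξ₀
  constructor
  · intro h
    have hc : Continuous fun t => d.pos (d.flow t (d.ofEnergy ξ₀)) :=
      d.pos.continuous.comp (d.continuous_flow _)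
    refine ⟨fun t => d.toEnergy (d.flow t (d.ofEnergy ξ₀)),
      ((d.isModalSolution_flow _).mono (subset_univ _)).isSolutionOn _ he hA ordConnected_Iic,
      ⟨?_, ?_⟩, by simp⟩
    · simp only [WaveData.toEnergy_fst]
      exact hc.aestronglyMeasurable
    · simp only [WaveData.toEnergy_fst]
      exact h
  · rintro ⟨ξ, hξ, hi, rfl⟩
    have h1 := hi.2
    have h2 := d.mem_unstableSet_of_isModalSolution (d.isModalSolution_of_isSolutionOn he hξ)
    simp only [WaveData.pos_ofEnergy] at h2
    exact h2 h1

/-- The parametrization of the inertial manifold by the slow components. -/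
def parametrization (p : spectralSpace d.e d.N) : energySpace d.e d.lam :=
  d.toEnergy (d.backSolution p 0)

theorem slowProjection_parametrization (p : spectralSpace d.e d.N) :
    slowProjection d.e d.lam d.ε d.N (d.parametrization p) = p := by
  rw [← d.slow_backSolution p.2, slow_apply]; rfl

theorem isLipschitzParametrization :
    IsLipschitzParametrization d.e d.lam d.ε d.N d.parametrization d.manifold where
  range_eq := by
    ext ξ
    constructor
    · rintro ⟨p, rfl⟩
      exact d.toEnergy_mem_manifold.2 <| d.backSolution_mem_unstableSet _
    · intro h
      refine ⟨⟨d.slow (d.ofEnergy ξ), d.slow_mem_spectralSpace _⟩, ?_⟩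
      rw [parametrization, ← d.eq_backSolution_of_mem_unstableSet h, WaveData.toEnergy_ofEnergy]
  lipschitz := by
    obtain ⟨K, hK⟩ := d.norm_backSolution_sub_le
    refine ⟨d.normConst * K, fun p q => ?_⟩
    rw [parametrization, parametrization, energyNorm_toEnergy_sub, mul_assoc]
    exact (d.energyNorm_le _).trans (mul_le_mul_of_nonneg_left (hK p q) d.normConst_pos.le)
  lipschitz_inverse := by
    -- The slow projection is a bounded left inverse of the parametrization.
    refine ⟨‖d.slow‖, fun p q => ?_⟩
    rw [parametrization, parametrization, energyNorm_toEnergy_sub, Submodule.coe_norm,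
      Submodule.coe_sub]
    nth_rw 1 [← d.slow_backSolution p.2, ← d.slow_backSolution q.2]
    rw [← map_sub]
    exact (d.slow.le_opNorm _).trans (mul_le_mul_of_nonneg_left (d.norm_le_energyNorm _)
      (norm_nonneg _))

theorem isInertialManifold : IsInertialManifold d.e d.lam d.ε d.N d.semigroup d.θ d.manifold where
  submanifold := ⟨_, d.isLipschitzParametrization⟩
  invariant t _ := by
    ext ξ
    constructor
    · rintro ⟨η, hη, rfl⟩
      exact d.toEnergy_mem_manifold.2 <| d.flow_mem_unstableSet hη t
    · intro hξ
      refine ⟨d.toEnergy (d.flow (-t) (d.ofEnergy ξ)), ?_, ?_⟩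
      · exact d.toEnergy_mem_manifold.2 (d.flow_mem_unstableSet hξ _)
      · simp [WaveData.semigroup, ← WaveData.flow_add]
  rate_pos := d.θ_pos
  tracking := by
    obtain ⟨C, hC, hT⟩ := d.exists_tracking
    refine ⟨d.normConst * C, mul_pos d.normConst_pos hC, fun ξ₀ => ?_⟩
    obtain ⟨y₀, hy, hy'⟩ := hT (d.ofEnergy ξ₀)
    refine ⟨d.toEnergy y₀, d.toEnergy_mem_manifold.2 hy, fun t ht => ?_⟩
    · have h1 : ‖d.ofEnergy ξ₀‖ ≤ energyNorm d.e d.lam d.ε ξ₀ := by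
        simpa using d.norm_le_energyNorm (d.ofEnergy ξ₀)
      rw [WaveData.semigroup, WaveData.semigroup, energyNorm_toEnergy_sub,
        WaveData.ofEnergy_toEnergy, neg_mul]
      calc _ ≤ d.normConst * (C * ‖d.ofEnergy ξ₀‖ * Real.exp (-(d.θ * t))) :=
            (d.energyNorm_le _).trans (mul_le_mul_of_nonneg_left (hy' t ht) d.normConst_pos.le)
        _ ≤ d.normConst * (C * energyNorm d.e d.lam d.ε ξ₀ * Real.exp (-(d.θ * t))) := by
            have := d.normConst_pos
            gcongr
        _ = _ := by ring

end GapData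
end

theorem theorem2p1 {H : Type*} [NormedAddCommGroup H] [InnerProductSpace ℝ H] [CompleteSpace H]
    (A : H →ₗ.[ℝ] H) (hA : IsPositiveSelfAdjointCompactInverse A)
    (e : HilbertBasis ℕ+ ℝ H) (lam : ℕ+ → ℝ) (he : IsEigensystem A e lam)
    (F : H → H) (L : ℝ) (hF : ∀ u₁ u₂ : H, ‖F u₁ - F u₂‖ ≤ L * ‖u₁ - u₂‖) (hF0 : F 0 = 0)
    (ε : ℝ) (hε : 0 < ε) (N : ℕ+)
    (hgap : lam (N + 1) - lam N > 2 * L) (hgap' : 3 * lam (N + 1) + lam N ≤ 1 / ε) :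
    ∃ θ : ℝ, IsLeast {x : ℝ | 2 * x * (ε * x - 1) + lam (N + 1) + lam N = 0} θ ∧
    ∃ S : ℝ → energySpace e lam → energySpace e lam, IsSolutionSemigroup A e lam F ε S ∧
    ∃ 𝓜 : Set (energySpace e lam),
      IsInertialManifold e lam ε N S θ 𝓜 ∧
      𝓜 = {ξ₀ | ∃ ξ : ℝ → energySpace e lam, IsSolutionOn A e lam F ε (Set.Iic 0) ξ ∧
        MemWeightedL2 θ (Set.Iic 0) (fun t => (ξ t : H × H).1) ∧ ξ 0 = ξ₀} ∧
      ∃ M : spectralSpace e N → energySpace e lam,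
        IsLipschitzParametrization e lam ε N M 𝓜 ∧ Function.Injective M ∧
        ∀ p : spectralSpace e N, slowProjection e lam ε N (M p) = (p : H) := by
  -- The Lipschitz estimate between a unit vector and 0 forces the sign of L.
  have hL : 0 ≤ L := by
    have h := (norm_nonneg _).trans (hF (e 1) 0)
    rwa [sub_zero, e.orthonormal.norm_eq_one, mul_one] at h
  let d : GapData H :=
    { e := e, lam := lam, ε := ε, ε_pos := hε, lam_pos := he.lam_pos hA, mono := he.monotone,
      F := F, L := L, L_nonneg := hL, F_lip := hF, F_zero := hF0, N := N, gap := hgap,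
      gap_le := hgap' }
  have hM := d.slowProjection_parametrization
  refine ⟨d.θ, d.isLeast_θ, d.semigroup, d.isSolutionSemigroup he hA, d.manifold,
    d.isInertialManifold, d.manifold_eq hA he, d.parametrization, d.isLipschitzParametrization,
    fun p q hpq => ?_, hM⟩
  exact Subtype.ext ((hM p).symm.trans ((congrArg (fun ξ : energySpace e lam =>
    slowProjection e lam ε N (ξ : H × H)) hpq).trans (hM q)))
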